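/- **Setting.** Let $\mathfrak g$ be a classical complex simple Lie algebra in its defining representation by $d\times d$ matrices: $\mathfrak{sl}_d$ ($d\ge2$, type A), $\mathfrak{so}_d$ ($d\ge 3$, $d\neq4$, types B and D) or $\mathfrak{sp}_d$ ($d\ge2$ even, type C). Let $T^a$, $T_a$ be bases of $\mathfrak g$ with $\mathrm{Tr}(T^aT_b)=\delta^a_b$, and $C_{12}=\sum_a T^a\otimes T_a$. Let $\sigma$ be an automorphism of $\mathfrak g$ of order $T\ge1$ of the form $X\mapsto QXQ^{-1}$ or $X\mapsto -QX^{\mathsf T}Q^{-1}$ with $Q\in GL_d(\mathbb C)$ (this excludes only automorphisms of $\mathfrak{so}_8$ coming from triality), let $\omega$ be a primitive $T$-th root of unity, and put $$\mathcal R^0_{12}(\lambda,\mu)=\frac1T\sum_{k=0}^{T-1}\frac{\sigma_1^kC_{12}}{\mu-\omega^{-k}\lambda}.$$ Let $\varphi\neq0$ be a rational function (the twist function) with $\varphi(\omega\lambda)=\omega^{-1}\varphi(\lambda)$, and $\mathcal R_{12}(\lambda,\mu)=\mathcal R^0_{12}(\lambda,\mu)\varphi(\mu)^{-1}$. Consider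 a commutative differential algebra $\mathcal A$ over $\mathbb C$ of local fields in one space variable $x$, with a local Poisson bracket $\{a(x),b(y)\}=\sum_{n\ge0}(a_{(n)}b)(y)\,\partial_y^n\delta_{xy}/n!$ (finite sums; bilinear, compatible with $\partial_x$, skew-symmetric, satisfying the Jacobi and Leibniz identities, that is, a Poisson vertex algebra), where $\delta_{xy}=\delta(x-y)$ and $\delta'_{xy}=\partial_x\delta(x-y)$. Boundary terms are discarded: $\int dx\,a(x)$ denotes the class of $a$ modulo total derivatives, and $\{\int dx\,a(x),b\}=a_{(0)}b$. Let $\mathcal L(\lambda,x)=\sum_a L_a(\lambda,x)T^a$ with $L_a(\lambda,\cdot)\in\mathcal A$ be a Lax matrix, defined for $\lambda$ outside a closed discrete subset of $\mathbb C$, such that $\sigma(\mathcal L(\lambda,x))=\mathcal L(\omega\lambda,x)$ and $$\{\mathcal L(\lambda,x)_1,\mathcal L(\mu,y)_2\}=[\mathcal R_{12}(\lambda,\mu),\mathcal L(\lambda,x)_1]\delta_{xy}-[\mathcal R_{21}(\mu,\lambda),\mathcal L(\mu,x)_2]\delta_{xy}-\bigl(\mathcal R_{12}(\lambda,\mu)+\mathcal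 R_{21}(\mu,\lambda)\bigr)\delta'_{xy}$$ whenever both sides are defined. A zero $\lambda_0\in\mathbb C$ of $\varphi$ is *regular* if $S(\lambda,x)=\varphi(\lambda)\mathcal L(\lambda,x)$ is holomorphic at $\lambda_0$, i.e. near $\lambda_0$ (up to a removable singularity) each component of $S$ is a finite sum of holomorphic functions of $\lambda$ times fixed fields. Let $\mathcal Z\subset\mathbb C$ be a set of regular zeros of $\varphi$ such that the orbits $\{\omega^k\lambda_0\}_k$ of distinct points of $\mathcal Z$ are disjoint. **Degrees.** Call $\lambda_0\in\mathcal Z$ *cyclotomic* if $T>1$ and $\lambda_0=0$. Let $\kappa=1+T/2$ if $\mathfrak g$ is of type A and $\sigma$ is not inner, and $\kappa=1$ otherwise. Let $r_n\in\{0,\dots,T-1\}$ be the remainder of $-n\kappa$ modulo $T$ if $\lambda_0$ is cyclotomic, and $r_n=0$ otherwise. Let $\mathcal E_{\lambda_0}$ be the set of integers $n\ge2$ such that $d\nmid n-1$ in type A, $n$ is even in types B, C, D, and, if $\lambda_0$ is cyclotomic, $r_n\ne T-1$. **Charges and matrices.** Let $\mathscr T_k(\lambda,x)=\mathrm{Tr}\,S(\lambda,x)^k$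 and $$\mathcal N_k(\lambda;\rho,x)=k\,\mathrm{Tr}_2\bigl(\mathcal R^0_{12}(\rho,\lambda)\,S(\lambda,x)^{k-1}_2\bigr).$$ In type A, unless $\lambda_0$ is cyclotomic and $\sigma$ is inner, let $\mathcal W_n(\lambda,x)$ be the coefficient of $\mu^n$ in $$\exp\Bigl(-\frac{n-1}{d}\sum_{k\ge2}\frac{\mu^k}{k}\mathscr T_k(\lambda,x)\Bigr);$$ in all other cases let $\mathcal W_n=\mathscr T_n$. Regard $\mathcal W_n$ as a polynomial in the $\mathscr T_k$ and put $\mathcal M_n(\lambda;\rho,x)=\sum_k\frac{\partial\mathcal W_n}{\partial\mathscr T_k}(\lambda,x)\,\mathcal N_k(\lambda;\rho,x)$. For $\lambda_0\in\mathcal Z$ and $n\in\mathcal E_{\lambda_0}$, let $\mathcal K_n^{\lambda_0}(x)$ and $\mathcal M_n^{\lambda_0}(\rho,x)$ be the coefficients of $(\lambda-\lambda_0)^{r_n}$ in the Taylor expansions at $\lambda_0$ of $\mathcal W_n(\lambda,x)$ and $\mathcal M_n(\lambda;\rho,x)$, the latter for $\rho$ outside the orbit $\{\omega^k\lambda_0\}_k$,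 and let $\mathcal Q_n^{\lambda_0}=\int dx\,\mathcal K_n^{\lambda_0}(x)$. **Theorem.** Let $\lambda_0,\mu_0\in\mathcal Z$ (equal or distinct), $n\in\mathcal E_{\lambda_0}$ and $m\in\mathcal E_{\mu_0}$. Then, for every $\lambda\in\mathbb C$ outside the orbits of $\lambda_0$ and $\mu_0$ under multiplication by $\omega$, $$\{\mathcal Q_n^{\lambda_0},\mathcal M_m^{\mu_0}(\lambda,x)\}-\{\mathcal Q_m^{\mu_0},\mathcal M_n^{\lambda_0}(\lambda,x)\}+[\mathcal M_n^{\lambda_0}(\lambda,x),\mathcal M_m^{\mu_0}(\lambda,x)]=0 .$$ -/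

import Mathlib

open scoped Topology Kronecker

attribute [local instance] LieRing.ofAssociativeRing

noncomputable section

namespace RSHierarchy

/-! ### Local fields, local Poisson brackets, local functionals -/

/-- A commutative differential algebra `𝒜` of local fields `a(x)` of a one-dimensional field theory
(`der` is the spatial derivative `∂ₓ`), with a local Poisson bracket
`{a(x), b(y)} = ∑ₙ (a₍ₙ₎b)(y) ∂_yⁿ δ(x - y) / n!`  (a finite sum), where `a₍ₙ₎b = prod n a b`.
The axioms are compatibility with `∂ₓ`, skew-symmetry, the Jacobi identity and the Leibniz rule,
that is, `𝒜` is a Poisson vertex algebra. -/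
class LocalPoissonAlgebra (𝒜 : Type*) [CommRing 𝒜] [Algebra ℂ 𝒜] where
  der : Derivation ℂ 𝒜 𝒜
  prod : ℕ → 𝒜 →ₗ[ℂ] 𝒜 →ₗ[ℂ] 𝒜
  locality : ∀ a b, ∃ N, ∀ n, N ≤ n → prod n a b = 0
  prod_zero_der_left : ∀ a b, prod 0 (der a) b = 0
  prod_succ_der_left : ∀ n a b, prod (n + 1) (der a) b = -((n + 1 : ℂ) • prod n a b)
  prod_zero_der_right : ∀ a b, prod 0 a (der b) = der (prod 0 a b)
  prod_succ_der_right : ∀ n a b,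
    prod (n + 1) a (der b) = der (prod (n + 1) a b) + (n + 1 : ℂ) • prod n a b
  skew : ∀ n a b, prod n a b =
    -∑ᶠ j : ℕ, ((-1 : ℂ) ^ (n + j) / (Nat.factorial j : ℂ)) • (⇑der)^[j] (prod (n + j) b a)
  jacobi : ∀ m n a b c, prod m a (prod n b c) - prod n b (prod m a c) =
    ∑ j ∈ Finset.range (m + 1), (Nat.choose m j : ℂ) • prod (m + n - j) (prod j a b) c
  leibniz : ∀ n a b c, prod n a (b * c) = prod n a b * c + b * prod n a c

section LocalFunctionals

variable (𝒜 : Type*) [CommRing 𝒜] [Algebra ℂ 𝒜] [LocalPoissonAlgebra 𝒜]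

/-- Local functionals `∫ dx a(x)`: densities modulo total derivatives. -/
abbrev LocalFunctional : Type _ :=
  𝒜 ⧸ LinearMap.range (LocalPoissonAlgebra.der (𝒜 := 𝒜)).toLinearMap

variable {𝒜}

/-- `∫ dx a(x)`. -/
def integral (a : 𝒜) : LocalFunctional 𝒜 := Submodule.Quotient.mk a

/-- The Poisson bracket `{Q, b(y)}` of a local functional with a local field. For `Q = ∫ dx a(x)`,
integrating `{a(x), b(y)}` over `x` leaves `a₍₀₎b`. -/
def flow : LocalFunctional 𝒜 →ₗ[ℂ] 𝒜 →ₗ[ℂ] 𝒜 :=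
  Submodule.liftQ _ (LocalPoissonAlgebra.prod 0) (by
    rintro _ ⟨a, rfl⟩
    ext b
    exact LocalPoissonAlgebra.prod_zero_der_left a b)

end LocalFunctionals

/-! ### Holomorphic field-valued functions of the spectral parameter -/

section Holomorphic

variable {𝒜 : Type*} [CommRing 𝒜] [Algebra ℂ 𝒜]

/-- `F` is (up to a removable singularity at `z`) holomorphic at `z` with values in the vector space
`𝒜`, i.e. near `z` it is a finite combination of fixed fields with holomorphic coefficients, and
`s = ∑ᵣ sᵣ Xʳ` is its expansion `F(z + X)`. -/
def HasExpansionAt (F : ℂ → 𝒜) (z : ℂ) (s : PowerSeries 𝒜) : Prop :=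
  ∃ (N : ℕ) (f : Fin N → ℂ → ℂ) (c : Fin N → 𝒜),
    (∀ i, AnalyticAt ℂ (f i) z) ∧
    (∀ᶠ w in 𝓝[≠] z, F w = ∑ i, f i w • c i) ∧
    ∀ r : ℕ, PowerSeries.coeff r s =
      ∑ i, (iteratedDeriv r (f i) z / (Nat.factorial r : ℂ)) • c i

theorem HasExpansionAt.unique {F : ℂ → 𝒜} {z : ℂ} {s t : PowerSeries 𝒜}
    (hs : HasExpansionAt F z s) (ht : HasExpansionAt F z t) : s = t := by
  obtain ⟨N, f, c, hf, hF, hc⟩ := hs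
  obtain ⟨M, g, d, hg, hG, hd⟩ := ht
  ext r
  rw [← sub_eq_zero, ← Module.forall_dual_apply_eq_zero_iff ℂ]
  intro ℓ
  have han1 : AnalyticAt ℂ (fun w => ∑ i, f i w * ℓ (c i)) z :=
    Finset.analyticAt_fun_sum _ fun i _ => (hf i).mul analyticAt_const
  have han2 : AnalyticAt ℂ (fun w => ∑ i, g i w * ℓ (d i)) z :=
    Finset.analyticAt_fun_sum _ fun i _ => (hg i).mul analyticAt_const
  have heq : (fun w => ∑ i, f i w * ℓ (c i)) =ᶠ[𝓝 z] (fun w => ∑ i, g i w * ℓ (d i)) := by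
    refine (han1.frequently_eq_iff_eventually_eq han2).1 (Filter.Eventually.frequently ?_)
    filter_upwards [hF, hG] with w h1 h2
    have := congrArg ℓ (h1.symm.trans h2)
    simpa [map_sum] using this
  have key : ∀ {K : ℕ} (h : Fin K → ℂ → ℂ) (e : Fin K → 𝒜), (∀ i, AnalyticAt ℂ (h i) z) →
      ℓ (∑ i, (iteratedDeriv r (h i) z / (Nat.factorial r : ℂ)) • e i) =
        iteratedDeriv r (fun w => ∑ i, h i w * ℓ (e i)) z / (Nat.factorial r : ℂ) := by
    intro K h e hh
    have h1 : iteratedDeriv r (fun w => ∑ i, h i w * ℓ (e i)) z =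
        ∑ i, iteratedDeriv r (h i) z * ℓ (e i) := by
      have hc : ∀ i ∈ Finset.univ, ContDiffAt ℂ r (fun w => h i w * ℓ (e i)) z := fun i _ =>
        ((hh i).mul (analyticAt_const (v := ℓ (e i)))).contDiffAt
      rw [iteratedDeriv_fun_sum hc]
      refine Finset.sum_congr rfl fun i _ => ?_
      have : (fun w => h i w * ℓ (e i)) = fun w => ℓ (e i) * h i w := by
        funext w; ring
      rw [this, iteratedDeriv_const_mul_field, mul_comm]
    rw [h1, Finset.sum_div, map_sum]
    refine Finset.sum_congr rfl fun i _ => ?_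
    simp only [map_smul, smul_eq_mul]
    ring
  rw [map_sub, hc r, hd r, key f c hf, key g d hg, heq.iteratedDeriv_eq, sub_self]

open Classical in
/-- The expansion `F(z + X)` of a function holomorphic at `z`. -/
def expansion (F : ℂ → 𝒜) (z : ℂ) : PowerSeries 𝒜 :=
  if h : ∃ s, HasExpansionAt F z s then h.choose else 0

end Holomorphic

/-! ### Classical Lie algebras -/

/-- The types of the classical simple Lie algebras. -/
inductive ClassicalType
  | A
  | BD
  | C

/-- `g` is the classical simple Lie algebra of the given type in its defining representation:
`sl(d)` with `d ≥ 2`, `so(d)` with `d ≥ 3`, `d ≠ 4`, or `sp(2l)` with `l ≥ 1`. -/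
def IsDefiningRep {ι : Type*} [Fintype ι] [DecidableEq ι] :
    ClassicalType → LieSubalgebra ℂ (Matrix ι ι ℂ) → Prop
  | .A, g => 2 ≤ Fintype.card ι ∧ g = LieAlgebra.SpecialLinear.sl ι ℂ
  | .BD, g => 3 ≤ Fintype.card ι ∧ Fintype.card ι ≠ 4 ∧ g = LieAlgebra.Orthogonal.so ι ℂ
  | .C, g => ∃ (l : ℕ) (e : Fin l ⊕ Fin l ≃ ι), 1 ≤ l ∧
      ∀ X : Matrix ι ι ℂ, X ∈ g ↔ X.submatrix e e ∈ LieAlgebra.Symplectic.sp (Fin l) ℂ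

/-- The partial trace over the second tensor factor. -/
def partialTrace₂ {ι R : Type*} [Fintype ι] [CommRing R] (Z : Matrix (ι × ι) (ι × ι) R) :
    Matrix ι ι R :=
  Matrix.of fun i k => ∑ j, Z (i, j) (k, j)

/-- `Z₁₂ ↦ Z₂₁`. -/
def flip₁₂ {ι R : Type*} (Z : Matrix (ι × ι) (ι × ι) R) : Matrix (ι × ι) (ι × ι) R :=
  Z.submatrix Prod.swap Prod.swap

/-! ### The `r/s`-system with twist function -/

/-- The data of a model: a Lie algebra `g` of matrices, dual bases `Tᵃ`, `Tₐ`, an automorphism `σ`,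
its order `T`, a root of unity `ω`, the twist function `φ` and the Lax matrix
`𝓛(λ, x) = ∑ₐ Lₐ(λ, x) Tᵃ`, defined for `λ` in `dom`. -/
structure ModelData (𝒜 ι κ : Type*) [CommRing 𝒜] [Algebra ℂ 𝒜] [Fintype ι] [DecidableEq ι]
    [Fintype κ] where
  type : ClassicalType
  g : LieSubalgebra ℂ (Matrix ι ι ℂ)
  basis : Module.Basis κ ℂ g
  dualBasis : κ → g
  σ : g ≃ₗ⁅ℂ⁆ g
  T : ℕ
  ω : ℂ
  φ : RatFunc ℂ
  dom : Set ℂ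
  L : ℂ → κ → 𝒜

namespace ModelData

variable {𝒜 ι κ : Type*} [CommRing 𝒜] [Algebra ℂ 𝒜] [Fintype ι] [DecidableEq ι] [Fintype κ]
variable (S : ModelData 𝒜 ι κ)

/-- The value `φ(z)`. -/
def phi (z : ℂ) : ℂ := S.φ.eval (RingHom.id ℂ) z

/-- `σ` as a linear endomorphism of `g`. -/
def sigmaEnd : Module.End ℂ S.g := (S.σ : S.g →ₗ[ℂ] S.g)

/-- `σ(X) = Q X Q⁻¹` for some invertible matrix `Q`. For `sl(d)` this says that `σ` is inner. -/
def IsConj : Prop :=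
  ∃ Q : GL ι ℂ, ∀ X : S.g,
    (S.σ X : Matrix ι ι ℂ) = (Q : Matrix ι ι ℂ) * X * ((Q⁻¹ : GL ι ℂ) : Matrix ι ι ℂ)

/-- `σ(X) = -Q Xᵀ Q⁻¹` for some invertible matrix `Q`. -/
def IsNegTransposeConj : Prop :=
  ∃ Q : GL ι ℂ, ∀ X : S.g,
    (S.σ X : Matrix ι ι ℂ) =
      -((Q : Matrix ι ι ℂ) * (X : Matrix ι ι ℂ).transpose * ((Q⁻¹ : GL ι ℂ) : Matrix ι ι ℂ))

/-- The `g`-valued field `∑ₐ vₐ τ(Tᵃ)` as a matrix of fields, for an endomorphism `τ` of `g`. -/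
def toMatrix {R : Type*} [CommRing R] [Algebra ℂ R] (τ : Module.End ℂ S.g) (v : κ → R) :
    Matrix ι ι R :=
  ∑ a, v a • (τ (S.basis a) : Matrix ι ι ℂ).map (algebraMap ℂ R)

/-- The Lax matrix `𝓛(λ, x)`. -/
def lax (z : ℂ) : Matrix ι ι 𝒜 := S.toMatrix 1 (S.L z)

/-- `σ₁ᵏ C₁₂`, where `C₁₂ = ∑ₐ Tᵃ ⊗ Tₐ` is the Casimir tensor. -/
def twistedCasimir (k : ℕ) : Matrix (ι × ι) (ι × ι) ℂ :=
  ∑ a, ((S.sigmaEnd ^ k) (S.basis a) : Matrix ι ι ℂ) ⊗ₖ (S.dualBasis a : Matrix ι ι ℂ)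

/-- `(1/T) ∑_{k<T} cₖ σ₁ᵏ C₁₂`. -/
def cyclicSum {R : Type*} [CommRing R] [Algebra ℂ R] (c : ℕ → R) : Matrix (ι × ι) (ι × ι) R :=
  (S.T : ℂ)⁻¹ • ∑ k ∈ Finset.range S.T, c k • (S.twistedCasimir k).map (algebraMap ℂ R)

/-- `𝓡⁰₁₂(λ, μ) = (1/T) ∑_{k<T} σ₁ᵏ C₁₂ / (μ - ω⁻ᵏ λ)`. -/
def R0 (l m : ℂ) : Matrix (ι × ι) (ι × ι) ℂ := S.cyclicSum fun k => (m - (S.ω ^ k)⁻¹ * l)⁻¹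

/-- `𝓡₁₂(λ, μ) = 𝓡⁰₁₂(λ, μ) φ(μ)⁻¹`. -/
def R (l m : ℂ) : Matrix (ι × ι) (ι × ι) ℂ := (S.phi m)⁻¹ • S.R0 l m

/-- The expansion of `𝓡⁰₁₂(ρ, z + X)` in powers of `X`. -/
def R0Expansion (ρ z : ℂ) : Matrix (ι × ι) (ι × ι) (PowerSeries ℂ) :=
  S.cyclicSum fun k => (PowerSeries.C (z - (S.ω ^ k)⁻¹ * ρ) + PowerSeries.X)⁻¹

/-- `z` is a regular zero of `φ`: `φ(z) = 0` and `φ(λ) 𝓛(λ, x)` is holomorphic at `λ = z`. -/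
def IsRegularZero (z : ℂ) : Prop :=
  S.φ.num.IsRoot z ∧ ∀ a, ∃ s, HasExpansionAt (fun l => S.phi l • S.L l a) z s

/-- The cyclotomic finite point is the origin, if `T > 1`. -/
def IsCyclotomic (z : ℂ) : Prop := 1 < S.T ∧ z = 0

open Classical in
/-- `1`, or `1 + T/2` if `g = sl(d)` and `σ` is not inner. -/
def kappa : ℕ := if S.IsConj then 1 else 1 + S.T / 2

open Classical in
/-- The order `rₙ` of the coefficient that is extracted at `z`: the remainder of `-nκ` modulo `T` at
a cyclotomic point, and `0` at a non-cyclotomic one. -/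
def r (z : ℂ) (n : ℕ) : ℕ :=
  if S.IsCyclotomic z then ((-((n * S.kappa : ℕ) : ℤ)) % (S.T : ℤ)).toNat else 0

/-- The set `𝓔_z` of degrees at the regular zero `z`: one plus the exponents of the affine
Kac-Moody algebra of `g` (without those of the Pfaffian in type D), where the degrees `n` with
`rₙ = T - 1` are dropped if `z` is cyclotomic. -/
def degrees (z : ℂ) : Set ℕ :=
  {n | 2 ≤ n ∧
    (match S.type with
      | .A => ¬ Fintype.card ι ∣ n - 1
      | .BD => Even n
      | .C => Even n) ∧
    (S.IsCyclotomic z → S.r z n ≠ S.T - 1)}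

/-- The coefficient of `μⁿ` in `exp (-((n-1)/d) ∑_{k≥2} (μᵏ/k) tₖ)`, as a polynomial in the
variables `tₖ`. -/
def genPoly (d n : ℕ) : MvPolynomial ℕ ℂ :=
  let F : PowerSeries (MvPolynomial ℕ ℂ) := PowerSeries.mk fun k =>
    if 2 ≤ k then MvPolynomial.C (-((n : ℂ) - 1) / ((d : ℂ) * (k : ℂ))) * MvPolynomial.X k else 0
  ∑ j ∈ Finset.range (n + 1),
    MvPolynomial.C (1 / (Nat.factorial j : ℂ)) * PowerSeries.coeff n (F ^ j)

open Classical in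
/-- The polynomial expressing `𝓦ₙ` through the `𝓣ₖ`: the generating function in type A, except at a
cyclotomic point when `σ` is inner, and `𝓦ₙ = 𝓣ₙ` in all other cases. -/
def currentPoly (z : ℂ) (n : ℕ) : MvPolynomial ℕ ℂ :=
  match S.type with
  | .A => if S.IsCyclotomic z ∧ S.IsConj then MvPolynomial.X n else genPoly (Fintype.card ι) n
  | .BD => MvPolynomial.X n
  | .C => MvPolynomial.X n

/-- `S(λ, x) = φ(λ) 𝓛(λ, x)` at `λ = z + X`. -/
def SExpansion (z : ℂ) : Matrix ι ι (PowerSeries 𝒜) :=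
  S.toMatrix 1 fun a => expansion (fun l => S.phi l • S.L l a) z

/-- `𝓣ₖ(λ, x) = Tr (S(λ, x)ᵏ)` at `λ = z + X`. -/
def TExpansion (z : ℂ) (k : ℕ) : PowerSeries 𝒜 := (S.SExpansion z ^ k).trace

/-- `𝓦ₙ(λ, x)` at `λ = z + X`. -/
def WExpansion (z : ℂ) (n : ℕ) : PowerSeries 𝒜 :=
  MvPolynomial.aeval (S.TExpansion z) (S.currentPoly z n)

/-- `𝓝ₖ(λ; ρ, x) = k Tr₂ (𝓡⁰₁₂(ρ, λ) S(λ, x)₂ᵏ⁻¹)` at `λ = z + X`. -/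
def NExpansion (z : ℂ) (k : ℕ) (ρ : ℂ) : Matrix ι ι (PowerSeries 𝒜) :=
  (k : PowerSeries 𝒜) • partialTrace₂
    ((S.R0Expansion ρ z).map (PowerSeries.map (algebraMap ℂ 𝒜)) *
      ((1 : Matrix ι ι (PowerSeries 𝒜)) ⊗ₖ (S.SExpansion z ^ (k - 1))))

/-- `𝓜ₙ(λ; ρ, x)` at `λ = z + X`: it is obtained from the polynomial `𝓦ₙ` in the `𝓣ₖ` by replacing
each monomial `𝓣_{m₁} ⋯ 𝓣_{mₚ}` by `∑ₖ (∏_{j≠k} 𝓣_{mⱼ}) 𝓝_{mₖ}`. -/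
def MExpansion (z : ℂ) (n : ℕ) (ρ : ℂ) : Matrix ι ι (PowerSeries 𝒜) :=
  ∑ k ∈ Finset.range (n + 1),
    MvPolynomial.aeval (S.TExpansion z) (MvPolynomial.pderiv k (S.currentPoly z n)) •
      S.NExpansion z k ρ

/-- The current `𝓚ₙ` at the regular zero `z`: the coefficient of `(λ - z)^{rₙ}` in `𝓦ₙ(λ, x)`. -/
def K (z : ℂ) (n : ℕ) : 𝒜 := PowerSeries.coeff (S.r z n) (S.WExpansion z n)

/-- The matrix `𝓜ₙ(ρ, x)` at the regular zero `z`: the coefficient of `(λ - z)^{rₙ}` in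
`𝓜ₙ(λ; ρ, x)`. -/
def M (z : ℂ) (n : ℕ) (ρ : ℂ) : Matrix ι ι 𝒜 :=
  (S.MExpansion z n ρ).map (PowerSeries.coeff (S.r z n))

/-- The local charge `𝓠ₙ = ∫ dx 𝓚ₙ(x)` at the regular zero `z`. -/
def Q [LocalPoissonAlgebra 𝒜] (z : ℂ) (n : ℕ) : LocalFunctional 𝒜 := integral (S.K z n)

end ModelData

/-- An `r/s`-system with twist function: the assumptions on the data. -/
structure IsRSSystem {𝒜 ι κ : Type*} [CommRing 𝒜] [Algebra ℂ 𝒜] [LocalPoissonAlgebra 𝒜]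
    [Fintype ι] [DecidableEq ι] [Fintype κ] [DecidableEq κ] (S : ModelData 𝒜 ι κ) : Prop where
  definingRep : IsDefiningRep S.type S.g
  dual : ∀ a b, ((S.basis a : Matrix ι ι ℂ) * (S.dualBasis b : Matrix ι ι ℂ)).trace =
    if a = b then 1 else 0
  T_pos : 0 < S.T
  /-- `σ` has order `T`. -/
  order : orderOf S.sigmaEnd = S.T
  /-- `σ` is given by matrix conjugation, possibly after `X ↦ -Xᵀ`. This excludes only the special
  automorphisms of `so(8)` that come from triality. -/
  realised : S.IsConj ∨ S.IsNegTransposeConj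
  primitive : IsPrimitiveRoot S.ω S.T
  phi_ne_zero : S.φ ≠ 0
  /-- `φ(ωλ) = ω⁻¹ φ(λ)`. -/
  phi_equivariant : ∀ z, S.phi (S.ω * z) = S.ω⁻¹ * S.phi z
  /-- The Lax matrix is defined away from a closed discrete set. -/
  dom_codiscrete : S.dom ∈ Filter.codiscrete ℂ
  /-- `σ(𝓛(λ, x)) = 𝓛(ωλ, x)`. -/
  lax_equivariant : ∀ z ∈ S.dom, S.ω * z ∈ S.dom →
    S.toMatrix S.sigmaEnd (S.L z) = S.lax (S.ω * z)
  /-- The Poisson bracket `{𝓛(λ, x)₁, 𝓛(μ, y)₂} = [𝓡₁₂(λ, μ), 𝓛(λ, x)₁] δ(x - y)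
  - [𝓡₂₁(μ, λ), 𝓛(μ, y)₂] δ(x - y) - (𝓡₁₂(λ, μ) + 𝓡₂₁(μ, λ)) ∂ₓδ(x - y)`; note that
  `∂ₓδ(x - y) = -∂_yδ(x - y)`. -/
  bracket : ∀ l ∈ S.dom, ∀ m ∈ S.dom, S.phi l ≠ 0 → S.phi m ≠ 0 → l ^ S.T ≠ m ^ S.T →
    let R₁₂ : Matrix (ι × ι) (ι × ι) 𝒜 := (S.R l m).map (algebraMap ℂ 𝒜)
    let R₂₁ : Matrix (ι × ι) (ι × ι) 𝒜 := (flip₁₂ (S.R m l)).map (algebraMap ℂ 𝒜)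
    let br : ℕ → Matrix (ι × ι) (ι × ι) 𝒜 := fun n =>
      Matrix.kroneckerMap (fun a b => LocalPoissonAlgebra.prod n a b) (S.lax l) (S.lax m)
    br 0 = ⁅R₁₂, S.lax l ⊗ₖ (1 : Matrix ι ι 𝒜)⁆ - ⁅R₂₁, (1 : Matrix ι ι 𝒜) ⊗ₖ S.lax m⁆ ∧
    br 1 = R₁₂ + R₂₁ ∧
    ∀ n, 2 ≤ n → br n = 0

end RSHierarchy

end

/-! As a function of the spectral parameter `ρ`, the left-hand side is a combination of fixed fields
with rational coefficients. It vanishes at infinity, has poles only on the orbits of the two zeros,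
and intertwines multiplication by `ω` with `σ`. By Liouville's theorem (`IsProperOff.eq_zero`) it is
therefore zero as soon as it is regular at the two zeros themselves.

Regularity is a local computation. The partial trace against the Casimir tensor projects the
gradient of `𝓦ₙ` orthogonally onto `g`; call the result `Yₙ(S)`, a polynomial in `S` whose
coefficients are polynomials in traces. Near its zero `z` one has `𝓜ₙ = Bₙ - a Yₙ(S)` with `Bₙ`
regular and `a = c (ρ - z)^{-(rₙ+1)}` (`exists_regular_part`), while the Poisson bracket gives the
flow `{𝓠ₙ, S} = -[𝓜ₙ, S] + φ ∂ₓ𝓜ₙ` (`map_prod_field`). Since `Yₙ` is conjugation equivariant and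
`[Yₙ, Yₘ] = 0`, substitution leaves the same expression in the regular parts, terms with a factor
`aφ` or `bφ`, and the term `abφ` times the commutator of the Hessians (the derivatives of `Yₙ` and
`Yₘ`) applied to `∂ₓS` (`zeroCurvature_regular_part`). The equivariance of `φ` and the exclusion of
`rₙ = T - 1` make `φ` vanish to order greater than `rₙ` (`coeff_taylor_phi`), so `aφ` and `bφ` are
regular.

The Hessian term has one pole too many and needs algebra. In types B, C, D the Hessians are
polynomials in left and right multiplication by `S`, hence commute. In type A with the generating
function they commute because of the exponent `(n-1)/d`: an integration by parts in two formal
variables followed by a partial fraction identity (`dGenGradient_comm`). In type A at a cyclotomic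
point with `σ` inner they do not commute, but each term of the commutator contains a factor `∂ₓ Tr
S^{n-1}` or `∂ₓ Tr S^{m-1}`, and equivariance forces it to vanish to high enough order to absorb a
pole (`coeff_trace_pow_eq_zero`). -/

noncomputable section

namespace RSHierarchy

/-! ### Taylor series of functions of the spectral parameter -/

section Taylor

/-- The Taylor series `f(z + X)`. -/
def taylor (f : ℂ → ℂ) (z : ℂ) : PowerSeries ℂ :=
  PowerSeries.mk fun r => iteratedDeriv r f z / (Nat.factorial r : ℂ)

theorem coeff_taylor (f : ℂ → ℂ) (z : ℂ) (r : ℕ) :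
    PowerSeries.coeff r (taylor f z) = iteratedDeriv r f z / (Nat.factorial r : ℂ) := by
  simp [taylor]

theorem taylor_congr {f g : ℂ → ℂ} {z : ℂ} (h : f =ᶠ[𝓝 z] g) : taylor f z = taylor g z := by
  ext r
  rw [coeff_taylor, coeff_taylor, h.iteratedDeriv_eq]

theorem taylor_mul {f g : ℂ → ℂ} {z : ℂ} (hf : AnalyticAt ℂ f z) (hg : AnalyticAt ℂ g z) :
    taylor (f * g) z = taylor f z * taylor g z := by
  ext r
  rw [coeff_taylor, PowerSeries.coeff_mul, iteratedDeriv_mul hf.contDiffAt hg.contDiffAt,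
    Finset.Nat.sum_antidiagonal_eq_sum_range_succ_mk, Finset.sum_div]
  refine Finset.sum_congr rfl fun i hi => ?_
  have hir : i ≤ r := Nat.lt_succ_iff.1 (Finset.mem_range.1 hi)
  have h3 : (r.factorial : ℂ) = r.choose i * i.factorial * (r - i).factorial := by
    exact_mod_cast (Nat.choose_mul_factorial_mul_factorial hir).symm
  have h1 : (r.choose i : ℂ) ≠ 0 := by exact_mod_cast (Nat.choose_pos hir).ne'
  have h2 : (i.factorial : ℂ) ≠ 0 := by exact_mod_cast i.factorial_ne_zero
  have h4 : ((r - i).factorial : ℂ) ≠ 0 := by exact_mod_cast (r - i).factorial_ne_zero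
  rw [coeff_taylor, coeff_taylor, h3]
  field_simp

theorem taylor_add {f g : ℂ → ℂ} {z : ℂ} (hf : AnalyticAt ℂ f z) (hg : AnalyticAt ℂ g z) :
    taylor (f + g) z = taylor f z + taylor g z := by
  ext r
  rw [coeff_taylor, map_add, coeff_taylor, coeff_taylor,
    iteratedDeriv_add hf.contDiffAt hg.contDiffAt, add_div]

theorem taylor_const (c z : ℂ) : taylor (fun _ => c) z = PowerSeries.C c := by
  ext r
  rw [coeff_taylor, iteratedDeriv_const, PowerSeries.coeff_C]
  split_ifs with h
  · simp [h]
  · simp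

theorem taylor_sub_self (z : ℂ) : taylor (fun w => w - z) z = PowerSeries.X := by
  ext r
  rw [coeff_taylor, PowerSeries.coeff_X]
  rcases r with _ | r
  · simp
  · rw [iteratedDeriv_succ']
    have : deriv (fun w : ℂ => w - z) = fun _ => 1 := by
      funext w
      simp
    rw [this, iteratedDeriv_const]
    rcases r with _ | r <;> simp

theorem analyticAt_dslope {f : ℂ → ℂ} {z : ℂ} (hf : AnalyticAt ℂ f z) :
    AnalyticAt ℂ (dslope f z) z := by
  obtain ⟨p, hp⟩ := hf
  exact ⟨_, hp.has_fpower_series_dslope_fslope⟩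

/-- `dslope` is the holomorphic quotient `(f w - f z) / (w - z)`, so dividing by `w - z` shifts
coefficients. The cancellation of poles at a regular zero rests on this shift. -/
theorem taylor_eq_dslope {f : ℂ → ℂ} {z : ℂ} (hf : AnalyticAt ℂ f z) :
    taylor f z = PowerSeries.C (f z) + PowerSeries.X * taylor (dslope f z) z := by
  have h : f = (fun _ => f z) + (fun w => w - z) * dslope f z := by
    funext w
    have := sub_smul_dslope f z w
    simp only [smul_eq_mul] at this
    simp [this]
  have hid : AnalyticAt ℂ (fun w : ℂ => w - z) z := analyticAt_id.sub analyticAt_const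
  conv_lhs => rw [h]
  rw [taylor_add analyticAt_const (hid.mul (analyticAt_dslope hf)),
    taylor_mul hid (analyticAt_dslope hf), taylor_const, taylor_sub_self]

theorem coeff_taylor_zero (f : ℂ → ℂ) (z : ℂ) : PowerSeries.coeff 0 (taylor f z) = f z := by
  simp [coeff_taylor]

theorem coeff_taylor_dslope {f : ℂ → ℂ} {z : ℂ} (hf : AnalyticAt ℂ f z) (r : ℕ) :
    PowerSeries.coeff r (taylor (dslope f z) z) = PowerSeries.coeff (r + 1) (taylor f z) := by
  rw [taylor_eq_dslope hf, map_add, PowerSeries.coeff_succ_X_mul, PowerSeries.coeff_C]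
  simp

theorem coeff_taylor_comp_mul (f : ℂ → ℂ) (a z : ℂ) (r : ℕ) :
    PowerSeries.coeff r (taylor (fun w => f (a * w)) z) =
      a ^ r * PowerSeries.coeff r (taylor f (a * z)) := by
  have : ∀ (r : ℕ), iteratedDeriv r (fun w => f (a * w)) =
      fun w => a ^ r * iteratedDeriv r f (a * w) := by
    intro r
    induction r with
    | zero => simp
    | succ r ih =>
      rw [iteratedDeriv_succ, ih]
      funext w
      rw [deriv_const_mul_field, deriv_comp_mul_left, ← iteratedDeriv_succ, smul_eq_mul]
      ring
  rw [coeff_taylor, coeff_taylor, this]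
  ring

/-- Identifies the formal inverses in `R0Expansion` with Taylor series of actual simple poles. -/
theorem taylor_inv {a z : ℂ} (h : z - a ≠ 0) :
    taylor (fun w => (w - a)⁻¹) z = (PowerSeries.C (z - a) + PowerSeries.X)⁻¹ := by
  have h1 : AnalyticAt ℂ (fun w : ℂ => w - a) z := analyticAt_id.sub analyticAt_const
  have h2 : AnalyticAt ℂ (fun w : ℂ => (w - a)⁻¹) z := h1.inv h
  have h3 : taylor (fun w => w - a) z = PowerSeries.C (z - a) + PowerSeries.X := by
    rw [← taylor_sub_self z, ← taylor_const (z - a) z, ← taylor_add analyticAt_const]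
    · congr 1
      funext w
      simp
    · exact analyticAt_id.sub analyticAt_const
  rw [PowerSeries.eq_inv_iff_mul_eq_one (by simpa using h), ← h3, ← taylor_mul h2 h1]
  have h4 : ((fun w : ℂ => (w - a)⁻¹) * fun w => w - a) =ᶠ[𝓝 z] fun _ => 1 := by
    filter_upwards [h1.continuousAt.eventually_ne h] with w hw
    simpa using inv_mul_cancel₀ hw
  rw [taylor_congr h4, taylor_const, map_one]

end Taylor

/-! ### Calculus of expansions -/

section ExpansionCalculus

variable {𝒜 ℬ : Type*} [CommRing 𝒜] [Algebra ℂ 𝒜] [CommRing ℬ] [Algebra ℂ ℬ]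

/-- `F` is holomorphic at `z`, up to a removable singularity. -/
def IsRegularAt (F : ℂ → 𝒜) (z : ℂ) : Prop := ∃ s, HasExpansionAt F z s

theorem hasExpansionAt_expansion {F : ℂ → 𝒜} {z : ℂ} (h : IsRegularAt F z) :
    HasExpansionAt F z (expansion F z) := by
  have h' : ∃ s, HasExpansionAt F z s := h
  rw [expansion, dif_pos h']
  exact h'.choose_spec

namespace HasExpansionAt

variable {F G : ℂ → 𝒜} {z : ℂ} {s t : PowerSeries 𝒜}

theorem isRegularAt (h : HasExpansionAt F z s) : IsRegularAt F z := ⟨s, h⟩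

theorem of_fintype {I : Type*} [Fintype I] (f : I → ℂ → ℂ) (c : I → 𝒜)
    (hf : ∀ i, AnalyticAt ℂ (f i) z) (hF : ∀ᶠ w in 𝓝[≠] z, F w = ∑ i, f i w • c i)
    (hs : ∀ r, PowerSeries.coeff r s = ∑ i, PowerSeries.coeff r (taylor (f i) z) • c i) :
    HasExpansionAt F z s := by
  let e := (Fintype.equivFin I).symm
  refine ⟨Fintype.card I, fun i => f (e i), fun i => c (e i), fun i => hf _, ?_, fun r => ?_⟩
  · filter_upwards [hF] with w hw
    rw [hw, ← e.sum_comp]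
  · simp only [← coeff_taylor]
    rw [hs, ← e.sum_comp]

theorem congr (h : HasExpansionAt F z s) (hFG : ∀ᶠ w in 𝓝[≠] z, G w = F w) :
    HasExpansionAt G z s := by
  obtain ⟨N, f, c, hf, hF, hs⟩ := h
  refine ⟨N, f, c, hf, ?_, hs⟩
  filter_upwards [hF, hFG] with w h1 h2
  rw [h2, h1]

theorem const (a : 𝒜) (z : ℂ) : HasExpansionAt (fun _ => a) z (PowerSeries.C a) := by
  refine of_fintype (I := Unit) (fun _ _ => 1) (fun _ => a) (fun _ => analyticAt_const)
    (by simp) fun r => ?_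
  rw [taylor_const]
  simp only [PowerSeries.coeff_C]
  split_ifs <;> simp

theorem scalar {f : ℂ → ℂ} (hf : AnalyticAt ℂ f z) :
    HasExpansionAt (fun w => algebraMap ℂ 𝒜 (f w)) z
      (PowerSeries.map (algebraMap ℂ 𝒜) (taylor f z)) := by
  refine of_fintype (I := Unit) (fun _ => f) (fun _ => 1) (fun _ => hf) ?_ fun r => ?_
  · exact Filter.Eventually.of_forall fun w => by simp [Algebra.algebraMap_eq_smul_one]
  · simp [Algebra.algebraMap_eq_smul_one]

theorem add (hF : HasExpansionAt F z s) (hG : HasExpansionAt G z t) :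
    HasExpansionAt (fun w => F w + G w) z (s + t) := by
  obtain ⟨N, f, c, hf, hF, hs⟩ := hF
  obtain ⟨M, g, d, hg, hG, ht⟩ := hG
  refine of_fintype (I := Fin N ⊕ Fin M) (Sum.elim f g) (Sum.elim c d) ?_ ?_ fun r => ?_
  · rintro (i | i)
    exacts [hf i, hg i]
  · filter_upwards [hF, hG] with w h1 h2
    simp [h1, h2]
  · simp [hs, ht, coeff_taylor]

theorem mul (hF : HasExpansionAt F z s) (hG : HasExpansionAt G z t) :
    HasExpansionAt (fun w => F w * G w) z (s * t) := by
  obtain ⟨N, f, c, hf, hF, hs⟩ := hF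
  obtain ⟨M, g, d, hg, hG, ht⟩ := hG
  refine of_fintype (I := Fin N × Fin M) (fun i => f i.1 * g i.2) (fun i => c i.1 * d i.2)
    (fun i => (hf _).mul (hg _)) ?_ fun r => ?_
  · filter_upwards [hF, hG] with w h1 h2
    rw [h1, h2, Finset.sum_mul_sum, ← Finset.univ_product_univ, Finset.sum_product]
    simp only [Pi.mul_apply, smul_mul_smul_comm]
  · simp only [taylor_mul (hf _) (hg _), PowerSeries.coeff_mul, Finset.sum_smul]
    rw [Finset.sum_comm]
    refine Finset.sum_congr rfl fun p _ => ?_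
    rw [hs, ht, Finset.sum_mul_sum, ← Finset.univ_product_univ, Finset.sum_product]
    simp only [coeff_taylor, smul_mul_smul_comm]

theorem smul {f : ℂ → ℂ} (hf : AnalyticAt ℂ f z) (hF : HasExpansionAt F z s) :
    HasExpansionAt (fun w => f w • F w) z
      (PowerSeries.map (algebraMap ℂ 𝒜) (taylor f z) * s) := by
  refine ((scalar hf).mul hF).congr (Filter.Eventually.of_forall fun w => ?_)
  rw [Algebra.smul_def]

theorem const_smul (a : ℂ) (hF : HasExpansionAt F z s) :
    HasExpansionAt (fun w => a • F w) z (a • s) := by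
  have h := hF.smul (analyticAt_const (v := a))
  rw [taylor_const, PowerSeries.map_C] at h
  convert h using 1
  rw [Algebra.smul_def, PowerSeries.algebraMap_apply]

theorem linearMap (ℓ : 𝒜 →ₗ[ℂ] ℬ) (hF : HasExpansionAt F z s) :
    HasExpansionAt (fun w => ℓ (F w)) z (PowerSeries.mk fun r => ℓ (PowerSeries.coeff r s)) := by
  obtain ⟨N, f, c, hf, hF, hs⟩ := hF
  refine of_fintype f (fun i => ℓ (c i)) hf ?_ fun r => ?_
  · filter_upwards [hF] with w h1
    simp [h1]
  · simp [hs, coeff_taylor]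

theorem sum {I : Type*} (u : Finset I) {F : I → ℂ → 𝒜} {s : I → PowerSeries 𝒜}
    (h : ∀ i ∈ u, HasExpansionAt (F i) z (s i)) :
    HasExpansionAt (fun w => ∑ i ∈ u, F i w) z (∑ i ∈ u, s i) := by
  classical
  induction u using Finset.induction_on with
  | empty => simpa using const (0 : 𝒜) z
  | insert i u hi ih =>
    simp only [Finset.sum_insert hi]
    exact (h i (Finset.mem_insert_self _ _)).add
      (ih fun j hj => h j (Finset.mem_insert_of_mem hj))

theorem aeval {I : Type*} {F : I → ℂ → 𝒜} {s : I → PowerSeries 𝒜}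
    (h : ∀ i, HasExpansionAt (F i) z (s i)) (p : MvPolynomial I ℂ) :
    HasExpansionAt (fun w => MvPolynomial.aeval (fun i => F i w) p) z
      (MvPolynomial.aeval s p) := by
  induction p using MvPolynomial.induction_on with
  | C a =>
    simp only [MvPolynomial.aeval_C]
    have h := const (algebraMap ℂ 𝒜 a) z
    rwa [← PowerSeries.algebraMap_apply] at h
  | add p q hp hq =>
    simp only [map_add]
    exact hp.add hq
  | mul_X p i hp =>
    simp only [map_mul, MvPolynomial.aeval_X]
    exact hp.mul (h i)

theorem comp_mul {a : ℂ} (ha : a ≠ 0) (hF : HasExpansionAt F (a * z) s) :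
    HasExpansionAt (fun w => F (a * w)) z (PowerSeries.mk fun r => a ^ r • PowerSeries.coeff r s) := by
  obtain ⟨N, f, c, hf, hF, hs⟩ := hF
  refine of_fintype (fun i w => f i (a * w)) c (fun i => ?_) ?_ fun r => ?_
  · exact (hf i).comp_of_eq (analyticAt_const.mul analyticAt_id) rfl
  · have h : Filter.Tendsto (fun w => a * w) (𝓝[≠] z) (𝓝[≠] (a * z)) := by
      refine Filter.Tendsto.inf (by fun_prop : Continuous fun w => a * w).continuousAt ?_
      simp [ha]
    exact h.eventually hF
  · simp only [coeff_taylor_comp_mul, PowerSeries.coeff_mk, hs, Finset.smul_sum, smul_smul]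
    simp only [coeff_taylor]

theorem divided_difference (hF : HasExpansionAt F z s) :
    HasExpansionAt (fun w => (w - z)⁻¹ • (F w - PowerSeries.coeff 0 s)) z
      (PowerSeries.mk fun r => PowerSeries.coeff (r + 1) s) := by
  obtain ⟨N, f, c, hf, hF, hs⟩ := hF
  refine of_fintype (fun i => dslope (f i) z) c (fun i => analyticAt_dslope (hf i)) ?_
    fun r => ?_
  · filter_upwards [hF, self_mem_nhdsWithin] with w h1 (h2 : w ≠ z)
    rw [h1, hs, ← Finset.sum_sub_distrib, Finset.smul_sum]
    refine Finset.sum_congr rfl fun i _ => ?_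
    rw [dslope_of_ne _ h2, slope_def_field, ← sub_smul, smul_smul]
    simp [div_eq_inv_mul]
  · simp only [PowerSeries.coeff_mk, hs, coeff_taylor_dslope (hf _), coeff_taylor]

/-- Iteration of the divided difference. The subtracted Taylor polynomial over `(w - z) ^ k` is
later recognised, up to sign, as the singular part of `𝓜ₙ` at a cyclotomic point. -/
theorem taylor_remainder (hF : HasExpansionAt F z s) (k : ℕ) :
    HasExpansionAt (fun w => ((w - z) ^ k)⁻¹ •
      (F w - ∑ j ∈ Finset.range k, (w - z) ^ j • PowerSeries.coeff j s)) z
      (PowerSeries.mk fun r => PowerSeries.coeff (r + k) s) := by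
  induction k with
  | zero =>
    have : (PowerSeries.mk fun r => PowerSeries.coeff (r + 0) s) = s := by
      ext
      simp
    rw [this]
    simpa using hF
  | succ k ih =>
    have h := ih.divided_difference
    have h2 : (PowerSeries.mk fun r => PowerSeries.coeff (r + (k + 1)) s) =
        PowerSeries.mk fun r => PowerSeries.coeff (r + 1)
          (PowerSeries.mk fun r => PowerSeries.coeff (r + k) s) := by
      ext r
      simp only [PowerSeries.coeff_mk]
      congr 2
      ring
    rw [h2]
    refine h.congr ?_
    filter_upwards [self_mem_nhdsWithin] with w (hw : w ≠ z)
    have hw' : (w - z) ^ k ≠ 0 := pow_ne_zero _ (sub_ne_zero.2 hw)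
    simp only [PowerSeries.coeff_mk, zero_add, Finset.sum_range_succ, pow_succ, mul_inv_rev,
      mul_smul]
    rw [← sub_sub, smul_sub _ (F w - _), inv_smul_smul₀ hw']

/-- The criterion by which a zero of sufficient order, of `φ` or of a differentiated trace, absorbs
a pole. -/
theorem div_pow {k : ℕ} (hF : HasExpansionAt F z s) (h : ∀ j < k, PowerSeries.coeff j s = 0) :
    IsRegularAt (fun w => ((w - z) ^ k)⁻¹ • F w) z := by
  refine ⟨_, (hF.taylor_remainder k).congr (Filter.Eventually.of_forall fun w => ?_)⟩
  rw [Finset.sum_eq_zero, sub_zero]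
  intro j hj
  rw [h j (Finset.mem_range.1 hj), smul_zero]

end HasExpansionAt

namespace IsRegularAt

variable {F G : ℂ → 𝒜} {z : ℂ}

theorem congr (h : IsRegularAt F z) (hFG : ∀ᶠ w in 𝓝[≠] z, G w = F w) : IsRegularAt G z :=
  h.imp fun _ hs => hs.congr hFG

theorem const (a : 𝒜) (z : ℂ) : IsRegularAt (fun _ => a) z := ⟨_, HasExpansionAt.const a z⟩

theorem add (hF : IsRegularAt F z) (hG : IsRegularAt G z) : IsRegularAt (fun w => F w + G w) z :=
  hF.elim fun _ h => hG.elim fun _ h' => ⟨_, h.add h'⟩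

theorem mul (hF : IsRegularAt F z) (hG : IsRegularAt G z) : IsRegularAt (fun w => F w * G w) z :=
  hF.elim fun _ h => hG.elim fun _ h' => ⟨_, h.mul h'⟩

theorem smul {f : ℂ → ℂ} (hf : IsRegularAt f z) (hF : IsRegularAt F z) :
    IsRegularAt (fun w => f w • F w) z := by
  obtain ⟨s, hs⟩ := hf
  have h := hs.linearMap (Algebra.linearMap ℂ 𝒜)
  refine (h.isRegularAt.mul hF).congr (Filter.Eventually.of_forall fun w => ?_)
  simp [Algebra.smul_def]

theorem linearMap (ℓ : 𝒜 →ₗ[ℂ] ℬ) (hF : IsRegularAt F z) : IsRegularAt (fun w => ℓ (F w)) z :=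
  hF.elim fun _ h => ⟨_, h.linearMap ℓ⟩

theorem const_smul (a : ℂ) (hF : IsRegularAt F z) : IsRegularAt (fun w => a • F w) z :=
  hF.elim fun _ h => ⟨_, h.const_smul a⟩

theorem neg (hF : IsRegularAt F z) : IsRegularAt (fun w => -F w) z := by
  simpa using hF.const_smul (-1)

theorem sub (hF : IsRegularAt F z) (hG : IsRegularAt G z) : IsRegularAt (fun w => F w - G w) z := by
  simpa [sub_eq_add_neg] using hF.add hG.neg

theorem sum {I : Type*} (u : Finset I) {F : I → ℂ → 𝒜} (h : ∀ i ∈ u, IsRegularAt (F i) z) :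
    IsRegularAt (fun w => ∑ i ∈ u, F i w) z := by
  classical
  have h' : ∀ i, ∃ s, i ∈ u → HasExpansionAt (F i) z s := fun i => by
    by_cases hi : i ∈ u
    · exact (h i hi).imp fun _ hs _ => hs
    · exact ⟨0, fun hi' => absurd hi' hi⟩
  choose s hs using h'
  exact ⟨_, HasExpansionAt.sum u hs⟩

theorem comp_mul {a : ℂ} (ha : a ≠ 0) (hF : IsRegularAt F (a * z)) :
    IsRegularAt (fun w => F (a * w)) z :=
  hF.elim fun _ h => ⟨_, h.comp_mul ha⟩

end IsRegularAt

theorem AnalyticAt.isRegularAt {f : ℂ → ℂ} {z : ℂ} (hf : AnalyticAt ℂ f z) : IsRegularAt f z :=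
  ⟨_, HasExpansionAt.scalar (𝒜 := ℂ) hf⟩

theorem HasExpansionAt.of_analyticAt {f : ℂ → ℂ} {z : ℂ} (hf : AnalyticAt ℂ f z) :
    HasExpansionAt f z (taylor f z) := by
  have := HasExpansionAt.scalar (𝒜 := ℂ) hf
  simpa using this

end ExpansionCalculus

/-! ### Matrices of functions of the spectral parameter -/

section MatrixExpansions

variable {𝒜 ι : Type*} [CommRing 𝒜] [Algebra ℂ 𝒜]

/-- The entries of `F` have the expansions `s` at `z`. -/
def MatHasExpansionAt (F : ℂ → Matrix ι ι 𝒜) (z : ℂ) (s : Matrix ι ι (PowerSeries 𝒜)) : Prop :=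
  ∀ i j, HasExpansionAt (fun w => F w i j) z (s i j)

/-- The entries of `F` are holomorphic at `z`, up to removable singularities. -/
def MatIsRegularAt (F : ℂ → Matrix ι ι 𝒜) (z : ℂ) : Prop :=
  ∀ i j, IsRegularAt (fun w => F w i j) z

namespace MatHasExpansionAt

variable {F G : ℂ → Matrix ι ι 𝒜} {z : ℂ} {s t : Matrix ι ι (PowerSeries 𝒜)}

theorem isRegularAt (h : MatHasExpansionAt F z s) : MatIsRegularAt F z :=
  fun i j => (h i j).isRegularAt

theorem mul [Fintype ι] (hF : MatHasExpansionAt F z s) (hG : MatHasExpansionAt G z t) :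
    MatHasExpansionAt (fun w => F w * G w) z (s * t) := fun i j => by
  simp only [Matrix.mul_apply]
  exact HasExpansionAt.sum _ fun k _ => (hF i k).mul (hG k j)

theorem one [DecidableEq ι] (z : ℂ) : MatHasExpansionAt (fun _ => (1 : Matrix ι ι 𝒜)) z 1 :=
  fun i j => by
    have h := HasExpansionAt.const ((1 : Matrix ι ι 𝒜) i j) z
    convert h using 1
    rw [Matrix.one_apply, Matrix.one_apply]
    split_ifs <;> simp

theorem pow [Fintype ι] [DecidableEq ι] (hF : MatHasExpansionAt F z s) (k : ℕ) :
    MatHasExpansionAt (fun w => F w ^ k) z (s ^ k) := by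
  induction k with
  | zero =>
    simp only [pow_zero]
    exact one z
  | succ k ih =>
    simp only [pow_succ]
    exact ih.mul hF

theorem trace [Fintype ι] (hF : MatHasExpansionAt F z s) :
    HasExpansionAt (fun w => (F w).trace) z s.trace :=
  HasExpansionAt.sum _ fun i _ => hF i i

theorem smul {f : ℂ → 𝒜} {a : PowerSeries 𝒜} (hf : HasExpansionAt f z a)
    (hF : MatHasExpansionAt F z s) : MatHasExpansionAt (fun w => f w • F w) z (a • s) :=
  fun i j => hf.mul (hF i j)

theorem sum {I : Type*} (u : Finset I) {F : I → ℂ → Matrix ι ι 𝒜}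
    {s : I → Matrix ι ι (PowerSeries 𝒜)} (h : ∀ i ∈ u, MatHasExpansionAt (F i) z (s i)) :
    MatHasExpansionAt (fun w => ∑ i ∈ u, F i w) z (∑ i ∈ u, s i) := fun i j => by
  simp only [Matrix.sum_apply]
  exact HasExpansionAt.sum u fun k hk => h k hk i j

end MatHasExpansionAt

namespace MatIsRegularAt

variable {F G : ℂ → Matrix ι ι 𝒜} {z : ℂ}

theorem congr (h : MatIsRegularAt F z) (hFG : ∀ᶠ w in 𝓝[≠] z, G w = F w) :
    MatIsRegularAt G z := fun i j => (h i j).congr (hFG.mono fun w hw => by rw [hw])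

theorem exists_expansion (hF : MatIsRegularAt F z) : ∃ s, MatHasExpansionAt F z s := by
  choose s hs using hF
  exact ⟨Matrix.of s, hs⟩

theorem mul [Fintype ι] (hF : MatIsRegularAt F z) (hG : MatIsRegularAt G z) :
    MatIsRegularAt (fun w => F w * G w) z := by
  obtain ⟨s, hs⟩ := hF.exists_expansion
  obtain ⟨t, ht⟩ := hG.exists_expansion
  exact (hs.mul ht).isRegularAt

theorem const (A : Matrix ι ι 𝒜) (z : ℂ) : MatIsRegularAt (fun _ => A) z :=
  fun i j => IsRegularAt.const (A i j) z

theorem add (hF : MatIsRegularAt F z) (hG : MatIsRegularAt G z) :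
    MatIsRegularAt (fun w => F w + G w) z := fun i j => (hF i j).add (hG i j)

theorem sub (hF : MatIsRegularAt F z) (hG : MatIsRegularAt G z) :
    MatIsRegularAt (fun w => F w - G w) z := fun i j => (hF i j).sub (hG i j)

theorem pow [Fintype ι] [DecidableEq ι] (hF : MatIsRegularAt F z) (k : ℕ) :
    MatIsRegularAt (fun w => F w ^ k) z := by
  obtain ⟨s, hs⟩ := hF.exists_expansion
  exact (hs.pow k).isRegularAt

theorem trace [Fintype ι] (hF : MatIsRegularAt F z) : IsRegularAt (fun w => (F w).trace) z := by
  obtain ⟨s, hs⟩ := hF.exists_expansion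
  exact hs.trace.isRegularAt

theorem smul {f : ℂ → 𝒜} (hf : IsRegularAt f z) (hF : MatIsRegularAt F z) :
    MatIsRegularAt (fun w => f w • F w) z := fun i j => hf.mul (hF i j)

theorem scalar_smul {f : ℂ → ℂ} (hf : IsRegularAt f z) (hF : MatIsRegularAt F z) :
    MatIsRegularAt (fun w => f w • F w) z := fun i j => hf.smul (hF i j)

theorem const_smul (a : ℂ) (hF : MatIsRegularAt F z) : MatIsRegularAt (fun w => a • F w) z :=
  fun i j => (hF i j).const_smul a

theorem sum {I : Type*} (u : Finset I) {F : I → ℂ → Matrix ι ι 𝒜}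
    (h : ∀ i ∈ u, MatIsRegularAt (F i) z) : MatIsRegularAt (fun w => ∑ i ∈ u, F i w) z :=
  fun i j => by
    simp only [Matrix.sum_apply]
    exact IsRegularAt.sum u fun k hk => h k hk i j

theorem map (ℓ : 𝒜 →ₗ[ℂ] 𝒜) (hF : MatIsRegularAt F z) :
    MatIsRegularAt (fun w => (F w).map ℓ) z := fun i j => (hF i j).linearMap ℓ

theorem lie [Fintype ι] [DecidableEq ι] (hF : MatIsRegularAt F z) (hG : MatIsRegularAt G z) :
    MatIsRegularAt (fun w => ⁅F w, G w⁆) z := by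
  simp only [Ring.lie_def]
  exact (hF.mul hG).sub (hG.mul hF)

end MatIsRegularAt

end MatrixExpansions

/-! ### Functions that are holomorphic on the sphere -/

section Liouville

variable {𝒜 : Type*} [CommRing 𝒜] [Algebra ℂ 𝒜]

/-- `F` is a finite combination of fixed fields, with coefficients that are holomorphic outside `P`
and vanish at infinity. -/
def IsProperOff (P : Set ℂ) (F : ℂ → 𝒜) : Prop :=
  ∃ (N : ℕ) (f : Fin N → ℂ → ℂ) (c : Fin N → 𝒜),
    (∀ i, ∀ z ∉ P, AnalyticAt ℂ (f i) z) ∧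
    (∀ i, Filter.Tendsto (f i) (Filter.cocompact ℂ) (𝓝 0)) ∧ ∀ w, F w = ∑ i, f i w • c i

namespace IsProperOff

variable {P : Set ℂ} {F G : ℂ → 𝒜}

theorem of_fintype {I : Type*} [Fintype I] (f : I → ℂ → ℂ) (c : I → 𝒜)
    (hf : ∀ i, ∀ z ∉ P, AnalyticAt ℂ (f i) z)
    (hf0 : ∀ i, Filter.Tendsto (f i) (Filter.cocompact ℂ) (𝓝 0))
    (hF : ∀ w, F w = ∑ i, f i w • c i) : IsProperOff P F := by
  let e := (Fintype.equivFin I).symm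
  refine ⟨Fintype.card I, fun i => f (e i), fun i => c (e i), fun i => hf _, fun i => hf0 _,
    fun w => ?_⟩
  rw [hF, ← e.sum_comp]

theorem smul_const {f : ℂ → ℂ} (hf : ∀ z ∉ P, AnalyticAt ℂ f z)
    (hf0 : Filter.Tendsto f (Filter.cocompact ℂ) (𝓝 0)) (c : 𝒜) :
    IsProperOff P fun w => f w • c :=
  of_fintype (I := Unit) (fun _ => f) (fun _ => c) (fun _ => hf) (fun _ => hf0) (by simp)

theorem add (hF : IsProperOff P F) (hG : IsProperOff P G) :
    IsProperOff P fun w => F w + G w := by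
  obtain ⟨N, f, c, hf, hf0, hF⟩ := hF
  obtain ⟨M, g, d, hg, hg0, hG⟩ := hG
  refine of_fintype (I := Fin N ⊕ Fin M) (Sum.elim f g) (Sum.elim c d) ?_ ?_ fun w => ?_
  · rintro (i | i)
    exacts [hf i, hg i]
  · rintro (i | i)
    exacts [hf0 i, hg0 i]
  · simp [hF, hG]

theorem mul (hF : IsProperOff P F) (hG : IsProperOff P G) :
    IsProperOff P fun w => F w * G w := by
  obtain ⟨N, f, c, hf, hf0, hF⟩ := hF
  obtain ⟨M, g, d, hg, hg0, hG⟩ := hG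
  refine of_fintype (I := Fin N × Fin M) (fun i => f i.1 * g i.2) (fun i => c i.1 * d i.2)
    (fun i z hz => (hf _ z hz).mul (hg _ z hz)) (fun i => ?_) fun w => ?_
  · have h := (hf0 i.1).mul (hg0 i.2)
    rwa [mul_zero] at h
  · rw [hF, hG, Finset.sum_mul_sum, ← Finset.univ_product_univ, Finset.sum_product]
    simp only [Pi.mul_apply, smul_mul_smul_comm]

theorem linearMap {ℬ : Type*} [CommRing ℬ] [Algebra ℂ ℬ] (ℓ : 𝒜 →ₗ[ℂ] ℬ)
    (hF : IsProperOff P F) : IsProperOff P fun w => ℓ (F w) := by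
  obtain ⟨N, f, c, hf, hf0, hF⟩ := hF
  exact ⟨N, f, fun i => ℓ (c i), hf, hf0, fun w => by simp [hF]⟩

theorem zero : IsProperOff P fun _ => (0 : 𝒜) :=
  of_fintype (I := Empty) Empty.elim Empty.elim (fun i => i.elim) (fun i => i.elim) (by simp)

theorem sum {I : Type*} (u : Finset I) {F : I → ℂ → 𝒜} (h : ∀ i ∈ u, IsProperOff P (F i)) :
    IsProperOff P fun w => ∑ i ∈ u, F i w := by
  classical
  induction u using Finset.induction_on with
  | empty => simpa using zero
  | insert i u hi ih =>
    simp only [Finset.sum_insert hi]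
    exact (h i (Finset.mem_insert_self _ _)).add
      (ih fun j hj => h j (Finset.mem_insert_of_mem hj))

theorem sub (hF : IsProperOff P F) (hG : IsProperOff P G) :
    IsProperOff P fun w => F w - G w := by
  have h := hG.linearMap (-LinearMap.id)
  simpa [sub_eq_add_neg] using hF.add h

theorem mono {P' : Set ℂ} (hP : P ⊆ P') (hF : IsProperOff P F) : IsProperOff P' F := by
  obtain ⟨N, f, c, hf, hf0, hF⟩ := hF
  exact ⟨N, f, c, fun i z hz => hf i z fun h => hz (hP h), hf0, hF⟩

/-- Liouville's theorem: a function without poles that vanishes at infinity is zero. -/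
theorem eq_zero (hP : P.Finite) (hF : IsProperOff P F) (hreg : ∀ z ∈ P, IsRegularAt F z)
    {w : ℂ} (hw : w ∉ P) : F w = 0 := by
  -- Linear functionals separate the vectors of `𝒜`, so the scalar Liouville theorem suffices.
  rw [← Module.forall_dual_apply_eq_zero_iff ℂ]
  intro ℓ
  have hg := hF.linearMap ℓ
  have hreg' : ∀ z ∈ P, ∃ h : ℂ → ℂ, AnalyticAt ℂ h z ∧ ∀ᶠ w in 𝓝[≠] z, ℓ (F w) = h w := by
    intro z hz
    obtain ⟨s, N, f, c, hf, hF, -⟩ := (hreg z hz).linearMap ℓ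
    exact ⟨_, Finset.analyticAt_fun_sum _ fun i _ => (hf i).mul analyticAt_const, hF⟩
  obtain ⟨N, f, c, hf, hf0, hF⟩ := hg
  choose! h hh hFh using hreg'
  have hlim : Filter.Tendsto (fun w => ℓ (F w)) (Filter.cocompact ℂ) (𝓝 0) := by
    have : Filter.Tendsto (fun w => ∑ i, f i w * c i) (Filter.cocompact ℂ)
        (𝓝 (∑ i, 0 * c i)) := tendsto_finsetSum _ fun i _ => (hf0 i).mul_const (c i)
    simpa [hF] using this
  classical
  -- The candidate entire function: at a point of `P` it takes the value there of the local
  -- continuation belonging to that same point.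
  let g : ℂ → ℂ := fun w => if w ∈ P then h w w else ℓ (F w)
  have hPnear : ∀ z, ∀ᶠ w in 𝓝[≠] z, w ∉ P := fun z => by
    have h1 : ((P \ {z})ᶜ : Set ℂ) ∈ 𝓝 z :=
      (hP.subset Set.sdiff_subset).isClosed.isOpen_compl.mem_nhds (by simp)
    filter_upwards [nhdsWithin_le_nhds h1, self_mem_nhdsWithin] with w h2 (h3 : w ≠ z) h4
    exact h2 ⟨h4, h3⟩
  have hg : Differentiable ℂ g := fun z => by
    by_cases hz : z ∈ P
    · have : g =ᶠ[𝓝 z] h z := by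
        refine eventuallyEq_nhds_of_eventuallyEq_nhdsNE ?_ (by simp [g, hz])
        filter_upwards [hFh z hz, hPnear z] with w h1 h2
        simp only [g, h2, if_false]
        exact h1
      exact this.differentiableAt_iff.2 (hh z hz).differentiableAt
    · have : g =ᶠ[𝓝 z] fun w => ∑ i, f i w * c i := by
        filter_upwards [hP.isClosed.isOpen_compl.mem_nhds hz] with w (hw : w ∉ P)
        simp [g, hw, hF]
      exact this.differentiableAt_iff.2
        (Finset.analyticAt_fun_sum _ fun i _ => (hf i z hz).mul analyticAt_const).differentiableAt
  have hglim : Filter.Tendsto g (Filter.cocompact ℂ) (𝓝 0) := by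
    refine hlim.congr' ?_
    filter_upwards [hP.isCompact.compl_mem_cocompact] with w (hw : w ∉ P)
    simp [g, hw]
  have := hg.apply_eq_of_tendsto_cocompact w hglim
  simpa [g, hw] using this

end IsProperOff

end Liouville

/-! ### Local Poisson brackets with derivations -/

section LocalBrackets

variable {𝒜 : Type*} [CommRing 𝒜] [Algebra ℂ 𝒜] [LocalPoissonAlgebra 𝒜]

/-- The `n`-th product with a fixed first factor, as a derivation. -/
def prodDerivation (n : ℕ) (a : 𝒜) : Derivation ℂ 𝒜 𝒜 :=
  Derivation.mk' (LocalPoissonAlgebra.prod n a) fun b c => by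
    rw [LocalPoissonAlgebra.leibniz, smul_eq_mul, smul_eq_mul]
    ring

@[simp]
theorem prodDerivation_apply (n : ℕ) (a b : 𝒜) :
    prodDerivation n a b = LocalPoissonAlgebra.prod n a b := rfl

/-- Skew-symmetry for a bracket that involves at most the first derivative of `δ`. -/
theorem prod_zero_eq {a c : 𝒜} (h : ∀ n, 2 ≤ n → LocalPoissonAlgebra.prod n c a = 0) :
    LocalPoissonAlgebra.prod 0 a c =
      -LocalPoissonAlgebra.prod 0 c a +
        LocalPoissonAlgebra.der (LocalPoissonAlgebra.prod 1 c a) := by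
  rw [LocalPoissonAlgebra.skew 0 a c,
    finsum_eq_sum_of_support_subset (s := Finset.range 2) _ fun j hj => ?_]
  · simp [Finset.sum_range_succ]
    ring
  · by_contra hj'
    have h2 : 2 ≤ j := by
      simp only [Finset.coe_range, Set.mem_Iio, not_lt] at hj'
      exact hj'
    refine hj ?_
    simp only [zero_add, h j h2, iterate_map_zero, smul_zero]

end LocalBrackets

/-! ### Powers and traces of a matrix, and their derivatives -/

section MatrixPowers

variable {R ι : Type*} [CommRing R] [Fintype ι] [DecidableEq ι]

/-- The derivative of `S ↦ Sᵏ` in the direction `Z`. -/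
def dPow (k : ℕ) (S Z : Matrix ι ι R) : Matrix ι ι R :=
  ∑ i ∈ Finset.range k, S ^ i * Z * S ^ (k - 1 - i)

theorem dPow_succ (k : ℕ) (S Z : Matrix ι ι R) :
    dPow (k + 1) S Z = dPow k S Z * S + S ^ k * Z := by
  rw [dPow, Finset.sum_range_succ, dPow, Finset.sum_mul]
  congr 1
  · refine Finset.sum_congr rfl fun i hi => ?_
    have : k + 1 - 1 - i = k - 1 - i + 1 := by
      have := Finset.mem_range.1 hi
      omega
    rw [this, pow_succ]
    simp only [mul_assoc]
  · simp

theorem dPow_zero (S Z : Matrix ι ι R) : dPow 0 S Z = 0 := by simp [dPow]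

theorem dPow_one_right (k : ℕ) (S : Matrix ι ι R) : dPow k S 1 = k • S ^ (k - 1) := by
  rw [dPow, Finset.sum_congr rfl (g := fun _ => S ^ (k - 1)), Finset.sum_const, Finset.card_range]
  intro i hi
  have := Finset.mem_range.1 hi
  rw [mul_one, ← pow_add]
  congr 1
  omega

theorem dPow_add (k : ℕ) (S Z Z' : Matrix ι ι R) :
    dPow k S (Z + Z') = dPow k S Z + dPow k S Z' := by
  simp [dPow, mul_add, add_mul, Finset.sum_add_distrib]

theorem dPow_smul {A : Type*} [CommSemiring A] [Algebra A R] (k : ℕ) (a : A) (S Z : Matrix ι ι R) :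
    dPow k S (a • Z) = a • dPow k S Z := by
  simp [dPow, Finset.smul_sum]

/-- `⁅B, S⁆` is the infinitesimal conjugation of `S`, and taking powers is conjugation equivariant.
-/
theorem dPow_lie (k : ℕ) (S B : Matrix ι ι R) : dPow k S ⁅B, S⁆ = ⁅B, S ^ k⁆ := by
  induction k with
  | zero => simp [dPow, Ring.lie_def]
  | succ k ih =>
    rw [dPow_succ, ih, pow_succ]
    simp only [Ring.lie_def]
    noncomm_ring

theorem trace_mul_dPow (k j : ℕ) (S Z : Matrix ι ι R) :
    (S ^ j * dPow k S Z).trace = k * (S ^ (j + (k - 1)) * Z).trace := by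
  rw [dPow, Finset.mul_sum, Matrix.trace_sum, Finset.sum_congr rfl
    (g := fun _ => (S ^ (j + (k - 1)) * Z).trace), Finset.sum_const, Finset.card_range,
    nsmul_eq_mul]
  intro i hi
  have := Finset.mem_range.1 hi
  have h : j + (k - 1) = (k - 1 - i) + (j + i) := by omega
  rw [h, pow_add, pow_add S j i]
  simp only [← mul_assoc]
  rw [Matrix.trace_mul_comm]
  simp only [← mul_assoc]

/-- Both maps are polynomials in left and right multiplication by `S`, which commute. This is all
that types B, C and D need for the commutation of the Hessians. -/
theorem dPow_dPow_comm (k l : ℕ) (S Z : Matrix ι ι R) :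
    dPow k S (dPow l S Z) = dPow l S (dPow k S Z) := by
  simp only [dPow, Finset.mul_sum, Finset.sum_mul]
  rw [Finset.sum_comm]
  refine Finset.sum_congr rfl fun i _ => Finset.sum_congr rfl fun j _ => ?_
  have h1 : ∀ a b : ℕ, S ^ a * S ^ b = S ^ b * S ^ a := fun a b => by
    rw [← pow_add, ← pow_add, add_comm]
  calc S ^ j * (S ^ i * Z * S ^ (l - 1 - i)) * S ^ (k - 1 - j)
      = (S ^ j * S ^ i) * Z * (S ^ (l - 1 - i) * S ^ (k - 1 - j)) := by simp only [mul_assoc]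
    _ = (S ^ i * S ^ j) * Z * (S ^ (k - 1 - j) * S ^ (l - 1 - i)) := by rw [h1, h1 (l - 1 - i)]
    _ = _ := by simp only [mul_assoc]

variable [Algebra ℂ R]

omit [DecidableEq ι] in
theorem map_derivation_mul (D : Derivation ℂ R R) (A B : Matrix ι ι R) :
    (A * B).map D = A.map D * B + A * B.map D := by
  ext i j
  simp only [Matrix.map_apply, Matrix.mul_apply, Matrix.add_apply, map_sum, Derivation.leibniz,
    smul_eq_mul, ← Finset.sum_add_distrib]
  exact Finset.sum_congr rfl fun k _ => by ring

omit [Fintype ι] in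
theorem map_derivation_one (D : Derivation ℂ R R) : (1 : Matrix ι ι R).map D = 0 := by
  ext i j
  rw [Matrix.map_apply, Matrix.one_apply]
  split_ifs <;> simp

omit [Fintype ι] [DecidableEq ι] in
theorem map_derivation_smul (D : Derivation ℂ R R) (a : R) (B : Matrix ι ι R) :
    (a • B).map D = D a • B + a • B.map D := by
  ext i j
  simp only [Matrix.map_apply, Matrix.smul_apply, Matrix.add_apply, Derivation.leibniz,
    smul_eq_mul]
  ring

theorem map_derivation_pow (D : Derivation ℂ R R) (S : Matrix ι ι R) (k : ℕ) :
    (S ^ k).map D = dPow k S (S.map D) := by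
  induction k with
  | zero => simp [dPow, map_derivation_one]
  | succ k ih => rw [pow_succ, map_derivation_mul, ih, dPow_succ]

omit [DecidableEq ι] in
theorem derivation_trace (D : Derivation ℂ R R) (S : Matrix ι ι R) :
    D S.trace = (S.map D).trace := by
  simp [Matrix.trace]

theorem derivation_trace_pow (D : Derivation ℂ R R) (S : Matrix ι ι R) (k : ℕ) :
    D (S ^ k).trace = k * (S ^ (k - 1) * S.map D).trace := by
  have := trace_mul_dPow k 0 S (S.map D)
  rw [derivation_trace, map_derivation_pow]
  simpa using this

/-- The chain rule. The finite range loses nothing because `p` only involves variables with index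
below `N`. -/
theorem derivation_aeval (D : Derivation ℂ R R) (t : ℕ → R) {N : ℕ} {p : MvPolynomial ℕ ℂ}
    (hp : p ∈ MvPolynomial.supported ℂ {k | k < N}) :
    D (MvPolynomial.aeval t p) =
      ∑ k ∈ Finset.range N, MvPolynomial.aeval t (MvPolynomial.pderiv k p) * D (t k) := by
  rw [MvPolynomial.supported] at hp
  induction hp using Algebra.adjoin_induction with
  | mem x hx =>
    obtain ⟨k, hk, rfl⟩ := hx
    rw [Finset.sum_eq_single k]
    · simp
    · intro j _ hj
      rw [MvPolynomial.pderiv_X_of_ne hj.symm]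
      simp
    · intro h
      exact absurd (Finset.mem_range.2 hk) h
  | algebraMap r =>
    simp [MvPolynomial.algebraMap_eq]
  | add x y _ _ hx hy => simp only [map_add, hx, hy, add_mul, Finset.sum_add_distrib]
  | mul x y _ _ hx hy =>
    simp only [map_mul, Derivation.leibniz, hx, hy, smul_eq_mul, map_add, add_mul,
      Finset.sum_add_distrib, Finset.mul_sum]
    congr 1 <;> refine Finset.sum_congr rfl fun k _ => ?_ <;> ring

/-- The gradient at `S` of the function `S ↦ p(Tr S⁰, Tr S¹, Tr S², …)`. -/
def gradient (N : ℕ) (p : MvPolynomial ℕ ℂ) (S : Matrix ι ι R) : Matrix ι ι R :=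
  ∑ k ∈ Finset.range N,
    MvPolynomial.aeval (fun j => (S ^ j).trace) (MvPolynomial.pderiv k p) •
      (k : R) • S ^ (k - 1)

theorem derivation_aeval_trace (D : Derivation ℂ R R) (S : Matrix ι ι R) {N : ℕ}
    {p : MvPolynomial ℕ ℂ} (hp : p ∈ MvPolynomial.supported ℂ {k | k < N}) :
    D (MvPolynomial.aeval (fun j => (S ^ j).trace) p) = (gradient N p S * S.map D).trace := by
  rw [derivation_aeval D _ hp, gradient, Finset.sum_mul, Matrix.trace_sum]
  refine Finset.sum_congr rfl fun k _ => ?_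
  rw [derivation_trace_pow, Matrix.smul_mul, Matrix.smul_mul, Matrix.trace_smul, Matrix.trace_smul,
    smul_eq_mul, smul_eq_mul]

theorem gradient_commute (N : ℕ) (p : MvPolynomial ℕ ℂ) (S : Matrix ι ι R) :
    Commute (gradient N p S) S := by
  refine Commute.sum_left _ _ _ fun k _ => ?_
  exact ((Commute.pow_self S _).smul_left _).smul_left _

end MatrixPowers

/-! ### Partial traces -/

section PartialTrace

variable {R ι : Type*} [CommRing R] [Fintype ι] [DecidableEq ι]

theorem partialTrace₂_mul_apply (Z : Matrix (ι × ι) (ι × ι) R) (X : Matrix ι ι R) (i k : ι) :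
    partialTrace₂ (Z * ((1 : Matrix ι ι R) ⊗ₖ X)) i k = ∑ j, ∑ l, Z (i, j) (k, l) * X l j := by
  simp only [partialTrace₂, Matrix.of_apply, Matrix.mul_apply, Fintype.sum_prod_type,
    Matrix.kroneckerMap_apply, Matrix.one_apply]
  refine Finset.sum_congr rfl fun j _ => ?_
  rw [Finset.sum_eq_single k]
  · simp
  · intro b _ hb
    simp [hb]
  · simp

omit [DecidableEq ι] in
theorem partialTrace₂_sub (U V : Matrix (ι × ι) (ι × ι) R) :
    partialTrace₂ (U - V) = partialTrace₂ U - partialTrace₂ V := by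
  ext
  simp [partialTrace₂]

theorem partialTrace₂_mul_left (Z : Matrix (ι × ι) (ι × ι) R) (A : Matrix ι ι R) :
    partialTrace₂ (Z * (A ⊗ₖ (1 : Matrix ι ι R))) = partialTrace₂ Z * A := by
  ext i k
  simp only [partialTrace₂, Matrix.of_apply, Matrix.mul_apply, Fintype.sum_prod_type,
    Matrix.kroneckerMap_apply, Matrix.one_apply, mul_ite, mul_one, mul_zero, Finset.sum_ite_eq',
    Finset.mem_univ, if_true, Finset.sum_mul]
  exact Finset.sum_comm

theorem partialTrace₂_left_mul (Z : Matrix (ι × ι) (ι × ι) R) (A : Matrix ι ι R) :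
    partialTrace₂ ((A ⊗ₖ (1 : Matrix ι ι R)) * Z) = A * partialTrace₂ Z := by
  ext i k
  simp only [partialTrace₂, Matrix.of_apply, Matrix.mul_apply, Fintype.sum_prod_type,
    Matrix.kroneckerMap_apply, Matrix.one_apply, mul_ite, mul_one, mul_zero, ite_mul, zero_mul,
    Finset.sum_ite_eq, Finset.mem_univ, if_true, Finset.mul_sum]
  exact Finset.sum_comm

theorem partialTrace₂_right_comm (Z : Matrix (ι × ι) (ι × ι) R) (B : Matrix ι ι R) :
    partialTrace₂ (((1 : Matrix ι ι R) ⊗ₖ B) * Z) =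
      partialTrace₂ (Z * ((1 : Matrix ι ι R) ⊗ₖ B)) := by
  ext i k
  rw [partialTrace₂_mul_apply, Finset.sum_comm]
  simp only [partialTrace₂, Matrix.of_apply, Matrix.mul_apply, Fintype.sum_prod_type,
    Matrix.kroneckerMap_apply, Matrix.one_apply, ite_mul, one_mul, zero_mul]
  refine Finset.sum_congr rfl fun j _ => ?_
  rw [Finset.sum_comm]
  refine Finset.sum_congr rfl fun l _ => ?_
  simp [mul_comm]

/-- Matrices in the first factor commute with those in the second, so the commutator can be taken
outside the trace. This produces the term `[𝓜ₙ, S]` of the flow. -/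
theorem partialTrace₂_lie_left (Z : Matrix (ι × ι) (ι × ι) R) (X A : Matrix ι ι R) :
    partialTrace₂ (⁅Z, A ⊗ₖ (1 : Matrix ι ι R)⁆ * ((1 : Matrix ι ι R) ⊗ₖ X)) =
      ⁅partialTrace₂ (Z * ((1 : Matrix ι ι R) ⊗ₖ X)), A⁆ := by
  have h : (A ⊗ₖ (1 : Matrix ι ι R)) * ((1 : Matrix ι ι R) ⊗ₖ X) =
      ((1 : Matrix ι ι R) ⊗ₖ X) * (A ⊗ₖ (1 : Matrix ι ι R)) := by
    rw [← Matrix.mul_kronecker_mul, ← Matrix.mul_kronecker_mul]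
    simp
  rw [Ring.lie_def, Ring.lie_def, sub_mul, partialTrace₂_sub, mul_assoc, h, ← mul_assoc,
    partialTrace₂_mul_left, mul_assoc, partialTrace₂_left_mul]

/-- Cyclicity of the trace in the second factor. It eliminates the second commutator of the Poisson
bracket, since the gradient of an invariant function commutes with its argument. -/
theorem partialTrace₂_lie_right (Z : Matrix (ι × ι) (ι × ι) R) {X A : Matrix ι ι R}
    (h : Commute X A) :
    partialTrace₂ (⁅Z, (1 : Matrix ι ι R) ⊗ₖ A⁆ * ((1 : Matrix ι ι R) ⊗ₖ X)) = 0 := by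
  rw [Ring.lie_def, sub_mul, partialTrace₂_sub, mul_assoc, mul_assoc, partialTrace₂_right_comm,
    mul_assoc, ← Matrix.mul_kronecker_mul, ← Matrix.mul_kronecker_mul, h.eq, sub_self]

end PartialTrace

/-! ### Automorphisms given by matrix conjugation -/

section Twist

variable {R R' ι : Type*} [CommRing R] [Algebra ℂ R] [CommRing R'] [Algebra ℂ R'] [Fintype ι]
  [DecidableEq ι]

/-- `X ↦ Q X Q⁻¹` or, if `b` is false, `X ↦ -Q Xᵀ Q⁻¹`. -/
def twist (R : Type*) [CommRing R] [Algebra ℂ R] (b : Bool) (Q : GL ι ℂ) :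
    Matrix ι ι R →ₗ[R] Matrix ι ι R where
  toFun X := bif b then (Q : Matrix ι ι ℂ).map (algebraMap ℂ R) * X *
      ((Q⁻¹ : GL ι ℂ) : Matrix ι ι ℂ).map (algebraMap ℂ R)
    else -((Q : Matrix ι ι ℂ).map (algebraMap ℂ R) * X.transpose *
      ((Q⁻¹ : GL ι ℂ) : Matrix ι ι ℂ).map (algebraMap ℂ R))
  map_add' X Y := by cases b <;> simp [mul_add, add_mul, add_comm]
  map_smul' a X := by cases b <;> simp

/-- The sign of `twist b Q`. -/
def twistSign (b : Bool) : ℂ := bif b then 1 else -1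

theorem twistSign_mul_self (b : Bool) : twistSign b * twistSign b = 1 := by
  cases b <;> simp [twistSign]

theorem map_GL_inv_mul (Q : GL ι ℂ) :
    ((Q⁻¹ : GL ι ℂ) : Matrix ι ι ℂ).map (algebraMap ℂ R) *
      (Q : Matrix ι ι ℂ).map (algebraMap ℂ R) = 1 := by
  rw [← Matrix.map_mul, ← Units.val_mul, inv_mul_cancel, Units.val_one, Matrix.map_one] <;> simp

theorem twist_mul (b : Bool) (Q : GL ι ℂ) (X Y : Matrix ι ι R) :
    twist R b Q (X * Y) = bif b then twist R b Q X * twist R b Q Y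
      else -(twist R b Q Y * twist R b Q X) := by
  have h : ∀ U V : Matrix ι ι R, (Q : Matrix ι ι ℂ).map (algebraMap ℂ R) * U *
      ((Q⁻¹ : GL ι ℂ) : Matrix ι ι ℂ).map (algebraMap ℂ R) *
      ((Q : Matrix ι ι ℂ).map (algebraMap ℂ R) * V *
      ((Q⁻¹ : GL ι ℂ) : Matrix ι ι ℂ).map (algebraMap ℂ R)) =
      (Q : Matrix ι ι ℂ).map (algebraMap ℂ R) * (U * V) *
      ((Q⁻¹ : GL ι ℂ) : Matrix ι ι ℂ).map (algebraMap ℂ R) := fun U V => by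
    calc _ = (Q : Matrix ι ι ℂ).map (algebraMap ℂ R) * U *
          (((Q⁻¹ : GL ι ℂ) : Matrix ι ι ℂ).map (algebraMap ℂ R) *
            (Q : Matrix ι ι ℂ).map (algebraMap ℂ R)) * V *
          ((Q⁻¹ : GL ι ℂ) : Matrix ι ι ℂ).map (algebraMap ℂ R) := by simp only [mul_assoc]
      _ = _ := by rw [map_GL_inv_mul, mul_one]; simp only [mul_assoc]
  cases b
  · simp only [twist, LinearMap.coe_mk, AddHom.coe_mk, cond_false, neg_mul_neg, h,
      Matrix.transpose_mul]
  · simp only [twist, LinearMap.coe_mk, AddHom.coe_mk, cond_true, h]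

theorem twist_lie (b : Bool) (Q : GL ι ℂ) (X Y : Matrix ι ι R) :
    twist R b Q ⁅X, Y⁆ = ⁅twist R b Q X, twist R b Q Y⁆ := by
  rw [Ring.lie_def, Ring.lie_def, map_sub, twist_mul, twist_mul]
  cases b
  · simp only [cond_false]
    abel
  · rfl

theorem twist_one (b : Bool) (Q : GL ι ℂ) :
    twist R b Q 1 = twistSign b • (1 : Matrix ι ι R) := by
  cases b <;> simp [twist, twistSign]

/-- With a transpose, the twist is minus an antiautomorphism, so its value on a `j`-th power
acquires the sign `(-1) ^ (j + 1)`. The exponent `kappa` is designed to account for this sign. -/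
theorem twist_pow (b : Bool) (Q : GL ι ℂ) (X : Matrix ι ι R) (j : ℕ) :
    twist R b Q (X ^ j) = twistSign b ^ (j + 1) • (twist R b Q X) ^ j := by
  induction j with
  | zero => simp [twist_one]
  | succ j ih =>
    rw [pow_succ', twist_mul]
    cases b
    · simp only [cond_false, ih, pow_succ (twist R false Q X), Matrix.smul_mul]
      simp [twistSign, pow_succ]
    · simp only [cond_true, ih, pow_succ' (twist R true Q X), Matrix.mul_smul]
      simp [twistSign]

theorem trace_twist (b : Bool) (Q : GL ι ℂ) (X : Matrix ι ι R) :
    (twist R b Q X).trace = twistSign b • X.trace := by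
  cases b
  · simp only [twist, LinearMap.coe_mk, AddHom.coe_mk, cond_false, twistSign, Matrix.trace_neg]
    rw [Matrix.trace_mul_comm, ← mul_assoc, map_GL_inv_mul, one_mul, Matrix.trace_transpose]
    simp
  · simp only [twist, LinearMap.coe_mk, AddHom.coe_mk, cond_true, twistSign]
    rw [Matrix.trace_mul_comm, ← mul_assoc, map_GL_inv_mul, one_mul]
    simp

omit [DecidableEq ι] in
theorem map_algebraMap_mul_map (A : Matrix ι ι ℂ) (X : Matrix ι ι R) (f : R →ₗ[ℂ] R') :
    (A.map (algebraMap ℂ R) * X).map f = A.map (algebraMap ℂ R') * X.map f := by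
  ext i j
  simp [Matrix.mul_apply, ← Algebra.smul_def]

omit [DecidableEq ι] in
theorem mul_map_algebraMap_map (A : Matrix ι ι ℂ) (X : Matrix ι ι R) (f : R →ₗ[ℂ] R') :
    (X * A.map (algebraMap ℂ R)).map f = X.map f * A.map (algebraMap ℂ R') := by
  ext i j
  simp [Matrix.mul_apply, ← Algebra.commutes, ← Algebra.smul_def]

theorem twist_map (b : Bool) (Q : GL ι ℂ) (X : Matrix ι ι R) (f : R →ₗ[ℂ] R') :
    (twist R b Q X).map f = twist R' b Q (X.map f) := by
  cases b
  · simp only [twist, LinearMap.coe_mk, AddHom.coe_mk, cond_false]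
    rw [← Matrix.transpose_map, ← map_algebraMap_mul_map, ← mul_map_algebraMap_map]
    ext
    simp
  · simp only [twist, LinearMap.coe_mk, AddHom.coe_mk, cond_true]
    rw [mul_map_algebraMap_map, map_algebraMap_mul_map]

theorem twist_pow_map (b : Bool) (Q : GL ι ℂ) (k : ℕ) (X : Matrix ι ι R) (f : R →ₗ[ℂ] R') :
    ((twist R b Q ^ k) X).map f = (twist R' b Q ^ k) (X.map f) := by
  induction k with
  | zero => simp
  | succ k ih => rw [pow_succ', pow_succ', Module.End.mul_apply, Module.End.mul_apply, twist_map, ih]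

/-- An `R`-linear map on matrices is determined by its values on complex matrices. -/
theorem matrix_linearMap_ext {M : Type*} [AddCommGroup M] [Module R M]
    {f g : Matrix ι ι R →ₗ[R] M}
    (h : ∀ A : Matrix ι ι ℂ, f (A.map (algebraMap ℂ R)) = g (A.map (algebraMap ℂ R))) : f = g := by
  refine LinearMap.ext fun X => ?_
  rw [Matrix.matrix_eq_sum_single X, map_sum, map_sum]
  refine Finset.sum_congr rfl fun i _ => ?_
  rw [map_sum, map_sum]
  refine Finset.sum_congr rfl fun j _ => ?_
  have h1 : Matrix.single i j (X i j) =
      X i j • (Matrix.single i j (1 : ℂ)).map (algebraMap ℂ R) := by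
    rw [Matrix.map_single, map_one, Matrix.smul_single, smul_eq_mul, mul_one]
  rw [h1, map_smul, map_smul, h]

omit [DecidableEq ι] in
theorem trace_map_algebraMap (A : Matrix ι ι ℂ) :
    (A.map (algebraMap ℂ R)).trace = algebraMap ℂ R A.trace := by
  simp [Matrix.trace]

end Twist

/-! ### The Casimir tensor -/

namespace ModelData

section Casimir

variable {𝒜 ι κ : Type*} [CommRing 𝒜] [Algebra ℂ 𝒜] [Fintype ι] [DecidableEq ι] [Fintype κ]
variable (S : ModelData 𝒜 ι κ)
variable {R R' : Type*} [CommRing R] [Algebra ℂ R] [CommRing R'] [Algebra ℂ R']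

/-- `X ↦ Tr₂ (σ₁ᵏ C₁₂ X₂)`. -/
def casimirMap (R : Type*) [CommRing R] [Algebra ℂ R] (k : ℕ) :
    Matrix ι ι R →ₗ[R] Matrix ι ι R where
  toFun X := ∑ a, ((S.dualBasis a : Matrix ι ι ℂ).map (algebraMap ℂ R) * X).trace •
    ((S.sigmaEnd ^ k) (S.basis a) : Matrix ι ι ℂ).map (algebraMap ℂ R)
  map_add' X Y := by simp [mul_add, add_smul, Finset.sum_add_distrib]
  map_smul' a X := by simp [Finset.smul_sum, smul_smul]

theorem casimirMap_apply (k : ℕ) (X : Matrix ι ι R) : S.casimirMap R k X =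
    ∑ a, ((S.dualBasis a : Matrix ι ι ℂ).map (algebraMap ℂ R) * X).trace •
      ((S.sigmaEnd ^ k) (S.basis a) : Matrix ι ι ℂ).map (algebraMap ℂ R) := rfl

theorem partialTrace₂_twistedCasimir (k : ℕ) (X : Matrix ι ι R) :
    partialTrace₂ ((S.twistedCasimir k).map (algebraMap ℂ R) * ((1 : Matrix ι ι R) ⊗ₖ X)) =
      S.casimirMap R k X := by
  ext i j
  rw [partialTrace₂_mul_apply, casimirMap_apply]
  simp only [twistedCasimir, Matrix.map_apply, Matrix.sum_apply, Matrix.kroneckerMap_apply,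
    map_sum, map_mul, Matrix.smul_apply, Matrix.trace, Matrix.diag_apply, Matrix.mul_apply,
    smul_eq_mul, Finset.sum_mul]
  calc _ = ∑ x, ∑ a, ∑ y, _ := Finset.sum_congr rfl fun x _ => Finset.sum_comm
    _ = ∑ a, ∑ x, ∑ y, _ := Finset.sum_comm
    _ = _ := Finset.sum_congr rfl fun a _ => Finset.sum_congr rfl fun x _ =>
      Finset.sum_congr rfl fun y _ => by ring

theorem partialTrace₂_cyclicSum (c : ℕ → R) (X : Matrix ι ι R) :
    partialTrace₂ (S.cyclicSum c * ((1 : Matrix ι ι R) ⊗ₖ X)) =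
      (S.T : ℂ)⁻¹ • ∑ k ∈ Finset.range S.T, c k • S.casimirMap R k X := by
  simp only [← partialTrace₂_twistedCasimir, cyclicSum]
  ext i j
  simp only [partialTrace₂, Matrix.smul_mul, Finset.sum_mul, Matrix.of_apply, Matrix.smul_apply,
    Matrix.sum_apply, Finset.smul_sum]
  rw [Finset.sum_comm]

theorem cyclicSum_map (f : R →ₐ[ℂ] R') (c : ℕ → R) :
    (S.cyclicSum c).map f = S.cyclicSum fun k => f (c k) := by
  ext i j
  simp [cyclicSum, Matrix.sum_apply]

end Casimir

end ModelData

/-! ### The trace-orthogonal projection onto the Lie algebra, and `σ` as a matrix twist. -/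

section Projection

variable {𝒜 ι κ : Type*} [CommRing 𝒜] [Algebra ℂ 𝒜] [LocalPoissonAlgebra 𝒜]
    [Fintype ι] [DecidableEq ι] [Fintype κ] [DecidableEq κ]
variable {S : ModelData 𝒜 ι κ}
variable {R R' : Type*} [CommRing R] [Algebra ℂ R] [CommRing R'] [Algebra ℂ R']

/-- Duality of the bases makes contraction with `C₁₂` the identity on `g`. Together with its
vanishing on the trace-orthogonal complement, this makes it the orthogonal projection onto `g`. -/
theorem IsRSSystem.casimirMap_zero_of_mem (hS : IsRSSystem S) {A : Matrix ι ι ℂ} (hA : A ∈ S.g) :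
    S.casimirMap R 0 (A.map (algebraMap ℂ R)) = A.map (algebraMap ℂ R) := by
  have h1 : A = ∑ a, S.basis.repr ⟨A, hA⟩ a • (S.basis a : Matrix ι ι ℂ) := by
    have h := congrArg S.g.toSubmodule.subtype (S.basis.sum_repr ⟨A, hA⟩)
    rw [map_sum] at h
    exact h.symm
  rw [ModelData.casimirMap_apply]
  have h2 : ∀ a, ((S.dualBasis a : Matrix ι ι ℂ) * A).trace = S.basis.repr ⟨A, hA⟩ a := fun a => by
    conv_lhs => rw [h1]
    rw [Finset.mul_sum, Matrix.trace_sum, Finset.sum_eq_single a]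
    · rw [Matrix.mul_smul, Matrix.trace_smul, Matrix.trace_mul_comm, hS.dual]
      simp
    · intro b _ hb
      rw [Matrix.mul_smul, Matrix.trace_smul, Matrix.trace_mul_comm, hS.dual, if_neg hb, smul_zero]
    · simp
  have h3 : ∀ a, ((S.dualBasis a : Matrix ι ι ℂ).map (algebraMap ℂ R) *
      A.map (algebraMap ℂ R)).trace = algebraMap ℂ R (S.basis.repr ⟨A, hA⟩ a) := fun a => by
    rw [← h2, ← Matrix.map_mul, trace_map_algebraMap]
  conv_rhs => rw [h1]
  ext i j
  simp only [h3, Matrix.sum_apply, Matrix.smul_apply, Matrix.map_apply, smul_eq_mul, map_sum,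
    map_mul, pow_zero, Module.End.one_apply]

omit [LocalPoissonAlgebra 𝒜] [DecidableEq κ] in
theorem ModelData.casimirMap_eq_zero {A : Matrix ι ι ℂ}
    (hA : ∀ U ∈ S.g, (U * A).trace = 0) (k : ℕ) :
    S.casimirMap R k (A.map (algebraMap ℂ R)) = 0 := by
  rw [ModelData.casimirMap_apply]
  refine Finset.sum_eq_zero fun a _ => ?_
  have h : ((S.dualBasis a : Matrix ι ι ℂ).map (algebraMap ℂ R) * A.map (algebraMap ℂ R)).trace =
      algebraMap ℂ R ((S.dualBasis a : Matrix ι ι ℂ) * A).trace := by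
    rw [← Matrix.map_mul, trace_map_algebraMap]
  rw [h, hA _ (S.dualBasis a).2, map_zero, zero_smul]

/-- The traceless part of a matrix. -/
def traceless (R ι : Type*) [CommRing R] [Algebra ℂ R] [Fintype ι] [DecidableEq ι] :
    Matrix ι ι R →ₗ[R] Matrix ι ι R :=
  LinearMap.id - (Matrix.traceLinearMap ι R R).smulRight
    (algebraMap ℂ R (Fintype.card ι : ℂ)⁻¹ • (1 : Matrix ι ι R))

theorem traceless_apply (X : Matrix ι ι R) :
    traceless R ι X = X - (algebraMap ℂ R (Fintype.card ι : ℂ)⁻¹ * X.trace) • 1 := by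
  rw [mul_comm, mul_smul]
  rfl

theorem traceless_one (h : (Fintype.card ι : ℂ) ≠ 0) : traceless R ι 1 = 0 := by
  rw [traceless_apply, Matrix.trace_one]
  have : (Fintype.card ι : R) = algebraMap ℂ R (Fintype.card ι : ℂ) := by simp
  rw [this, ← map_mul, inv_mul_cancel₀ h]
  simp

theorem trace_traceless (h : (Fintype.card ι : ℂ) ≠ 0) (X : Matrix ι ι R) :
    (traceless R ι X).trace = 0 := by
  rw [traceless_apply, Matrix.trace_sub, Matrix.trace_smul, Matrix.trace_one]
  have h1 : (Fintype.card ι : R) = algebraMap ℂ R (Fintype.card ι : ℂ) := by simp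
  have h2 : algebraMap ℂ R (Fintype.card ι : ℂ)⁻¹ * algebraMap ℂ R (Fintype.card ι : ℂ) = 1 := by
    rw [← map_mul, inv_mul_cancel₀ h, map_one]
  rw [h1, smul_eq_mul, mul_right_comm, h2, one_mul, sub_self]

theorem traceless_of_trace_eq_zero {X : Matrix ι ι R} (h : X.trace = 0) :
    traceless R ι X = X := by
  rw [traceless_apply, h]
  simp

theorem map_traceless (f : R →ₗ[ℂ] R') (X : Matrix ι ι R) :
    (traceless R ι X).map f = traceless R' ι (X.map f) := by
  have h : (X.map f).trace = f X.trace := by simp [Matrix.trace]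
  rw [traceless_apply, traceless_apply, h, ← Algebra.smul_def, ← Algebra.smul_def]
  ext i j
  simp only [Matrix.map_apply, Matrix.sub_apply, Matrix.smul_apply, map_sub, Matrix.one_apply]
  split_ifs <;> simp

namespace IsRSSystem

variable (hS : IsRSSystem S)

include hS

theorem card_ne_zero (hA : S.type = .A) : (Fintype.card ι : ℂ) ≠ 0 := by
  have h := hS.definingRep
  rw [hA] at h
  have : 2 ≤ Fintype.card ι := h.1
  exact_mod_cast (by omega : Fintype.card ι ≠ 0)

theorem mem_iff_trace (hA : S.type = .A) (X : Matrix ι ι ℂ) : X ∈ S.g ↔ X.trace = 0 := by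
  have h := hS.definingRep
  rw [hA] at h
  rw [h.2]
  exact LinearMap.mem_ker

/-- The orthogonal complement of the traceless matrices consists of the scalar ones. -/
theorem casimirMap_zero_typeA (hA : S.type = .A) : S.casimirMap R 0 = traceless R ι := by
  refine matrix_linearMap_ext fun A => ?_
  have h1 : A = traceless ℂ ι A + ((Fintype.card ι : ℂ)⁻¹ * A.trace) • 1 := by
    rw [traceless_apply]
    simp
  have h2 : traceless ℂ ι A ∈ S.g :=
    (hS.mem_iff_trace hA _).2 (trace_traceless (hS.card_ne_zero hA) A)
  have h3 : (traceless ℂ ι A).map (algebraMap ℂ R) = traceless R ι (A.map (algebraMap ℂ R)) :=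
    map_traceless (Algebra.linearMap ℂ R) A
  have h4 : (((Fintype.card ι : ℂ)⁻¹ * A.trace) • (1 : Matrix ι ι ℂ)).map (algebraMap ℂ R) =
      algebraMap ℂ R ((Fintype.card ι : ℂ)⁻¹ * A.trace) • (1 : Matrix ι ι ℂ).map (algebraMap ℂ R) := by
    ext i j
    simp only [Matrix.map_apply, Matrix.smul_apply, smul_eq_mul, map_mul]
  have h5 : S.casimirMap R 0 ((1 : Matrix ι ι ℂ).map (algebraMap ℂ R)) = 0 :=
    ModelData.casimirMap_eq_zero (fun U hU => by
      rw [mul_one]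
      exact (hS.mem_iff_trace hA _).1 hU) 0
  conv_lhs => rw [h1]
  rw [Matrix.map_add _ (map_add _), map_add, h4, map_smul, h5, smul_zero, add_zero,
    hS.casimirMap_zero_of_mem h2, h3]

/-- Treats orthogonal and symplectic algebras at once: `J` is the identity with `s = 1`, or the
standard skew form transported to `ι` with `s = -1`. -/
theorem exists_form (hA : S.type ≠ .A) : ∃ (J J' : Matrix ι ι ℂ) (s : ℂ), J * J' = 1 ∧ J' * J = 1 ∧
    J.transpose = s • J ∧ s * s = 1 ∧ ∀ X : Matrix ι ι ℂ, X ∈ S.g ↔ X.transpose * J = -(J * X) := by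
  have h := hS.definingRep
  rcases hT : S.type with _ | _ | _
  · exact absurd hT hA
  · rw [hT] at h
    obtain ⟨-, -, h⟩ := h
    refine ⟨1, 1, 1, by simp, by simp, by simp, by simp, fun X => ?_⟩
    rw [h, LieAlgebra.Orthogonal.mem_so]
    simp
  · rw [hT] at h
    obtain ⟨l, e, -, h⟩ := h
    have hJ := Matrix.J_squared (Fin l) ℂ
    have hJ' : (Matrix.J (Fin l) ℂ).submatrix e.symm e.symm *
        (Matrix.J (Fin l) ℂ).submatrix e.symm e.symm = -1 := by
      rw [Matrix.submatrix_mul_equiv, hJ]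
      simp [Matrix.submatrix_neg, Matrix.submatrix_one_equiv]
    refine ⟨(Matrix.J (Fin l) ℂ).submatrix e.symm e.symm,
      -(Matrix.J (Fin l) ℂ).submatrix e.symm e.symm, -1, ?_, ?_, ?_, by simp, fun X => ?_⟩
    · rw [mul_neg, hJ', neg_neg]
    · rw [neg_mul, hJ', neg_neg]
    · rw [Matrix.transpose_submatrix, Matrix.J_transpose]
      simp [Matrix.submatrix_neg]
    · rw [h]
      have h1 : X.submatrix e e ∈ LieAlgebra.Symplectic.sp (Fin l) ℂ ↔
          (X.submatrix e e).transpose * Matrix.J (Fin l) ℂ =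
            Matrix.J (Fin l) ℂ * -(X.submatrix e e) := by
        rw [LieAlgebra.Symplectic.sp, mem_skewAdjointMatricesLieSubalgebra,
          mem_skewAdjointMatricesSubmodule]
        rfl
      rw [h1, ← (Matrix.reindex e e).injective.eq_iff]
      simp only [Matrix.reindex_apply]
      rw [← Matrix.submatrix_mul_equiv _ _ _ e.symm, ← Matrix.submatrix_mul_equiv _ _ _ e.symm]
      simp [Matrix.transpose_submatrix, Matrix.submatrix_neg]

/-- The map `X ↦ J⁻¹ Xᵀ J` is an involution whose `-1` eigenspace is `g`; its `+1` eigenspace is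
orthogonal to `g` for the trace form. So the projection is half of the identity minus the
involution. -/
theorem casimirMap_zero_of_form (J J' : Matrix ι ι ℂ) (s : ℂ) (h1 : J * J' = 1) (h2 : J' * J = 1)
    (h3 : J.transpose = s • J) (h4 : s * s = 1)
    (h5 : ∀ X : Matrix ι ι ℂ, X ∈ S.g ↔ X.transpose * J = -(J * X)) (X : Matrix ι ι R) :
    S.casimirMap R 0 X = algebraMap ℂ R 2⁻¹ •
      (X - J'.map (algebraMap ℂ R) * X.transpose * J.map (algebraMap ℂ R)) := by
  let f : Matrix ι ι R →ₗ[R] Matrix ι ι R :=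
    { toFun := fun X => algebraMap ℂ R 2⁻¹ •
        (X - J'.map (algebraMap ℂ R) * X.transpose * J.map (algebraMap ℂ R))
      map_add' := fun X Y => by
        simp only [Matrix.transpose_add, mul_add, add_mul, smul_sub, smul_add]
        abel
      map_smul' := fun a X => by
        simp only [Matrix.transpose_smul, Matrix.mul_smul, Matrix.smul_mul, ← smul_sub, RingHom.id_apply]
        rw [smul_comm] }
  suffices h : S.casimirMap R 0 = f by
    rw [h]
    rfl
  refine matrix_linearMap_ext fun A => ?_
  have hA1 : A = (2⁻¹ : ℂ) • (A - J' * A.transpose * J) + (2⁻¹ : ℂ) • (A + J' * A.transpose * J) := by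
    rw [← smul_add, sub_add_add_cancel, ← two_smul ℂ, smul_smul]
    simp
  have hJ't : J'.transpose = s • J' := by
    calc J'.transpose = (J' * J) * J'.transpose := by rw [h2, one_mul]
      _ = J' * ((s * s) • J * J'.transpose) := by rw [h4, one_smul, mul_assoc]
      _ = s • (J' * (J.transpose * J'.transpose)) := by rw [h3, mul_smul]; simp
      _ = _ := by rw [← Matrix.transpose_mul, h2, Matrix.transpose_one, mul_one]
  have hA2 : (2⁻¹ : ℂ) • (A - J' * A.transpose * J) ∈ S.g := by
    refine S.g.smul_mem _ ((h5 _).2 ?_)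
    simp only [Matrix.transpose_sub, Matrix.transpose_mul, Matrix.transpose_transpose, h3, hJ't]
    simp only [Matrix.smul_mul, Matrix.mul_smul, smul_smul, h4, one_smul, sub_mul, mul_sub]
    have e1 : J * (A * J') * J = J * A := by rw [mul_assoc, mul_assoc, h2, mul_one]
    have e2 : J * (J' * A.transpose * J) = A.transpose * J := by
      rw [← mul_assoc, ← mul_assoc, h1, one_mul]
    rw [e1, e2]
    abel
  have hA3 : ∀ U ∈ S.g, (U * ((2⁻¹ : ℂ) • (A + J' * A.transpose * J))).trace = 0 := by
    intro U hU
    have e1 : J * U * J' = -U.transpose := by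
      have := (h5 U).1 hU
      rw [eq_neg_iff_add_eq_zero, add_comm, ← eq_neg_iff_add_eq_zero] at this
      rw [this, neg_mul, mul_assoc, h1, mul_one]
    have e2 : (U * (J' * A.transpose * J)).trace = -(U * A).trace := by
      rw [← mul_assoc, Matrix.trace_mul_comm, ← mul_assoc, ← mul_assoc, e1, neg_mul,
        Matrix.trace_neg, ← Matrix.transpose_mul, Matrix.trace_transpose, Matrix.trace_mul_comm]
    rw [Matrix.mul_smul, Matrix.trace_smul, mul_add, Matrix.trace_add, e2, add_neg_cancel,
      smul_zero]
  conv_lhs => rw [hA1]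
  rw [Matrix.map_add _ (map_add _), map_add, ModelData.casimirMap_eq_zero hA3, add_zero,
    hS.casimirMap_zero_of_mem hA2]
  ext i j
  simp only [Matrix.map_apply, Matrix.smul_apply, Matrix.sub_apply, Matrix.mul_apply, smul_eq_mul,
    map_mul, map_sub, map_sum, Matrix.transpose_apply, LinearMap.coe_mk, AddHom.coe_mk, f]

omit [LocalPoissonAlgebra 𝒜] [DecidableEq κ] hS in
theorem transpose_toMatrix (J : Matrix ι ι ℂ)
    (h5 : ∀ X : Matrix ι ι ℂ, X ∈ S.g ↔ X.transpose * J = -(J * X)) (v : κ → R) :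
    (S.toMatrix 1 v).transpose * J.map (algebraMap ℂ R) =
      -(J.map (algebraMap ℂ R) * S.toMatrix 1 v) := by
  simp only [ModelData.toMatrix, Matrix.transpose_sum, Finset.sum_mul, Finset.mul_sum,
    ← Finset.sum_neg_distrib, Matrix.transpose_smul, Matrix.smul_mul, Matrix.mul_smul,
    Module.End.one_apply]
  refine Finset.sum_congr rfl fun a _ => ?_
  have := congrArg (fun M : Matrix ι ι ℂ => M.map (algebraMap ℂ R)) ((h5 _).1 (S.basis a).2)
  have h6 : ∀ A : Matrix ι ι ℂ, (-A).map (algebraMap ℂ R) = -A.map (algebraMap ℂ R) := fun A => by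
    ext
    simp
  simp only [Matrix.map_mul, h6] at this
  rw [← Matrix.transpose_map, this, smul_neg]

/-- Odd powers of an element of `g` are in `g`, in types B, C and D. -/
theorem casimirMap_zero_odd_pow (hA : S.type ≠ .A) (v : κ → R) {k : ℕ} (hk : Odd k) :
    S.casimirMap R 0 (S.toMatrix 1 v ^ k) = S.toMatrix 1 v ^ k := by
  obtain ⟨J, J', s, h1, h2, h3, h4, h5⟩ := hS.exists_form hA
  rw [hS.casimirMap_zero_of_form J J' s h1 h2 h3 h4 h5]
  have e1 := transpose_toMatrix J h5 v
  set X := S.toMatrix 1 v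
  have e2 : J'.map (algebraMap ℂ R) * J.map (algebraMap ℂ R) = 1 := by
    rw [← Matrix.map_mul, h2, Matrix.map_one _ (map_zero _) (map_one _)]
  -- Transposition turns `X` into `-X` up to conjugation by `J`; an odd power then keeps the sign
  -- and stays in the algebra.
  have e3 : ∀ j, X.transpose ^ j * J.map (algebraMap ℂ R) =
      J.map (algebraMap ℂ R) * (-X) ^ j := fun j => by
    induction j with
    | zero => simp
    | succ j ih =>
      rw [pow_succ, mul_assoc, e1, ← mul_neg, ← mul_assoc, ih, pow_succ, mul_assoc]
  rw [Matrix.transpose_pow, mul_assoc, e3, ← mul_assoc, e2, one_mul, hk.neg_pow, sub_neg_eq_add,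
    ← two_smul R, smul_smul]
  have : algebraMap ℂ R 2⁻¹ * 2 = 1 := by
    have h : (2 : R) = algebraMap ℂ R 2 := (map_ofNat (algebraMap ℂ R) 2).symm
    rw [h, ← map_mul]
    simp
  rw [this, one_smul]

theorem trace_toMatrix (hA : S.type = .A) (v : κ → R) : (S.toMatrix 1 v).trace = 0 := by
  rw [ModelData.toMatrix, Matrix.trace_sum]
  refine Finset.sum_eq_zero fun a _ => ?_
  have h : ((S.basis a : Matrix ι ι ℂ).map (algebraMap ℂ R)).trace = 0 := by
    have := (hS.mem_iff_trace hA _).1 (S.basis a).2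
    have h2 := congrArg (algebraMap ℂ R) this
    simpa [Matrix.trace] using h2
  rw [Matrix.trace_smul, Module.End.one_apply, h, smul_zero]

end IsRSSystem

/-- `σ` is the restriction of `twist b Q`. -/
def ModelData.IsTwist (S : ModelData 𝒜 ι κ) (b : Bool) (Q : GL ι ℂ) : Prop :=
  ∀ X : S.g, (S.σ X : Matrix ι ι ℂ) = twist ℂ b Q X

omit [LocalPoissonAlgebra 𝒜] [DecidableEq κ] in
theorem ModelData.IsTwist.sigmaEnd_pow {b : Bool} {Q : GL ι ℂ} (h : S.IsTwist b Q) (k : ℕ)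
    (X : S.g) : (((S.sigmaEnd ^ k) X : S.g) : Matrix ι ι ℂ) = (twist ℂ b Q ^ k) X := by
  induction k with
  | zero => simp
  | succ k ih =>
    rw [pow_succ', pow_succ', Module.End.mul_apply, Module.End.mul_apply, ← ih]
    exact h _

omit [LocalPoissonAlgebra 𝒜] [DecidableEq κ] in
theorem ModelData.IsTwist.casimirMap_eq {b : Bool} {Q : GL ι ℂ} (h : S.IsTwist b Q) (k : ℕ)
    (X : Matrix ι ι R) : S.casimirMap R k X = (twist R b Q ^ k) (S.casimirMap R 0 X) := by
  rw [ModelData.casimirMap_apply, ModelData.casimirMap_apply, map_sum]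
  refine Finset.sum_congr rfl fun a _ => ?_
  rw [map_smul, h.sigmaEnd_pow, pow_zero, Module.End.one_apply]
  congr 1
  exact twist_pow_map b Q k _ (Algebra.linearMap ℂ R)

omit [LocalPoissonAlgebra 𝒜] [DecidableEq κ] in
theorem ModelData.IsTwist.toMatrix_sigmaEnd {b : Bool} {Q : GL ι ℂ} (h : S.IsTwist b Q)
    (v : κ → R) : S.toMatrix S.sigmaEnd v = twist R b Q (S.toMatrix 1 v) := by
  rw [ModelData.toMatrix, ModelData.toMatrix, map_sum]
  refine Finset.sum_congr rfl fun a _ => ?_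
  rw [map_smul, Module.End.one_apply]
  congr 1
  have h1 : (S.sigmaEnd (S.basis a) : Matrix ι ι ℂ) = twist ℂ b Q (S.basis a : Matrix ι ι ℂ) := h _
  rw [h1]
  exact twist_map b Q _ (Algebra.linearMap ℂ R)

theorem twist_complex_true (Q : GL ι ℂ) (X : Matrix ι ι ℂ) :
    twist ℂ true Q X = (Q : Matrix ι ι ℂ) * X * ((Q⁻¹ : GL ι ℂ) : Matrix ι ι ℂ) := by
  simp [twist]

theorem twist_complex_false (Q : GL ι ℂ) (X : Matrix ι ι ℂ) :
    twist ℂ false Q X =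
      -((Q : Matrix ι ι ℂ) * X.transpose * ((Q⁻¹ : GL ι ℂ) : Matrix ι ι ℂ)) := by
  simp [twist]

theorem twist_true_pow (Q : GL ι ℂ) (k : ℕ) : twist ℂ true Q ^ k = twist ℂ true (Q ^ k) := by
  induction k with
  | zero =>
    ext1 X
    simp [twist_complex_true]
  | succ k ih =>
    refine LinearMap.ext fun X => ?_
    rw [pow_succ', Module.End.mul_apply, ih]
    simp only [twist_complex_true, pow_succ', mul_inv_rev, Units.val_mul, mul_assoc]

/-- Two transposes cancel, leaving conjugation by `Q` times its inverse transpose. -/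
theorem twist_false_sq (Q : GL ι ℂ) : ∃ P : GL ι ℂ, twist ℂ false Q ^ 2 = twist ℂ true P := by
  have h1 : (Q : Matrix ι ι ℂ) * ((Q⁻¹ : GL ι ℂ) : Matrix ι ι ℂ) = 1 := by
    rw [← Units.val_mul, mul_inv_cancel, Units.val_one]
  have h2 : ((Q⁻¹ : GL ι ℂ) : Matrix ι ι ℂ) * (Q : Matrix ι ι ℂ) = 1 := by
    rw [← Units.val_mul, inv_mul_cancel, Units.val_one]
  have h3 : (Q : Matrix ι ι ℂ).transpose * ((Q⁻¹ : GL ι ℂ) : Matrix ι ι ℂ).transpose = 1 := by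
    rw [← Matrix.transpose_mul, h2, Matrix.transpose_one]
  have h4 : ((Q⁻¹ : GL ι ℂ) : Matrix ι ι ℂ).transpose * (Q : Matrix ι ι ℂ).transpose = 1 := by
    rw [← Matrix.transpose_mul, h1, Matrix.transpose_one]
  refine ⟨⟨(Q : Matrix ι ι ℂ) * ((Q⁻¹ : GL ι ℂ) : Matrix ι ι ℂ).transpose,
    (Q : Matrix ι ι ℂ).transpose * ((Q⁻¹ : GL ι ℂ) : Matrix ι ι ℂ), ?_, ?_⟩,
    LinearMap.ext fun X => ?_⟩
  · rw [mul_assoc, ← mul_assoc (Matrix.transpose _), h4, one_mul, h1]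
  · rw [mul_assoc, ← mul_assoc _ (Q : Matrix ι ι ℂ), h2, one_mul, h3]
  · rw [pow_two, Module.End.mul_apply, twist_complex_false, twist_complex_false,
      twist_complex_true]
    simp only [Matrix.transpose_neg, Matrix.transpose_mul, Matrix.transpose_transpose, mul_neg,
      neg_mul, neg_neg, mul_assoc]
    rfl

/-- `σ` is a twist whose sign matches the exponent `κ`. -/
theorem IsRSSystem.exists_twist (hS : IsRSSystem S) : ∃ (b : Bool) (Q : GL ι ℂ),
    S.IsTwist b Q ∧ twistSign b * S.ω = S.ω ^ S.kappa := by
  by_cases hc : S.IsConj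
  · have hk : S.kappa = 1 := if_pos hc
    obtain ⟨Q, hQ⟩ := hc
    refine ⟨true, Q, fun X => by rw [hQ, twist_complex_true], ?_⟩
    simp [hk, twistSign]
  · have hk : S.kappa = 1 + S.T / 2 := if_neg hc
    obtain ⟨Q, hQ⟩ := hS.realised.resolve_left hc
    have htw : S.IsTwist false Q := fun X => by rw [hQ, twist_complex_false]
    refine ⟨false, Q, htw, ?_⟩
    -- If `T = 2t + 1`, then `σ = σ^{T+1} = (σ²)^{t+1}` would be a conjugation, because `σ²` is one.
    have hT : Even S.T := by
      by_contra hodd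
      obtain ⟨t, ht⟩ := Nat.not_even_iff_odd.1 hodd
      obtain ⟨P, hP⟩ := twist_false_sq Q
      refine hc ⟨P ^ (t + 1), fun X => ?_⟩
      have h1 : S.sigmaEnd ^ (2 * (t + 1)) = S.sigmaEnd := by
        have h2 : 2 * (t + 1) = S.T + 1 := by omega
        rw [h2, pow_succ, ← hS.order, pow_orderOf_eq_one, one_mul]
      have h2 := htw.sigmaEnd_pow (2 * (t + 1)) X
      rw [h1, pow_mul, hP, twist_true_pow, twist_complex_true] at h2
      exact h2
    obtain ⟨t, ht⟩ := hT
    have hTpos := hS.T_pos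
    have ht2 : S.T / 2 = t := by omega
    -- The half period gives `ω^{T/2} = -1`, which is the sign of the transpose twist; hence the
    -- summand `T/2` in `kappa`.
    have h1 : S.ω ^ t * S.ω ^ t = 1 := by rw [← pow_add, ← ht, hS.primitive.pow_eq_one]
    have h2 : S.ω ^ t ≠ 1 := hS.primitive.pow_ne_one_of_pos_of_lt (by omega) (by omega)
    have h3 : S.ω ^ t = -1 := (mul_self_eq_one_iff.1 h1).resolve_left h2
    rw [hk, ht2, pow_add, h3]
    simp [twistSign]

end Projection

/-! ### Derivations of power series -/

section SeriesDerivations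

variable {R R' : Type*} [CommRing R] [Algebra ℂ R] [CommRing R'] [Algebra ℂ R']

/-- A derivation applied to the coefficients of a power series. -/
def coeffDerivation (D : Derivation ℂ R R) : Derivation ℂ (PowerSeries R) (PowerSeries R) :=
  Derivation.mk'
    { toFun := fun f => PowerSeries.mk fun n => D (PowerSeries.coeff n f)
      map_add' := fun f g => by
        ext n
        simp
      map_smul' := fun a f => by
        ext n
        simp } fun f g => by
    ext n
    simp only [LinearMap.coe_mk, AddHom.coe_mk, PowerSeries.coeff_mk, PowerSeries.coeff_mul, map_sum,
      Derivation.leibniz, smul_eq_mul, map_add, Finset.sum_add_distrib]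
    congr 1
    rw [Finset.Nat.sum_antidiagonal_swap.symm]
    rfl

@[simp]
theorem coeff_coeffDerivation (D : Derivation ℂ R R) (f : PowerSeries R) (n : ℕ) :
    PowerSeries.coeff n (coeffDerivation D f) = D (PowerSeries.coeff n f) := by
  simp [coeffDerivation]

/-- The Euler derivation `X d/dX`. -/
def eulerDerivation (R : Type*) [CommRing R] [Algebra ℂ R] :
    Derivation ℂ (PowerSeries R) (PowerSeries R) :=
  Derivation.mk'
    { toFun := fun f => PowerSeries.mk fun n => (n : R) * PowerSeries.coeff n f
      map_add' := fun f g => by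
        ext n
        simp [mul_add]
      map_smul' := fun a f => by
        ext n
        simp } fun f g => by
    ext n
    simp only [LinearMap.coe_mk, AddHom.coe_mk, PowerSeries.coeff_mk, PowerSeries.coeff_mul,
      smul_eq_mul, map_add, Finset.mul_sum]
    rw [← Finset.Nat.sum_antidiagonal_swap (n := n) (f := fun p => PowerSeries.coeff p.1 g *
      ((p.2 : R) * PowerSeries.coeff p.2 f)), ← Finset.sum_add_distrib]
    refine Finset.sum_congr rfl fun p hp => ?_
    rw [← Finset.HasAntidiagonal.mem_antidiagonal.1 hp]
    push_cast
    simp only [Prod.fst_swap, Prod.snd_swap]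
    ring

@[simp]
theorem coeff_eulerDerivation (f : PowerSeries R) (n : ℕ) :
    PowerSeries.coeff n (eulerDerivation R f) = n * PowerSeries.coeff n f := by
  simp [eulerDerivation]

/-- The partial sums of the exponential series of `F`. -/
def expTrunc (F : PowerSeries R) (N : ℕ) : PowerSeries R :=
  ∑ j ∈ Finset.range N, (1 / (Nat.factorial j : ℂ)) • F ^ j

/-- The exponential of a power series without constant term. -/
def expSeries (F : PowerSeries R) : PowerSeries R :=
  PowerSeries.mk fun n => PowerSeries.coeff n (expTrunc F (n + 1))

omit [Algebra ℂ R] in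
theorem coeff_pow_eq_zero {F : PowerSeries R} (hF : PowerSeries.constantCoeff F = 0) {n j : ℕ}
    (h : n < j) : PowerSeries.coeff n (F ^ j) = 0 :=
  PowerSeries.X_pow_dvd_iff.1 (pow_dvd_pow_of_dvd (PowerSeries.X_dvd_iff.2 hF) j) n h

theorem coeff_expTrunc {F : PowerSeries R} (hF : PowerSeries.constantCoeff F = 0) {n N : ℕ}
    (h : n < N) : PowerSeries.coeff n (expTrunc F N) = PowerSeries.coeff n (expSeries F) := by
  rw [expSeries, PowerSeries.coeff_mk, expTrunc, expTrunc, map_sum, map_sum]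
  refine (Finset.sum_subset (s₁ := Finset.range (n + 1)) (s₂ := Finset.range N) ?_ ?_).symm
  · intro j hj
    have := Finset.mem_range.1 hj
    exact Finset.mem_range.2 (by omega)
  · intro j _ hj
    have : n < j := by
      by_contra h'
      exact hj (Finset.mem_range.2 (by omega))
    rw [PowerSeries.coeff_smul, coeff_pow_eq_zero hF this, smul_zero]

/-- Each term of the exponential series differentiates to the preceding term times `D F`, so one
order of truncation is lost. -/
theorem derivation_expTrunc (D : Derivation ℂ (PowerSeries R) (PowerSeries R))
    (F : PowerSeries R) (N : ℕ) : D (expTrunc F (N + 1)) = expTrunc F N * D F := by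
  rw [expTrunc, Finset.sum_range_succ', map_add, map_sum, expTrunc, Finset.sum_mul]
  simp only [Nat.factorial_zero, pow_zero, Derivation.map_smul, Derivation.map_one_eq_zero,
    smul_zero, add_zero]
  refine Finset.sum_congr rfl fun j _ => ?_
  rw [Derivation.leibniz_pow, Nat.add_sub_cancel, ← Nat.cast_smul_eq_nsmul ℂ, smul_smul,
    Nat.factorial_succ, smul_mul_assoc, smul_eq_mul]
  congr 1
  have h1 : ((j : ℂ) + 1) ≠ 0 := Nat.cast_add_one_ne_zero j
  have h2 : (j.factorial : ℂ) ≠ 0 := by exact_mod_cast j.factorial_ne_zero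
  push_cast
  field_simp

theorem derivation_expSeries (D : Derivation ℂ (PowerSeries R) (PowerSeries R))
    (hD : ∀ (n : ℕ) (f g : PowerSeries R), PowerSeries.coeff n f = PowerSeries.coeff n g →
      PowerSeries.coeff n (D f) = PowerSeries.coeff n (D g))
    {F : PowerSeries R} (hF : PowerSeries.constantCoeff F = 0) :
    D (expSeries F) = expSeries F * D F := by
  ext n
  -- By `hD` the coefficient of `Xⁿ` may be computed from a truncation. Cutting at `n + 2` leaves,
  -- after differentiation, a truncation still exact up to order `n`.
  rw [hD n _ (expTrunc F (n + 1 + 1)) (coeff_expTrunc hF (by omega)).symm, derivation_expTrunc,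
    PowerSeries.coeff_mul, PowerSeries.coeff_mul]
  refine Finset.sum_congr rfl fun p hp => ?_
  have := Finset.HasAntidiagonal.mem_antidiagonal.1 hp
  rw [coeff_expTrunc hF (by omega)]

theorem coeff_zero_expSeries (F : PowerSeries R) : PowerSeries.coeff 0 (expSeries F) = 1 := by
  simp [expSeries, expTrunc]

theorem map_coeff_expSeries (f : R →ₐ[ℂ] R') (F : PowerSeries R) (n : ℕ) :
    f (PowerSeries.coeff n (expSeries F)) =
      PowerSeries.coeff n (expSeries (PowerSeries.map (f : R →+* R') F)) := by
  simp only [expSeries, PowerSeries.coeff_mk, expTrunc, map_sum, PowerSeries.coeff_smul, map_smul,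
    ← map_pow, PowerSeries.coeff_map]
  rfl

/-- `-p ∑_{k ≥ 2} tₖ Xᵏ / k`. -/
def logSeries (p : ℂ) (t : ℕ → R) : PowerSeries R :=
  PowerSeries.mk fun k => if 2 ≤ k then (-p / (k : ℂ)) • t k else 0

theorem coeff_logSeries (p : ℂ) (t : ℕ → R) (k : ℕ) :
    PowerSeries.coeff k (logSeries p t) = if 2 ≤ k then (-p / (k : ℂ)) • t k else 0 :=
  PowerSeries.coeff_mk _ _

theorem constantCoeff_logSeries (p : ℂ) (t : ℕ → R) :
    PowerSeries.constantCoeff (logSeries p t) = 0 := by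
  rw [← PowerSeries.coeff_zero_eq_constantCoeff_apply, coeff_logSeries]
  simp

/-- `exp (-p ∑_{k ≥ 2} tₖ Xᵏ / k)`. -/
def genSeries (p : ℂ) (t : ℕ → R) : PowerSeries R := expSeries (logSeries p t)

theorem coeff_genSeries_derivation (D : Derivation ℂ R R) (p : ℂ) (t : ℕ → R) (n : ℕ) :
    D (PowerSeries.coeff n (genSeries p t)) = ∑ x ∈ Finset.HasAntidiagonal.antidiagonal n,
      PowerSeries.coeff x.1 (genSeries p t) *
        if 2 ≤ x.2 then (-p / (x.2 : ℂ)) • D (t x.2) else 0 := by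
  rw [← coeff_coeffDerivation, genSeries,
    derivation_expSeries _ (fun n f g h => by simp [h]) (constantCoeff_logSeries p t),
    PowerSeries.coeff_mul]
  refine Finset.sum_congr rfl fun x _ => ?_
  rw [coeff_coeffDerivation, coeff_logSeries]
  split_ifs <;> simp

/-- The Euler derivation removes the denominators `k` of the exponent. The result is a Newton-type
recursion that determines all coefficients from the `tₖ`. -/
theorem mul_coeff_genSeries (p : ℂ) (t : ℕ → R) (n : ℕ) :
    (n : R) * PowerSeries.coeff n (genSeries p t) = ∑ x ∈ Finset.HasAntidiagonal.antidiagonal n,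
      PowerSeries.coeff x.1 (genSeries p t) * if 2 ≤ x.2 then -p • t x.2 else 0 := by
  rw [← coeff_eulerDerivation, genSeries,
    derivation_expSeries _ (fun n f g h => by simp [h]) (constantCoeff_logSeries p t),
    PowerSeries.coeff_mul]
  refine Finset.sum_congr rfl fun x _ => ?_
  rw [coeff_eulerDerivation, coeff_logSeries]
  split_ifs with h
  · have hx : (x.2 : ℂ) ≠ 0 := by
      have : x.2 ≠ 0 := by omega
      exact_mod_cast this
    have : (x.2 : R) = algebraMap ℂ R x.2 := by simp
    rw [this, ← Algebra.smul_def, smul_smul, mul_div_cancel₀ _ hx]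
  · simp

theorem map_coeff_genSeries (f : R →ₐ[ℂ] R') (p : ℂ) (t : ℕ → R) (n : ℕ) :
    f (PowerSeries.coeff n (genSeries p t)) =
      PowerSeries.coeff n (genSeries p fun k => f (t k)) := by
  rw [genSeries, map_coeff_expSeries, genSeries]
  congr 2
  ext k
  rw [PowerSeries.coeff_map, coeff_logSeries, coeff_logSeries]
  split_ifs <;> simp

namespace ModelData

theorem genPoly_eq (d n : ℕ) :
    genPoly d n = PowerSeries.coeff n (genSeries (((n : ℂ) - 1) / d) MvPolynomial.X) := by
  have : (PowerSeries.mk fun k => if 2 ≤ k then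
      MvPolynomial.C (-((n : ℂ) - 1) / ((d : ℂ) * (k : ℂ))) * MvPolynomial.X k else 0) =
      logSeries (((n : ℂ) - 1) / d) (MvPolynomial.X (R := ℂ) (σ := ℕ)) := by
    ext1 k
    rw [coeff_logSeries, PowerSeries.coeff_mk]
    split_ifs
    · rw [MvPolynomial.C_mul', ← neg_div, div_div]
    · rfl
  rw [genPoly, genSeries, ← this, expSeries, PowerSeries.coeff_mk, expTrunc, map_sum]
  refine Finset.sum_congr rfl fun j _ => ?_
  rw [PowerSeries.coeff_smul, MvPolynomial.C_mul']

/-- Differentiating the exponential in `tₖ` multiplies it by a multiple of `Xᵏ`, so the partial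
derivatives are lower coefficients of the same series, with the same exponent. -/
theorem aeval_pderiv_genPoly (d n k : ℕ) (t : ℕ → R) :
    MvPolynomial.aeval t (MvPolynomial.pderiv k (genPoly d n)) = if 2 ≤ k ∧ k ≤ n then
      (-(((n : ℂ) - 1) / d) / (k : ℂ)) • PowerSeries.coeff (n - k)
        (genSeries (((n : ℂ) - 1) / d) t) else 0 := by
  have h := coeff_genSeries_derivation (MvPolynomial.pderiv k) (((n : ℂ) - 1) / d)
    (MvPolynomial.X (R := ℂ) (σ := ℕ)) n
  rw [genPoly_eq, h, map_sum]
  split_ifs with hk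
  · rw [Finset.sum_eq_single (n - k, k)]
    · simp [hk.1, map_coeff_genSeries]
    · rintro ⟨a, b⟩ hab hne
      have hb : k ≠ b := by
        rintro rfl
        have := Finset.HasAntidiagonal.mem_antidiagonal.1 hab
        simp only at this
        exact hne (by rw [Prod.mk.injEq]; omega)
      simp [MvPolynomial.pderiv_X_of_ne hb.symm]
    · intro hn
      exact absurd (Finset.HasAntidiagonal.mem_antidiagonal.2 (by simp; omega)) hn
  · refine Finset.sum_eq_zero ?_
    rintro ⟨a, b⟩ hab
    have := Finset.HasAntidiagonal.mem_antidiagonal.1 hab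
    simp only at this ⊢
    by_cases hb : k = b
    · subst hb
      rw [if_neg (by omega)]
      simp
    · simp [MvPolynomial.pderiv_X_of_ne (Ne.symm hb)]

theorem genPoly_mem_supported (d n : ℕ) :
    genPoly d n ∈ MvPolynomial.supported ℂ {k | k < n + 1} := by
  have h : ∀ j i, i < n + 1 → PowerSeries.coeff i
      (logSeries (((n : ℂ) - 1) / d) (MvPolynomial.X (R := ℂ) (σ := ℕ)) ^ j) ∈
      MvPolynomial.supported ℂ {k | k < n + 1} := by
    intro j
    induction j with
    | zero =>
      intro i _
      rw [pow_zero, PowerSeries.coeff_one]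
      split_ifs
      exacts [one_mem _, zero_mem _]
    | succ j ih =>
      intro i hi
      rw [pow_succ, PowerSeries.coeff_mul]
      refine sum_mem fun x hx => mul_mem (ih _ ?_) ?_
      · have := Finset.HasAntidiagonal.mem_antidiagonal.1 hx
        omega
      · have := Finset.HasAntidiagonal.mem_antidiagonal.1 hx
        rw [coeff_logSeries]
        split_ifs
        · have hx2 : (MvPolynomial.X x.2 : MvPolynomial ℕ ℂ) ∈
              MvPolynomial.supported ℂ {k | k < n + 1} :=
            Algebra.subset_adjoin ⟨x.2, show x.2 < n + 1 by omega, rfl⟩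
          exact Subalgebra.smul_mem _ hx2 _
        · exact zero_mem _
  rw [genPoly_eq, genSeries, expSeries, PowerSeries.coeff_mk, expTrunc, map_sum]
  refine sum_mem fun j _ => ?_
  rw [PowerSeries.coeff_smul]
  exact Subalgebra.smul_mem _ (h j n (by omega)) _

end ModelData

end SeriesDerivations

/-! ### The generating function of the currents in type A -/

section TwoVariables

variable {R : Type*} [CommRing R] [Algebra ℂ R]

/-- The double series `∑ fₖₗ xᵏ yˡ`. -/
def doubleSeries (f : ℕ → ℕ → R) : PowerSeries (PowerSeries R) :=
  PowerSeries.mk fun k => PowerSeries.mk fun l => f k l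

/-- The coefficient of `xᵏ yˡ`. -/
def coeff₂ (k l : ℕ) (F : PowerSeries (PowerSeries R)) : R :=
  PowerSeries.coeff l (PowerSeries.coeff k F)

omit [Algebra ℂ R] in
@[simp]
theorem coeff₂_doubleSeries (f : ℕ → ℕ → R) (k l : ℕ) : coeff₂ k l (doubleSeries f) = f k l := by
  simp [coeff₂, doubleSeries]

omit [Algebra ℂ R] in
theorem doubleSeries_ext {F G : PowerSeries (PowerSeries R)}
    (h : ∀ k l, coeff₂ k l F = coeff₂ k l G) : F = G := by
  ext k l
  exact h k l

omit [Algebra ℂ R] in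
theorem coeff₂_add (k l : ℕ) (F G : PowerSeries (PowerSeries R)) :
    coeff₂ k l (F + G) = coeff₂ k l F + coeff₂ k l G := by simp [coeff₂]

omit [Algebra ℂ R] in
theorem coeff₂_sub (k l : ℕ) (F G : PowerSeries (PowerSeries R)) :
    coeff₂ k l (F - G) = coeff₂ k l F - coeff₂ k l G := by simp [coeff₂]

theorem coeff₂_smul (k l : ℕ) (a : ℂ) (F : PowerSeries (PowerSeries R)) :
    coeff₂ k l (a • F) = a • coeff₂ k l F := by simp [coeff₂]

omit [Algebra ℂ R] in
theorem coeff₂_map_C_mul (k l : ℕ) (f : PowerSeries R) (F : PowerSeries (PowerSeries R)) :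
    coeff₂ k l (PowerSeries.map PowerSeries.C f * F) =
      ∑ x ∈ Finset.HasAntidiagonal.antidiagonal k, PowerSeries.coeff x.1 f * coeff₂ x.2 l F := by
  rw [coeff₂, PowerSeries.coeff_mul, map_sum]
  refine Finset.sum_congr rfl fun x _ => ?_
  rw [PowerSeries.coeff_map, PowerSeries.coeff_C_mul]
  rfl

omit [Algebra ℂ R] in
theorem coeff₂_C_mul (k l : ℕ) (f : PowerSeries R) (F : PowerSeries (PowerSeries R)) :
    coeff₂ k l (PowerSeries.C f * F) =
      ∑ x ∈ Finset.HasAntidiagonal.antidiagonal l, PowerSeries.coeff x.1 f * coeff₂ k x.2 F := by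
  rw [coeff₂, PowerSeries.coeff_C_mul, PowerSeries.coeff_mul]
  rfl

omit [Algebra ℂ R] in
theorem coeff₂_C_C_mul (k l : ℕ) (c : R) (F : PowerSeries (PowerSeries R)) :
    coeff₂ k l (PowerSeries.C (PowerSeries.C c) * F) = c * coeff₂ k l F := by
  rw [coeff₂, PowerSeries.coeff_C_mul, PowerSeries.coeff_C_mul]
  rfl

omit [Algebra ℂ R] in
theorem coeff₂_X_mul_succ (k l : ℕ) (F : PowerSeries (PowerSeries R)) :
    coeff₂ (k + 1) l (PowerSeries.X * F) = coeff₂ k l F := by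
  simp [coeff₂, PowerSeries.coeff_succ_X_mul]

omit [Algebra ℂ R] in
theorem coeff₂_X_mul_zero (l : ℕ) (F : PowerSeries (PowerSeries R)) :
    coeff₂ 0 l (PowerSeries.X * F) = 0 := by
  simp [coeff₂]

omit [Algebra ℂ R] in
theorem coeff₂_CX_mul_succ (k l : ℕ) (F : PowerSeries (PowerSeries R)) :
    coeff₂ k (l + 1) (PowerSeries.C PowerSeries.X * F) = coeff₂ k l F := by
  simp [coeff₂, PowerSeries.coeff_succ_X_mul]

omit [Algebra ℂ R] in
theorem coeff₂_CX_mul_zero (k : ℕ) (F : PowerSeries (PowerSeries R)) :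
    coeff₂ k 0 (PowerSeries.C PowerSeries.X * F) = 0 := by
  simp [coeff₂]

omit [Algebra ℂ R] in
/-- `x - y` is not a zero divisor. -/
theorem eq_zero_of_X_sub_CX_mul {F : PowerSeries (PowerSeries R)}
    (h : (PowerSeries.X - PowerSeries.C PowerSeries.X) * F = 0) : F = 0 := by
  have h' : PowerSeries.X * F = PowerSeries.C PowerSeries.X * F := by
    rw [← sub_eq_zero, ← sub_mul, h]
  have key : ∀ l k, coeff₂ k l F = 0 := by
    intro l
    induction l with
    | zero =>
      intro k
      rw [← coeff₂_X_mul_succ, h', coeff₂_CX_mul_zero]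
    | succ l ih =>
      intro k
      rw [← coeff₂_X_mul_succ, h', coeff₂_CX_mul_succ, ih]
  exact doubleSeries_ext fun k l => by
    rw [key]
    simp [coeff₂]

omit [Algebra ℂ R] in
-- The formula `∑ a_{k+l} xᵏ yˡ = (x a(x) - y a(y)) / (x - y)`, cleared of its denominator because
-- `x - y` is not invertible among power series.
theorem X_sub_CX_mul_doubleSeries (a : ℕ → R) :
    (PowerSeries.X - PowerSeries.C PowerSeries.X) * doubleSeries (fun k l => a (k + l)) =
      PowerSeries.X * PowerSeries.map PowerSeries.C (PowerSeries.mk a) -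
        PowerSeries.C PowerSeries.X * PowerSeries.C (PowerSeries.mk a) := by
  have h1 : ∀ k l, coeff₂ k l (PowerSeries.map PowerSeries.C (PowerSeries.mk a)) =
      if l = 0 then a k else 0 := fun k l => by
    simp [coeff₂, PowerSeries.coeff_C]
  have h2 : ∀ k l, coeff₂ k l (PowerSeries.C (PowerSeries.mk a)) =
      if k = 0 then a l else 0 := fun k l => by
    simp only [coeff₂, PowerSeries.coeff_C]
    split_ifs <;> simp
  refine doubleSeries_ext fun k l => ?_
  rw [sub_mul, coeff₂_sub, coeff₂_sub]
  rcases k with _ | k <;> rcases l with _ | l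
  · simp [coeff₂_X_mul_zero, coeff₂_CX_mul_zero]
  · simp [coeff₂_X_mul_zero, coeff₂_CX_mul_succ, h2]
  · simp [coeff₂_X_mul_succ, coeff₂_CX_mul_zero, h1]
  · simp only [coeff₂_X_mul_succ, coeff₂_CX_mul_succ, h1, h2, coeff₂_doubleSeries]
    simp [add_right_comm, add_assoc]

theorem coeff₂_euler_left (k l : ℕ) (F : PowerSeries (PowerSeries R)) :
    coeff₂ k l (eulerDerivation (PowerSeries R) F) = k * coeff₂ k l F := by
  rw [coeff₂, coeff_eulerDerivation, ← nsmul_eq_mul, map_nsmul, nsmul_eq_mul]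
  rfl

theorem coeff₂_euler_right (k l : ℕ) (F : PowerSeries (PowerSeries R)) :
    coeff₂ k l (coeffDerivation (eulerDerivation R) F) = l * coeff₂ k l F := by
  simp [coeff₂]

theorem eulerDerivation_map_C (f : PowerSeries R) :
    eulerDerivation (PowerSeries R) (PowerSeries.map PowerSeries.C f) =
      PowerSeries.map PowerSeries.C (eulerDerivation R f) := by
  ext1 n
  simp

theorem eulerDerivation_C (f : PowerSeries R) :
    eulerDerivation (PowerSeries R) (PowerSeries.C f) = 0 := by
  ext1 n
  rcases n with _ | n <;> simp [PowerSeries.coeff_C]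

theorem coeffDerivation_C (f : PowerSeries R) :
    coeffDerivation (eulerDerivation R) (PowerSeries.C f) =
      PowerSeries.C (eulerDerivation R f) := by
  ext1 n
  rw [coeff_coeffDerivation, PowerSeries.coeff_C, PowerSeries.coeff_C]
  split_ifs <;> simp

theorem coeffDerivation_map_C (f : PowerSeries R) :
    coeffDerivation (eulerDerivation R) (PowerSeries.map PowerSeries.C f) = 0 := by
  ext1 n
  ext1 m
  rcases m with _ | m <;> simp [PowerSeries.coeff_C]

/-- The interaction of two currents in type A, without its manifestly symmetric part. -/
def interaction (p q : ℂ) (t τ ρ : ℕ → R) (k l : ℕ) : R :=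
  ∑ x ∈ Finset.HasAntidiagonal.antidiagonal k, ∑ y ∈ Finset.HasAntidiagonal.antidiagonal l,
    ((p * q) • (τ y.1 * t (x.1 + y.2) * ρ x.2) - p • (τ (x.1 + y.1 + y.2) * ρ x.2) -
      q • (τ y.1 * ρ (x.1 + x.2 + y.2)))

/-- In the last two terms of `interaction` one of the inner sums has constant summands; the factors
`l + 1` and `k + 1` count its pairs. -/
theorem doubleSeries_interaction (p q : ℂ) (t τ ρ : ℕ → R) :
    doubleSeries (interaction p q t τ ρ) =
      (p * q) • (PowerSeries.C (PowerSeries.mk τ) * (PowerSeries.map PowerSeries.C (PowerSeries.mk ρ) *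
        doubleSeries fun k l => t (k + l))) -
      p • (PowerSeries.map PowerSeries.C (PowerSeries.mk ρ) *
        doubleSeries fun k l => ((l : R) + 1) * τ (k + l)) -
      q • (PowerSeries.C (PowerSeries.mk τ) * doubleSeries fun k l => ((k : R) + 1) * ρ (k + l)) := by
  refine doubleSeries_ext fun k l => ?_
  rw [coeff₂_sub, coeff₂_sub, coeff₂_smul, coeff₂_smul, coeff₂_smul, coeff₂_doubleSeries,
    coeff₂_C_mul, coeff₂_C_mul, coeff₂_map_C_mul]
  simp only [coeff₂_map_C_mul, coeff₂_doubleSeries, interaction, Finset.sum_sub_distrib,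
    PowerSeries.coeff_mk, ← Finset.smul_sum]
  congr 1
  · congr 1
    · rw [Finset.sum_comm]
      congr 1
      refine Finset.sum_congr rfl fun y _ => ?_
      rw [Finset.mul_sum, ← Finset.Nat.sum_antidiagonal_swap]
      refine Finset.sum_congr rfl fun x _ => ?_
      simp only [Prod.fst_swap, Prod.snd_swap]
      ring
    · congr 1
      rw [← Finset.Nat.sum_antidiagonal_swap]
      refine Finset.sum_congr rfl fun x _ => ?_
      rw [Finset.sum_congr rfl (g := fun _ => τ (x.2 + l) * ρ x.1)]
      · rw [Finset.sum_const, Finset.Nat.card_antidiagonal, nsmul_eq_mul]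
        push_cast
        ring
      · intro y hy
        rw [← Finset.HasAntidiagonal.mem_antidiagonal.1 hy, add_assoc]
        rfl
  · congr 1
    rw [Finset.sum_comm]
    refine Finset.sum_congr rfl fun y _ => ?_
    rw [Finset.sum_congr rfl (g := fun _ => τ y.1 * ρ (k + y.2))]
    · rw [Finset.sum_const, Finset.Nat.card_antidiagonal, nsmul_eq_mul]
      push_cast
      ring
    · intro x hx
      rw [← Finset.HasAntidiagonal.mem_antidiagonal.1 hx]

/-- Integration by parts: `y ∂_y` is applied to `f(x) B(y) · y · ∑ τ_{k+l} xᵏ yˡ` and the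
coefficient of `y^{n+1}` is read off. It is `n + 1` times the undifferentiated coefficient, which
cancels the contribution of `q t₀` from `B`. This cancellation is what singles out the exponent of
the generating function. -/
theorem coeff₂_parts_right (q : ℂ) (t τ : ℕ → R) (B : PowerSeries R) (m n : ℕ)
    (hB : eulerDerivation R B = (-q) • (B * (PowerSeries.mk t - PowerSeries.C (t 0))))
    (hn : q • t 0 = (n : R) + 1) (f : PowerSeries R) :
    coeff₂ m n (PowerSeries.map PowerSeries.C f * PowerSeries.C B *
      doubleSeries fun k l => ((l : R) + 1) * τ (k + l)) =
    q • coeff₂ m n (PowerSeries.map PowerSeries.C f * PowerSeries.C B *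
      (PowerSeries.C (PowerSeries.mk t) * doubleSeries fun k l => τ (k + l))) := by
  have h1 : coeffDerivation (eulerDerivation R)
      (PowerSeries.C PowerSeries.X * doubleSeries fun k l => τ (k + l)) =
      PowerSeries.C PowerSeries.X * doubleSeries fun k l => ((l : R) + 1) * τ (k + l) := by
    refine doubleSeries_ext fun k l => ?_
    rw [coeff₂_euler_right]
    rcases l with _ | l
    · simp [coeff₂_CX_mul_zero]
    · simp [coeff₂_CX_mul_succ]
  have h2 : coeffDerivation (eulerDerivation R) (PowerSeries.map PowerSeries.C f * PowerSeries.C B *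
      (PowerSeries.C PowerSeries.X * doubleSeries fun k l => τ (k + l))) =
      PowerSeries.C PowerSeries.X * (PowerSeries.map PowerSeries.C f * PowerSeries.C B *
        doubleSeries fun k l => ((l : R) + 1) * τ (k + l)) -
      q • (PowerSeries.C PowerSeries.X * (PowerSeries.map PowerSeries.C f * PowerSeries.C B *
        (PowerSeries.C (PowerSeries.mk t) * doubleSeries fun k l => τ (k + l)))) +
      q • (PowerSeries.C (PowerSeries.C (t 0)) * (PowerSeries.C PowerSeries.X *
        (PowerSeries.map PowerSeries.C f * PowerSeries.C B *
          doubleSeries fun k l => τ (k + l)))) := by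
    have hCB : PowerSeries.C ((-q) • (B * (PowerSeries.mk t - PowerSeries.C (t 0)))) =
        (-q) • (PowerSeries.C B * (PowerSeries.C (PowerSeries.mk t) -
          PowerSeries.C (PowerSeries.C (t 0)))) := by
      rw [← map_sub, ← map_mul]
      ext1 j
      simp only [PowerSeries.coeff_C, PowerSeries.coeff_smul]
      split_ifs <;> simp
    rw [Derivation.leibniz, h1, Derivation.leibniz, coeffDerivation_map_C, coeffDerivation_C, hB, hCB]
    simp only [smul_eq_mul, Algebra.smul_def, map_neg]
    ring
  have h3 := congrArg (coeff₂ m (n + 1)) h2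
  rw [coeff₂_euler_right, coeff₂_add, coeff₂_sub, coeff₂_smul, coeff₂_smul, coeff₂_C_C_mul,
    coeff₂_CX_mul_succ, coeff₂_CX_mul_succ, coeff₂_CX_mul_succ, ← smul_mul_assoc, hn,
    mul_left_comm, coeff₂_CX_mul_succ] at h3
  push_cast at h3
  linear_combination -h3

theorem coeff₂_parts_left (p : ℂ) (t ρ : ℕ → R) (A : PowerSeries R) (m n : ℕ)
    (hA : eulerDerivation R A = (-p) • (A * (PowerSeries.mk t - PowerSeries.C (t 0))))
    (hm : p • t 0 = (m : R) + 1) (f : PowerSeries R) :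
    coeff₂ m n (PowerSeries.map PowerSeries.C A * PowerSeries.C f *
      doubleSeries fun k l => ((k : R) + 1) * ρ (k + l)) =
    p • coeff₂ m n (PowerSeries.map PowerSeries.C A * PowerSeries.C f *
      (PowerSeries.map PowerSeries.C (PowerSeries.mk t) * doubleSeries fun k l => ρ (k + l))) := by
  have h1 : eulerDerivation (PowerSeries R)
      (PowerSeries.X * doubleSeries fun k l => ρ (k + l)) =
      PowerSeries.X * doubleSeries fun k l => ((k : R) + 1) * ρ (k + l) := by
    refine doubleSeries_ext fun k l => ?_
    rw [coeff₂_euler_left]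
    rcases k with _ | k
    · simp [coeff₂_X_mul_zero]
    · simp [coeff₂_X_mul_succ]
  have h2 : eulerDerivation (PowerSeries R) (PowerSeries.map PowerSeries.C A * PowerSeries.C f *
      (PowerSeries.X * doubleSeries fun k l => ρ (k + l))) =
      PowerSeries.X * (PowerSeries.map PowerSeries.C A * PowerSeries.C f *
        doubleSeries fun k l => ((k : R) + 1) * ρ (k + l)) -
      p • (PowerSeries.X * (PowerSeries.map PowerSeries.C A * PowerSeries.C f *
        (PowerSeries.map PowerSeries.C (PowerSeries.mk t) * doubleSeries fun k l => ρ (k + l)))) +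
      p • (PowerSeries.C (PowerSeries.C (t 0)) * (PowerSeries.X *
        (PowerSeries.map PowerSeries.C A * PowerSeries.C f *
          doubleSeries fun k l => ρ (k + l)))) := by
    have hCA : PowerSeries.map PowerSeries.C
        ((-p) • (A * (PowerSeries.mk t - PowerSeries.C (t 0)))) =
        (-p) • (PowerSeries.map PowerSeries.C A *
          (PowerSeries.map PowerSeries.C (PowerSeries.mk t) -
          PowerSeries.C (PowerSeries.C (t 0)))) := by
      rw [← PowerSeries.map_C, ← map_sub, ← map_mul]
      ext1 j
      ext1 i
      simp only [PowerSeries.coeff_map, PowerSeries.coeff_C, PowerSeries.coeff_smul]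
      split_ifs <;> simp
    rw [Derivation.leibniz, h1, Derivation.leibniz, eulerDerivation_map_C, eulerDerivation_C, hA, hCA]
    simp only [smul_eq_mul, Algebra.smul_def, map_neg]
    ring
  have h3 := congrArg (coeff₂ (m + 1) n) h2
  rw [coeff₂_euler_left, coeff₂_add, coeff₂_sub, coeff₂_smul, coeff₂_smul, coeff₂_C_C_mul,
    coeff₂_X_mul_succ, coeff₂_X_mul_succ, coeff₂_X_mul_succ, ← smul_mul_assoc, hm,
    mul_left_comm, coeff₂_X_mul_succ] at h3
  push_cast at h3
  linear_combination -h3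

/-- Integration by parts. -/
theorem coeff₂_interaction (p q : ℂ) (t τ ρ : ℕ → R) (A B : PowerSeries R) (m n : ℕ)
    (hA : eulerDerivation R A = (-p) • (A * (PowerSeries.mk t - PowerSeries.C (t 0))))
    (hB : eulerDerivation R B = (-q) • (B * (PowerSeries.mk t - PowerSeries.C (t 0))))
    (hm : p • t 0 = (m : R) + 1) (hn : q • t 0 = (n : R) + 1) :
    coeff₂ m n (PowerSeries.map PowerSeries.C A * PowerSeries.C B *
      doubleSeries (interaction p q t τ ρ)) =
    (p * q) • coeff₂ m n (PowerSeries.map PowerSeries.C A * PowerSeries.C B *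
      (PowerSeries.C (PowerSeries.mk τ) * PowerSeries.map PowerSeries.C (PowerSeries.mk ρ) *
          (doubleSeries fun k l => t (k + l)) -
        PowerSeries.C (PowerSeries.mk t) * PowerSeries.map PowerSeries.C (PowerSeries.mk ρ) *
          (doubleSeries fun k l => τ (k + l)) -
        PowerSeries.C (PowerSeries.mk τ) * PowerSeries.map PowerSeries.C (PowerSeries.mk t) *
          (doubleSeries fun k l => ρ (k + l)))) := by
  have hr := coeff₂_parts_right q t τ B m n hB hn (A * PowerSeries.mk ρ)
  have hl := coeff₂_parts_left p t ρ A m n hA hm (B * PowerSeries.mk τ)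
  have e1 : ∀ F : PowerSeries (PowerSeries R), PowerSeries.map PowerSeries.C A * PowerSeries.C B *
      (PowerSeries.map PowerSeries.C (PowerSeries.mk ρ) * F) =
      PowerSeries.map PowerSeries.C (A * PowerSeries.mk ρ) * PowerSeries.C B * F := fun F => by
    rw [map_mul]
    ring
  have e2 : ∀ F : PowerSeries (PowerSeries R), PowerSeries.map PowerSeries.C A * PowerSeries.C B *
      (PowerSeries.C (PowerSeries.mk τ) * F) =
      PowerSeries.map PowerSeries.C A * PowerSeries.C (B * PowerSeries.mk τ) * F := fun F => by
    rw [map_mul]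
    ring
  rw [doubleSeries_interaction, mul_sub, mul_sub, coeff₂_sub, coeff₂_sub, mul_smul_comm,
    mul_smul_comm, mul_smul_comm, coeff₂_smul, coeff₂_smul, coeff₂_smul,
    e1 (doubleSeries fun k l => ((l : R) + 1) * τ (k + l)), hr,
    e2 (doubleSeries fun k l => ((k : R) + 1) * ρ (k + l)), hl, ← e1, ← e2, mul_sub, mul_sub,
    coeff₂_sub, coeff₂_sub, smul_sub, smul_sub, smul_smul, smul_smul, mul_comm q p]
  simp only [mul_assoc, mul_left_comm (PowerSeries.map PowerSeries.C (PowerSeries.mk ρ))]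

/-- The exchange of the two variables. -/
def transposeSeries (F : PowerSeries (PowerSeries R)) : PowerSeries (PowerSeries R) :=
  doubleSeries fun k l => coeff₂ l k F

omit [Algebra ℂ R] in
theorem coeff₂_transposeSeries (k l : ℕ) (F : PowerSeries (PowerSeries R)) :
    coeff₂ k l (transposeSeries F) = coeff₂ l k F := coeff₂_doubleSeries _ _ _

omit [Algebra ℂ R] in
theorem coeff₂_mul (k l : ℕ) (F G : PowerSeries (PowerSeries R)) :
    coeff₂ k l (F * G) = ∑ x ∈ Finset.HasAntidiagonal.antidiagonal k,
      ∑ y ∈ Finset.HasAntidiagonal.antidiagonal l, coeff₂ x.1 y.1 F * coeff₂ x.2 y.2 G := by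
  simp only [coeff₂, PowerSeries.coeff_mul, map_sum]

omit [Algebra ℂ R] in
theorem transposeSeries_mul (F G : PowerSeries (PowerSeries R)) :
    transposeSeries (F * G) = transposeSeries F * transposeSeries G := by
  refine doubleSeries_ext fun k l => ?_
  rw [coeff₂_transposeSeries, coeff₂_mul, coeff₂_mul, Finset.sum_comm]
  simp only [coeff₂_transposeSeries]

omit [Algebra ℂ R] in
theorem transposeSeries_sub (F G : PowerSeries (PowerSeries R)) :
    transposeSeries (F - G) = transposeSeries F - transposeSeries G :=
  doubleSeries_ext fun k l => by
    rw [coeff₂_transposeSeries, coeff₂_sub, coeff₂_sub, coeff₂_transposeSeries,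
      coeff₂_transposeSeries]

omit [Algebra ℂ R] in
theorem transposeSeries_map_C (f : PowerSeries R) :
    transposeSeries (PowerSeries.map PowerSeries.C f) = PowerSeries.C f :=
  doubleSeries_ext fun k l => by
    rw [coeff₂_transposeSeries]
    simp only [coeff₂, PowerSeries.coeff_map, PowerSeries.coeff_C]
    split_ifs <;> simp

omit [Algebra ℂ R] in
theorem transposeSeries_C (f : PowerSeries R) :
    transposeSeries (PowerSeries.C f) = PowerSeries.map PowerSeries.C f :=
  doubleSeries_ext fun k l => by
    rw [coeff₂_transposeSeries]
    simp only [coeff₂, PowerSeries.coeff_map, PowerSeries.coeff_C]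
    split_ifs <;> simp

omit [Algebra ℂ R] in
theorem transposeSeries_doubleSeries_add (a : ℕ → R) :
    transposeSeries (doubleSeries fun k l => a (k + l)) = doubleSeries fun k l => a (k + l) :=
  doubleSeries_ext fun k l => by
    rw [coeff₂_transposeSeries, coeff₂_doubleSeries, coeff₂_doubleSeries, add_comm]

/-- After multiplication by `x - y`, either of the two expressions becomes `y τ(y) t(x) ρ(y) - x
τ(x) t(y) ρ(x)`: all other terms cancel in pairs. -/
theorem partial_fractions_symm {K : Type*} [CommRing K] {x y tx ty τx τy ρx ρy Dt Dτ Dρ : K}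
    (ht : (x - y) * Dt = x * tx - y * ty) (hτ : (x - y) * Dτ = x * τx - y * τy)
    (hρ : (x - y) * Dρ = x * ρx - y * ρy) :
    (x - y) * ((τy * ρx * Dt - ty * ρx * Dτ - τy * tx * Dρ) -
      (τx * ρy * Dt - tx * ρy * Dτ - τx * ty * Dρ)) = 0 := by
  linear_combination (τy * ρx - τx * ρy) * ht - (ty * ρx - tx * ρy) * hτ -
    (τy * tx - τx * ty) * hρ

/-- The commutativity of the Hessians of the currents in type A. -/
theorem coeff₂_interaction_symm (p q : ℂ) (t τ ρ : ℕ → R) (A B : PowerSeries R) (m n : ℕ)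
    (hA : eulerDerivation R A = (-p) • (A * (PowerSeries.mk t - PowerSeries.C (t 0))))
    (hB : eulerDerivation R B = (-q) • (B * (PowerSeries.mk t - PowerSeries.C (t 0))))
    (hm : p • t 0 = (m : R) + 1) (hn : q • t 0 = (n : R) + 1) :
    coeff₂ m n (PowerSeries.map PowerSeries.C A * PowerSeries.C B *
      doubleSeries (interaction p q t τ ρ)) =
    coeff₂ n m (PowerSeries.map PowerSeries.C B * PowerSeries.C A *
      doubleSeries (interaction q p t τ ρ)) := by
  rw [coeff₂_interaction p q t τ ρ A B m n hA hB hm hn,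
    coeff₂_interaction q p t τ ρ B A n m hB hA hn hm, ← coeff₂_transposeSeries m n, mul_comm q p,
    mul_comm (PowerSeries.map PowerSeries.C B)]
  simp only [transposeSeries_mul, transposeSeries_sub, transposeSeries_map_C, transposeSeries_C,
    transposeSeries_doubleSeries_add]
  -- After integration by parts the two kernels are exchanged by `x ↔ y`. They agree because `x - y`
  -- annihilates their difference.
  refine congrArg (fun F => (p * q) • coeff₂ m n (PowerSeries.map PowerSeries.C A *
    PowerSeries.C B * F)) (sub_eq_zero.1 (eq_zero_of_X_sub_CX_mul ?_))
  exact partial_fractions_symm (X_sub_CX_mul_doubleSeries t) (X_sub_CX_mul_doubleSeries τ)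
    (X_sub_CX_mul_doubleSeries ρ)

end TwoVariables

/-! ### The currents in type A -/

section TypeA

variable {R ι : Type*} [CommRing R] [Algebra ℂ R] [Fintype ι] [DecidableEq ι]

/-- The coefficients of `exp (-p ∑_{k ≥ 2} Tr (Sᵏ) Xᵏ / k)`. -/
def genCoeff (p : ℂ) (S : Matrix ι ι R) (j : ℕ) : R :=
  PowerSeries.coeff j (genSeries p fun k => (S ^ k).trace)

/-- The traceless part of the gradient of the coefficient of `Xⁿ` in
`exp (-p ∑_{k ≥ 2} Tr (Sᵏ) Xᵏ / k)`. -/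
def genGradient (p : ℂ) (n : ℕ) (S : Matrix ι ι R) : Matrix ι ι R :=
  (-p) • ∑ x ∈ Finset.HasAntidiagonal.antidiagonal (n - 1), genCoeff p S x.1 • S ^ x.2

/-- The derivative of `genCoeff`. -/
def dGenCoeff (p : ℂ) (S Z : Matrix ι ι R) (j : ℕ) : R :=
  (-p) • ∑ x ∈ Finset.HasAntidiagonal.antidiagonal j,
    genCoeff p S x.1 * if x.2 = 0 then 0 else (S ^ (x.2 - 1) * Z).trace

/-- The derivative of `genGradient`. -/
def dGenGradient (p : ℂ) (n : ℕ) (S Z : Matrix ι ι R) : Matrix ι ι R :=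
  (-p) • ∑ x ∈ Finset.HasAntidiagonal.antidiagonal (n - 1),
    (dGenCoeff p S Z x.1 • S ^ x.2 + genCoeff p S x.1 • dPow x.2 S Z)

theorem derivation_genCoeff (D : Derivation ℂ R R) (p : ℂ) {S : Matrix ι ι R} (hS : S.trace = 0)
    (j : ℕ) : D (genCoeff p S j) = dGenCoeff p S (S.map D) j := by
  rw [genCoeff, coeff_genSeries_derivation, dGenCoeff, Finset.smul_sum]
  refine Finset.sum_congr rfl fun x _ => ?_
  rw [← mul_smul_comm, genCoeff]
  congr 1
  by_cases h0 : x.2 = 0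
  · simp [h0]
  -- The generating function starts at `k = 2`, whereas `dGenCoeff` has a term with `k = 1`; that
  -- term is `D (Tr S) = 0`.
  by_cases h1 : x.2 = 1
  · rw [h1]
    have := derivation_trace D S
    rw [hS, map_zero] at this
    simp [← this]
  · rw [if_pos (by omega), if_neg h0, derivation_trace_pow]
    have hx : (x.2 : ℂ) ≠ 0 := by exact_mod_cast h0
    have h2 : (x.2 : R) = algebraMap ℂ R x.2 := by simp
    rw [h2, ← Algebra.smul_def, smul_smul, div_mul_cancel₀ _ hx]

theorem map_derivation_genGradient (D : Derivation ℂ R R) (p : ℂ) (n : ℕ) {S : Matrix ι ι R}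
    (hS : S.trace = 0) :
    (genGradient p n S).map D = dGenGradient p n S (S.map D) := by
  have h1 : ∀ (a : ℂ) (X : Matrix ι ι R), (a • X).map D = a • X.map D := fun a X => by
    ext
    simp
  have h2 : ∀ (u : Finset (ℕ × ℕ)) (F : ℕ × ℕ → Matrix ι ι R),
      (∑ x ∈ u, F x).map D = ∑ x ∈ u, (F x).map D := fun u F => by
    ext
    simp [Matrix.sum_apply]
  rw [genGradient, h1, h2, dGenGradient]
  simp only [map_derivation_smul, derivation_genCoeff D p hS, map_derivation_pow]

theorem mul_genCoeff (p : ℂ) {S : Matrix ι ι R} (hS : S.trace = 0) (j : ℕ) :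
    (j : R) * genCoeff p S j = (-p) • ∑ x ∈ Finset.HasAntidiagonal.antidiagonal j,
      genCoeff p S x.1 * if x.2 = 0 then 0 else (S ^ x.2).trace := by
  rw [genCoeff, mul_coeff_genSeries, Finset.smul_sum]
  refine Finset.sum_congr rfl fun x _ => ?_
  rw [← mul_smul_comm, genCoeff]
  congr 1
  by_cases h0 : x.2 = 0
  · simp [h0]
  by_cases h1 : x.2 = 1
  · rw [h1]
    simp [hS]
  · rw [if_pos (by omega), if_neg h0]

/-- By the recursion for the coefficients, the terms with `Tr Sᵏ`, `k ≥ 1`, add up to `(n - 1)`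
times the coefficient of order `n - 1`. The term with `Tr 1 = d` contributes `-p d` times the same
coefficient, and `p d = n - 1`. -/
theorem trace_genGradient {p : ℂ} {n : ℕ} {S : Matrix ι ι R} (hS : S.trace = 0) (hn : 1 ≤ n)
    (hp : p * Fintype.card ι = (n : ℂ) - 1) : (genGradient p n S).trace = 0 := by
  have h1 := mul_genCoeff p hS (n - 1)
  have h2 : ∀ x : ℕ × ℕ, (S ^ x.2).trace = (if x.2 = 0 then 0 else (S ^ x.2).trace) +
      if x.2 = 0 then (Fintype.card ι : R) else 0 := fun x => by
    split_ifs with h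
    · rw [h]
      simp
    · simp
  have h3 : ∑ x ∈ Finset.HasAntidiagonal.antidiagonal (n - 1),
      genCoeff p S x.1 * (if x.2 = 0 then (Fintype.card ι : R) else 0) =
      genCoeff p S (n - 1) * Fintype.card ι := by
    rw [Finset.sum_eq_single (n - 1, 0)]
    · simp
    · rintro ⟨a, b⟩ hab hne
      have hb : b ≠ 0 := by
        rintro rfl
        have := Finset.HasAntidiagonal.mem_antidiagonal.1 hab
        simp only [add_zero] at this
        exact hne (by rw [this])
      simp [hb]
    · intro h
      exact absurd (Finset.HasAntidiagonal.mem_antidiagonal.2 (by simp)) h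
  have h4 : p • (Fintype.card ι : R) = ((n - 1 : ℕ) : R) := by
    have e1 : (Fintype.card ι : R) = algebraMap ℂ R (Fintype.card ι : ℂ) := by simp
    have e2 : ((n - 1 : ℕ) : R) = algebraMap ℂ R ((n : ℂ) - 1) := by
      rw [Nat.cast_sub hn]
      simp
    rw [e1, e2, Algebra.smul_def, ← map_mul, hp]
  rw [genGradient, Matrix.trace_smul, Matrix.trace_sum]
  simp only [Matrix.trace_smul, smul_eq_mul]
  rw [Finset.sum_congr rfl fun x _ => by rw [h2 x, mul_add], Finset.sum_add_distrib, smul_add, ← h1,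
    h3, ← mul_smul_comm, neg_smul, h4]
  ring

/-- The gradient lacks the term proportional to the identity. Supplying it gives `genGradient`,
which is already traceless, so the traceless part needs no further correction. -/
theorem traceless_gradient_genPoly {n : ℕ} {S : Matrix ι ι R} (hS : S.trace = 0)
    (hn : 1 ≤ n) (hd : (Fintype.card ι : ℂ) ≠ 0) :
    traceless R ι (gradient (n + 1) (ModelData.genPoly (Fintype.card ι) n) S) =
      genGradient (((n : ℂ) - 1) / Fintype.card ι) n S := by
  set p := ((n : ℂ) - 1) / Fintype.card ι with hp
  have h1 : gradient (n + 1) (ModelData.genPoly (Fintype.card ι) n) S =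
      genGradient p n S + (p • genCoeff p S (n - 1)) • 1 := by
    have e1 : ∀ k ∈ Finset.range (n + 1), MvPolynomial.aeval (fun j => (S ^ j).trace)
        (MvPolynomial.pderiv k (ModelData.genPoly (Fintype.card ι) n)) • (k : R) • S ^ (k - 1) =
        if 2 ≤ k then (-p) • genCoeff p S (n - k) • S ^ (k - 1) else 0 := fun k hk => by
      have hk' := Finset.mem_range.1 hk
      rw [ModelData.aeval_pderiv_genPoly]
      by_cases h2 : 2 ≤ k
      · rw [if_pos ⟨h2, by omega⟩, if_pos h2]
        have hx : (k : ℂ) ≠ 0 := by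
          have : k ≠ 0 := by omega
          exact_mod_cast this
        have h2 : (k : R) = algebraMap ℂ R k := by simp
        rw [h2, algebraMap_smul, smul_comm, smul_assoc, smul_smul, mul_div_cancel₀ _ hx]
        rfl
      · rw [if_neg (fun h => h2 h.1), if_neg h2, zero_smul]
    obtain ⟨n, rfl⟩ := Nat.exists_eq_add_of_le' hn
    rw [gradient, Finset.sum_congr rfl e1, Finset.sum_range_succ', Finset.sum_range_succ',
      genGradient, Nat.add_sub_cancel, ← Finset.Nat.sum_antidiagonal_swap,
      Finset.Nat.sum_antidiagonal_eq_sum_range_succ_mk, Finset.sum_range_succ', smul_add,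
      Finset.smul_sum, add_assoc, add_assoc]
    congr 1
    · refine Finset.sum_congr rfl fun i hi => ?_
      rw [if_pos (by omega)]
      simp only [Prod.fst_swap, Prod.snd_swap]
      congr 3
      omega
    · simp
  have h2 : (genGradient p n S).trace = 0 :=
    trace_genGradient hS hn (by rw [hp, div_mul_cancel₀ _ hd])
  rw [h1, map_add, traceless_of_trace_eq_zero h2, map_smul, traceless_one hd, smul_zero, add_zero]

theorem genGradient_commute (p : ℂ) (n : ℕ) {S Y : Matrix ι ι R} (h : Commute S Y) :
    Commute (genGradient p n S) Y := by
  refine Commute.smul_left (Commute.sum_left _ _ _ fun x _ => ?_) _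
  exact (h.pow_left _).smul_left _

/-- Equivariance under infinitesimal conjugation: the coefficients are functions of traces and do
not vary, and the powers vary by a commutator. -/
theorem dGenGradient_lie (p : ℂ) (n : ℕ) (S B : Matrix ι ι R) :
    dGenGradient p n S ⁅B, S⁆ = ⁅B, genGradient p n S⁆ := by
  have h1 : ∀ j, dGenCoeff p S ⁅B, S⁆ j = 0 := fun j => by
    rw [dGenCoeff, Finset.sum_eq_zero, smul_zero]
    intro x _
    split_ifs
    · rw [mul_zero]
    · rw [Ring.lie_def, mul_sub, Matrix.trace_sub, ← mul_assoc, ← mul_assoc, ← pow_succ,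
        Matrix.trace_mul_comm (_ * B) S, ← mul_assoc, ← pow_succ', sub_self, mul_zero]
  rw [dGenGradient, genGradient]
  simp only [h1, zero_smul, zero_add, dPow_lie]
  simp only [Ring.lie_def, Finset.mul_sum, Finset.sum_mul,
    Matrix.mul_smul, Matrix.smul_mul, smul_sub, Finset.sum_sub_distrib]

theorem dGenCoeff_add (p : ℂ) (S Z Z' : Matrix ι ι R) (j : ℕ) :
    dGenCoeff p S (Z + Z') j = dGenCoeff p S Z j + dGenCoeff p S Z' j := by
  rw [dGenCoeff, dGenCoeff, dGenCoeff, ← smul_add, ← Finset.sum_add_distrib]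
  congr 1
  refine Finset.sum_congr rfl fun x _ => ?_
  split_ifs
  · simp
  · rw [mul_add, Matrix.trace_add, mul_add]

theorem dGenCoeff_smul (p a : ℂ) (S Z : Matrix ι ι R) (j : ℕ) :
    dGenCoeff p S (a • Z) j = a • dGenCoeff p S Z j := by
  rw [dGenCoeff, dGenCoeff, smul_comm a]
  congr 1
  rw [Finset.smul_sum]
  refine Finset.sum_congr rfl fun x _ => ?_
  split_ifs
  · simp
  · rw [Matrix.mul_smul, Matrix.trace_smul, mul_smul_comm]

theorem dGenGradient_add (p : ℂ) (n : ℕ) (S Z Z' : Matrix ι ι R) :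
    dGenGradient p n S (Z + Z') = dGenGradient p n S Z + dGenGradient p n S Z' := by
  rw [dGenGradient, dGenGradient, dGenGradient, ← smul_add, ← Finset.sum_add_distrib]
  congr 1
  refine Finset.sum_congr rfl fun x _ => ?_
  rw [dGenCoeff_add, dPow_add, add_smul, smul_add]
  abel

theorem dGenGradient_smul (p : ℂ) (n : ℕ) (a : ℂ) (S Z : Matrix ι ι R) :
    dGenGradient p n S (a • Z) = a • dGenGradient p n S Z := by
  rw [dGenGradient, dGenGradient, smul_comm a]
  congr 1
  rw [Finset.smul_sum]
  refine Finset.sum_congr rfl fun x _ => ?_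
  rw [dGenCoeff_smul, dPow_smul, smul_assoc, smul_add, smul_comm a, smul_comm a (genCoeff p S x.1)]

/-! ### Commutation of the Hessians in type A. -/

theorem sum_antidiagonal_fst {M : Type*} [AddCommMonoid M] (n : ℕ) (f : ℕ → ℕ → ℕ → M) :
    ∑ x ∈ Finset.HasAntidiagonal.antidiagonal n, ∑ y ∈ Finset.HasAntidiagonal.antidiagonal x.1,
      f y.1 y.2 x.2 =
    ∑ x ∈ Finset.HasAntidiagonal.antidiagonal n, ∑ y ∈ Finset.HasAntidiagonal.antidiagonal x.2,
      f x.1 y.1 y.2 := by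
  rw [Finset.sum_sigma', Finset.sum_sigma']
  refine Finset.sum_nbij' (fun z => ⟨(z.2.1, z.2.2 + z.1.2), (z.2.2, z.1.2)⟩)
    (fun z => ⟨(z.1.1 + z.2.1, z.2.2), (z.1.1, z.2.1)⟩) ?_ ?_ ?_ ?_ ?_
  · rintro ⟨⟨a, b⟩, ⟨c, d⟩⟩ h
    simp only [Finset.mem_sigma, Finset.HasAntidiagonal.mem_antidiagonal] at h ⊢
    obtain ⟨rfl, rfl⟩ := h
    exact ⟨(add_assoc _ _ _).symm, trivial⟩
  · rintro ⟨⟨a, b⟩, ⟨c, d⟩⟩ h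
    simp only [Finset.mem_sigma, Finset.HasAntidiagonal.mem_antidiagonal] at h ⊢
    obtain ⟨rfl, rfl⟩ := h
    exact ⟨add_assoc _ _ _, trivial⟩
  · rintro ⟨⟨a, b⟩, ⟨c, d⟩⟩ h
    simp only [Finset.mem_sigma, Finset.HasAntidiagonal.mem_antidiagonal] at h ⊢
    obtain ⟨h1, rfl⟩ := h
    rfl
  · rintro ⟨⟨a, b⟩, ⟨c, d⟩⟩ h
    simp only [Finset.mem_sigma, Finset.HasAntidiagonal.mem_antidiagonal] at h ⊢
    obtain ⟨h1, rfl⟩ := h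
    rfl
  · rintro ⟨⟨a, b⟩, ⟨c, d⟩⟩ h
    rfl

/-- The coefficients of `dGenGradient`. -/
def hessianTerm (p : ℂ) (S : Matrix ι ι R) (k : ℕ) : Matrix ι ι R →ₗ[R] Matrix ι ι R where
  toFun Z := ∑ x ∈ Finset.HasAntidiagonal.antidiagonal k,
    (S ^ x.1 * Z * S ^ x.2 - (p • (S ^ x.1 * Z).trace) • S ^ x.2)
  map_add' Z Z' := by
    rw [← Finset.sum_add_distrib]
    refine Finset.sum_congr rfl fun x _ => ?_
    rw [mul_add, add_mul, Matrix.trace_add, smul_add, add_smul]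
    abel
  map_smul' a Z := by
    rw [RingHom.id_apply, Finset.smul_sum]
    refine Finset.sum_congr rfl fun x _ => ?_
    rw [Matrix.mul_smul, Matrix.smul_mul, Matrix.trace_smul, smul_sub, smul_comm p, smul_assoc a]

theorem hessianTerm_apply (p : ℂ) (S : Matrix ι ι R) (k : ℕ) (Z : Matrix ι ι R) :
    hessianTerm p S k Z = ∑ x ∈ Finset.HasAntidiagonal.antidiagonal k,
      (S ^ x.1 * Z * S ^ x.2 - (p • (S ^ x.1 * Z).trace) • S ^ x.2) := rfl

/-- The derivative of `genCoeff` is a convolution of `genCoeff` with traces. After reassociation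
both parts of the Hessian are convolutions with the same series. In degree `m + 2` the gradient has
order `m + 1` in `S` and the Hessian order `m`. -/
theorem dGenGradient_eq (p : ℂ) (m : ℕ) (S Z : Matrix ι ι R) :
    dGenGradient p (m + 2) S Z = (-p) • ∑ x ∈ Finset.HasAntidiagonal.antidiagonal m,
      genCoeff p S x.1 • hessianTerm p S x.2 Z := by
  rw [dGenGradient, show m + 2 - 1 = m + 1 by omega, Finset.sum_add_distrib]
  congr 1
  simp only [hessianTerm_apply, Finset.sum_sub_distrib, smul_sub]
  rw [sub_eq_neg_add]
  congr 1
  · rw [Finset.Nat.sum_antidiagonal_succ]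
    have h0 : dGenCoeff p S Z 0 = 0 := by simp [dGenCoeff]
    have h1 : ∀ j, dGenCoeff p S Z (j + 1) = (-p) • ∑ x ∈ Finset.HasAntidiagonal.antidiagonal j,
        genCoeff p S x.1 * (S ^ x.2 * Z).trace := fun j => by
      rw [dGenCoeff, Finset.Nat.sum_antidiagonal_succ']
      simp
    simp only [h0, zero_smul, zero_add, h1, Finset.smul_sum, Finset.sum_smul]
    rw [sum_antidiagonal_fst m fun a b c =>
      ((-p) • (genCoeff p S a * (S ^ b * Z).trace)) • S ^ c, ← Finset.sum_neg_distrib]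
    refine Finset.sum_congr rfl fun x _ => ?_
    rw [← Finset.sum_neg_distrib]
    refine Finset.sum_congr rfl fun y _ => ?_
    rw [neg_smul, neg_smul, smul_smul, mul_smul_comm]
  · rw [Finset.Nat.sum_antidiagonal_succ']
    simp only [dPow_zero, smul_zero, zero_add]
    refine Finset.sum_congr rfl fun x _ => ?_
    rw [dPow, Finset.Nat.sum_antidiagonal_eq_sum_range_succ_mk]
    simp

/-- The term without traces, `S^{x₁+y₁} V S^{x₂+y₂}`, is symmetric in the two Hessians. At a fixed
entry the remaining three terms are scalar and depend only on the sequences `Tr Sᵏ`, `Tr (Sᵏ V)` and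
`(Sᵏ) i j`; they form `interaction`. -/
theorem hessianTerm_hessianTerm_apply (p q : ℂ) (S V : Matrix ι ι R) (k l : ℕ) (i j : ι) :
    hessianTerm p S k (hessianTerm q S l V) i j =
      interaction p q (fun k => (S ^ k).trace) (fun k => (S ^ k * V).trace)
        (fun k => (S ^ k) i j) k l +
      (∑ x ∈ Finset.HasAntidiagonal.antidiagonal k, ∑ y ∈ Finset.HasAntidiagonal.antidiagonal l,
        S ^ (x.1 + y.1) * V * S ^ (x.2 + y.2)) i j := by
  rw [hessianTerm_apply, interaction, Matrix.sum_apply, Matrix.sum_apply, ← Finset.sum_add_distrib]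
  refine Finset.sum_congr rfl fun x _ => ?_
  rw [hessianTerm_apply, Finset.mul_sum, Finset.sum_mul, Matrix.trace_sum, Finset.smul_sum,
    Finset.sum_smul, ← Finset.sum_sub_distrib, Matrix.sum_apply, Matrix.sum_apply,
    ← Finset.sum_add_distrib]
  refine Finset.sum_congr rfl fun y _ => ?_
  have e1 : S ^ x.1 * (S ^ y.1 * V * S ^ y.2 - (q • (S ^ y.1 * V).trace) • S ^ y.2) * S ^ x.2 =
      S ^ (x.1 + y.1) * V * S ^ (x.2 + y.2) -
        (q • (S ^ y.1 * V).trace) • S ^ (x.1 + x.2 + y.2) := by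
    rw [mul_sub, sub_mul, Matrix.mul_smul, Matrix.smul_mul, add_right_comm, add_comm x.2,
      pow_add, pow_add, pow_add, pow_add]
    simp only [mul_assoc]
  have e2 : (S ^ x.1 * (S ^ y.1 * V * S ^ y.2 - (q • (S ^ y.1 * V).trace) • S ^ y.2)).trace =
      (S ^ (x.1 + y.1 + y.2) * V).trace - q • ((S ^ y.1 * V).trace * (S ^ (x.1 + y.2)).trace) := by
    rw [mul_sub, Matrix.trace_sub, Matrix.mul_smul, Matrix.trace_smul, ← pow_add, smul_eq_mul,
      smul_mul_assoc, ← mul_assoc, Matrix.trace_mul_comm, ← mul_assoc, ← mul_assoc, ← pow_add,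
      ← pow_add, add_comm y.2, add_right_comm]
  rw [e1, e2]
  simp only [Matrix.sub_apply, Matrix.smul_apply, smul_eq_mul]
  simp only [Algebra.smul_def, map_mul]
  ring

omit [Algebra ℂ R] in
theorem coeff₂_map_C_C_mul (f g : PowerSeries R) (F : ℕ → ℕ → R) (m n : ℕ) :
    coeff₂ m n (PowerSeries.map PowerSeries.C f * PowerSeries.C g * doubleSeries F) =
      ∑ x ∈ Finset.HasAntidiagonal.antidiagonal m, ∑ y ∈ Finset.HasAntidiagonal.antidiagonal n,
        PowerSeries.coeff x.1 f * (PowerSeries.coeff y.1 g * F x.2 y.2) := by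
  simp only [mul_assoc, coeff₂_map_C_mul, coeff₂_C_mul, coeff₂_doubleSeries, Finset.mul_sum]

theorem euler_genSeries (p : ℂ) {S : Matrix ι ι R} (hS : S.trace = 0) :
    eulerDerivation R (genSeries p fun k => (S ^ k).trace) =
      (-p) • ((genSeries p fun k => (S ^ k).trace) *
        (PowerSeries.mk (fun k => (S ^ k).trace) - PowerSeries.C (S ^ 0).trace)) := by
  ext1 j
  rw [coeff_eulerDerivation, PowerSeries.coeff_smul, PowerSeries.coeff_mul]
  refine (mul_genCoeff p hS j).trans ?_
  congr 1
  refine Finset.sum_congr rfl fun x _ => ?_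
  rw [genCoeff]
  congr 1
  rw [map_sub, PowerSeries.coeff_mk, PowerSeries.coeff_C]
  split_ifs with h
  · rw [h, sub_self]
  · rw [sub_zero]

theorem dGenGradient_dGenGradient_apply (p q : ℂ) (m n : ℕ) (S V : Matrix ι ι R) (i j : ι) :
    dGenGradient p (m + 2) S (dGenGradient q (n + 2) S V) i j =
      (p * q) • (coeff₂ m n (PowerSeries.map PowerSeries.C (genSeries p fun k => (S ^ k).trace) *
        PowerSeries.C (genSeries q fun k => (S ^ k).trace) *
        doubleSeries (interaction p q (fun k => (S ^ k).trace) (fun k => (S ^ k * V).trace)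
          (fun k => (S ^ k) i j))) +
      ∑ x ∈ Finset.HasAntidiagonal.antidiagonal m, ∑ y ∈ Finset.HasAntidiagonal.antidiagonal n,
        genCoeff p S x.1 * (genCoeff q S y.1 * (∑ u ∈ Finset.HasAntidiagonal.antidiagonal x.2,
          ∑ v ∈ Finset.HasAntidiagonal.antidiagonal y.2,
            S ^ (u.1 + v.1) * V * S ^ (u.2 + v.2)) i j)) := by
  rw [dGenGradient_eq, dGenGradient_eq, coeff₂_map_C_C_mul, ← Finset.sum_add_distrib]
  have h : ∀ k, hessianTerm p S k ((-q) • ∑ x ∈ Finset.HasAntidiagonal.antidiagonal n,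
      genCoeff q S x.1 • hessianTerm q S x.2 V) =
      (-q) • ∑ x ∈ Finset.HasAntidiagonal.antidiagonal n,
        genCoeff q S x.1 • hessianTerm p S k (hessianTerm q S x.2 V) := fun k => by
    rw [LinearMap.map_smul_of_tower, map_sum]
    simp only [map_smul]
  simp only [h]
  rw [Matrix.smul_apply, Matrix.sum_apply, ← neg_mul_neg, mul_smul]
  congr 1
  rw [Finset.smul_sum]
  refine Finset.sum_congr rfl fun x _ => ?_
  rw [Matrix.smul_apply, Matrix.smul_apply, Matrix.sum_apply, smul_comm]
  congr 1
  rw [smul_eq_mul, Finset.mul_sum, ← Finset.sum_add_distrib]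
  refine Finset.sum_congr rfl fun y _ => ?_
  rw [Matrix.smul_apply, hessianTerm_hessianTerm_apply, smul_eq_mul, genCoeff, genCoeff]
  ring

/-- The Hessians of the currents in type A commute. -/
theorem dGenGradient_comm {p q : ℂ} {m n : ℕ} (hm : 2 ≤ m) (hn : 2 ≤ n)
    (hp : p * Fintype.card ι = (m : ℂ) - 1) (hq : q * Fintype.card ι = (n : ℂ) - 1)
    {S : Matrix ι ι R} (hS : S.trace = 0) (V : Matrix ι ι R) :
    dGenGradient p m S (dGenGradient q n S V) = dGenGradient q n S (dGenGradient p m S V) := by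
  obtain ⟨m, rfl⟩ := Nat.exists_eq_add_of_le' hm
  obtain ⟨n, rfl⟩ := Nat.exists_eq_add_of_le' hn
  have hcard : (Fintype.card ι : R) = algebraMap ℂ R (Fintype.card ι : ℂ) := by simp
  have hp' : p • (S ^ 0).trace = (m : R) + 1 := by
    rw [pow_zero, Matrix.trace_one, hcard, Algebra.smul_def, ← map_mul, hp]
    rw [show ((m + 2 : ℕ) : ℂ) - 1 = m + 1 by push_cast; ring]
    simp
  have hq' : q • (S ^ 0).trace = (n : R) + 1 := by
    rw [pow_zero, Matrix.trace_one, hcard, Algebra.smul_def, ← map_mul, hq]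
    rw [show ((n + 2 : ℕ) : ℂ) - 1 = n + 1 by push_cast; ring]
    simp
  ext i j
  rw [dGenGradient_dGenGradient_apply, dGenGradient_dGenGradient_apply, mul_comm q p,
    coeff₂_interaction_symm p q _ _ _ _ _ m n (euler_genSeries p hS) (euler_genSeries q hS) hp' hq']
  -- Only the trace-free double sum is left; it is symmetric after exchanging the order of
  -- summation.
  congr 2
  rw [Finset.sum_comm]
  refine Finset.sum_congr rfl fun y _ => Finset.sum_congr rfl fun x _ => ?_
  rw [mul_left_comm, Finset.sum_comm]
  simp only [add_comm]

end TypeA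

/-! ### The projected gradients of the currents -/

section Currents

/-- The three kinds of currents: `Tr (Sⁿ)` with traceless gradient, the coefficients of the generating
function of type A, and `Tr (Sⁿ)`. -/
inductive CurrentKind
  | traceless
  | generating
  | plain

variable {R ι : Type*} [CommRing R] [Algebra ℂ R] [Fintype ι] [DecidableEq ι]

/-- The gradient of the current of degree `n`, projected to the Lie algebra. -/
def current : CurrentKind → ℕ → Matrix ι ι R → Matrix ι ι R
  | .traceless, n, X => (n : ℂ) • traceless R ι (X ^ (n - 1))
  | .generating, n, X => genGradient (((n : ℂ) - 1) / Fintype.card ι) n X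
  | .plain, n, X => (n : ℂ) • X ^ (n - 1)

/-- The derivative of `current`. -/
def dCurrent : CurrentKind → ℕ → Matrix ι ι R → Matrix ι ι R → Matrix ι ι R
  | .traceless, n, X, Z => (n : ℂ) • traceless R ι (dPow (n - 1) X Z)
  | .generating, n, X, Z => dGenGradient (((n : ℂ) - 1) / Fintype.card ι) n X Z
  | .plain, n, X, Z => (n : ℂ) • dPow (n - 1) X Z

omit [Fintype ι] [DecidableEq ι] in
theorem map_derivation_const_smul (D : Derivation ℂ R R) (a : ℂ) (X : Matrix ι ι R) :
    (a • X).map D = a • X.map D := by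
  ext i j
  exact D.map_smul a (X i j)

theorem map_derivation_current (c : CurrentKind) (n : ℕ) (D : Derivation ℂ R R) {X : Matrix ι ι R}
    (hX : c = .generating → X.trace = 0) :
    (current c n X).map D = dCurrent c n X (X.map D) := by
  cases c with
  | traceless =>
    rw [current, dCurrent, map_derivation_const_smul, ← map_derivation_pow]
    congr 1
    exact map_traceless (D : R →ₗ[ℂ] R) (X ^ (n - 1))
  | generating => exact map_derivation_genGradient D _ n (hX rfl)
  | plain => rw [current, dCurrent, map_derivation_const_smul, map_derivation_pow]

theorem traceless_lie (B X : Matrix ι ι R) : traceless R ι ⁅B, X⁆ = ⁅B, traceless R ι X⁆ := by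
  rw [traceless_of_trace_eq_zero (by rw [Ring.lie_def, Matrix.trace_sub, Matrix.trace_mul_comm,
    sub_self]), traceless_apply, Ring.lie_def, Ring.lie_def]
  simp [mul_sub, sub_mul]

theorem lie_complex_smul (a : ℂ) (B X : Matrix ι ι R) : ⁅B, a • X⁆ = a • ⁅B, X⁆ := by
  rw [Ring.lie_def, Ring.lie_def, mul_smul_comm, smul_mul_assoc, smul_sub]

theorem dCurrent_lie (c : CurrentKind) (n : ℕ) (X B : Matrix ι ι R) :
    dCurrent c n X ⁅B, X⁆ = ⁅B, current c n X⁆ := by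
  cases c with
  | traceless => rw [current, dCurrent, dPow_lie, traceless_lie, lie_complex_smul]
  | generating => exact dGenGradient_lie _ n X B
  | plain => rw [current, dCurrent, dPow_lie, lie_complex_smul]

theorem dCurrent_add (c : CurrentKind) (n : ℕ) (X Z Z' : Matrix ι ι R) :
    dCurrent c n X (Z + Z') = dCurrent c n X Z + dCurrent c n X Z' := by
  cases c with
  | traceless => simp only [dCurrent, dPow_add, map_add, smul_add]
  | generating => exact dGenGradient_add _ n X Z Z'
  | plain => simp only [dCurrent, dPow_add, smul_add]

theorem dCurrent_smul (c : CurrentKind) (n : ℕ) (a : ℂ) (X Z : Matrix ι ι R) :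
    dCurrent c n X (a • Z) = a • dCurrent c n X Z := by
  cases c with
  | traceless =>
    simp only [dCurrent, dPow_smul]
    rw [LinearMap.map_smul_of_tower, smul_comm]
  | generating => exact dGenGradient_smul _ n a X Z
  | plain => simp only [dCurrent, dPow_smul]; rw [smul_comm]

theorem current_commute (c : CurrentKind) (n : ℕ) {X Y : Matrix ι ι R} (h : Commute X Y) :
    Commute (current c n X) Y := by
  cases c with
  | traceless =>
    rw [current, traceless_apply]
    exact (((h.pow_left _).sub_left ((Commute.one_left Y).smul_left _))).smul_left _
  | generating => exact genGradient_commute _ n h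
  | plain => exact (h.pow_left _).smul_left _

theorem current_commute_current (c : CurrentKind) (m n : ℕ) (X : Matrix ι ι R) :
    Commute (current c n X) (current c m X) :=
  current_commute c n (current_commute c m (Commute.refl X)).symm

/-- The commutator of the Hessians for the traceless gradients of `Tr (Sⁿ)`. -/
theorem dCurrent_comm_traceless (m n : ℕ) (D : Derivation ℂ R R) (X : Matrix ι ι R) :
    dCurrent .traceless m X (dCurrent .traceless n X (X.map D)) -
      dCurrent .traceless n X (dCurrent .traceless m X (X.map D)) =
    D (X ^ (m - 1)).trace • (((m * n * (n - 1 : ℕ) : ℕ) : ℂ) * (Fintype.card ι : ℂ)⁻¹) •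
        traceless R ι (X ^ (n - 1 - 1)) -
      D (X ^ (n - 1)).trace • (((m * n * (m - 1 : ℕ) : ℕ) : ℂ) * (Fintype.card ι : ℂ)⁻¹) •
        traceless R ι (X ^ (m - 1 - 1)) := by
  -- Commutation fails only through the trace subtracted by the inner projection: the outer
  -- derivative maps that multiple of the identity to a multiple of `X ^ (m - 2)`.
  have key : ∀ m n : ℕ, dCurrent .traceless m X (dCurrent .traceless n X (X.map D)) =
      ((m * n : ℕ) : ℂ) • traceless R ι (dPow (m - 1) X (dPow (n - 1) X (X.map D))) -
      D (X ^ (n - 1)).trace • (((m * n * (m - 1 : ℕ) : ℕ) : ℂ) * (Fintype.card ι : ℂ)⁻¹) •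
        traceless R ι (X ^ (m - 1 - 1)) := by
    intro m n
    rw [dCurrent, dCurrent, ← map_derivation_pow, traceless_apply ((X ^ (n - 1)).map D),
      ← derivation_trace, sub_eq_add_neg, ← neg_smul, dPow_smul, dPow_add, dPow_smul,
      dPow_one_right, LinearMap.map_smul_of_tower, map_add, map_smul, ← Nat.cast_smul_eq_nsmul ℂ,
      LinearMap.map_smul_of_tower, smul_add, smul_add, sub_eq_add_neg]
    congr 1
    · rw [smul_smul]; push_cast; rfl
    · rw [neg_smul, smul_neg, smul_neg, mul_comm (algebraMap ℂ R _), mul_smul, algebraMap_smul,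
        smul_comm _ (D _), smul_comm _ (D _)]
      congr 2
      rw [smul_smul, smul_smul, smul_smul]
      congr 1
      push_cast
      ring
  rw [key m n, key n m, dPow_dPow_comm, mul_comm n m]
  abel

theorem dCurrent_comm {c : CurrentKind} (hc : c ≠ .traceless) {m n : ℕ} (hm : 2 ≤ m) (hn : 2 ≤ n)
    (hι : c = .generating → (Fintype.card ι : ℂ) ≠ 0)
    {X : Matrix ι ι R} (hX : c = .generating → X.trace = 0) (V : Matrix ι ι R) :
    dCurrent c m X (dCurrent c n X V) = dCurrent c n X (dCurrent c m X V) := by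
  cases c with
  | traceless => exact absurd rfl hc
  | generating =>
    exact dGenGradient_comm hm hn (div_mul_cancel₀ _ (hι rfl)) (div_mul_cancel₀ _ (hι rfl))
      (hX rfl) V
  | plain =>
    simp only [dCurrent, dPow_smul]
    rw [dPow_dPow_comm, smul_comm]

/-- Weighted homogeneity. The recursion determines the coefficients uniquely because positive
integers are invertible in a complex algebra. -/
theorem coeff_genSeries_pow_mul (p a : ℂ) (t : ℕ → R) (n : ℕ) :
    PowerSeries.coeff n (genSeries p fun k => a ^ k • t k) =
      a ^ n • PowerSeries.coeff n (genSeries p t) := by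
  induction n using Nat.strong_induction_on with
  | _ n ih =>
  rcases Nat.eq_zero_or_pos n with rfl | hn
  · rw [genSeries, genSeries, coeff_zero_expSeries, coeff_zero_expSeries, pow_zero, one_smul]
  have hu : IsUnit (n : R) := by
    have h : IsUnit (n : ℂ) := (Nat.cast_ne_zero.2 hn.ne').isUnit
    simpa using h.map (algebraMap ℂ R)
  refine hu.mul_left_cancel ?_
  rw [mul_smul_comm, mul_coeff_genSeries, mul_coeff_genSeries, Finset.smul_sum]
  refine Finset.sum_congr rfl fun x hx => ?_
  rw [Finset.HasAntidiagonal.mem_antidiagonal] at hx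
  split_ifs with h2
  · rw [ih x.1 (by omega), ← hx, pow_add, smul_mul_assoc, mul_smul, smul_comm (-p), mul_smul_comm]
  · simp

theorem twist_smul_pow (b : Bool) (Q : GL ι ℂ) (a : ℂ) (X : Matrix ι ι R) (j : ℕ) :
    (a • twist R b Q X) ^ j = (a ^ j * twistSign b ^ (j + 1)) • twist R b Q (X ^ j) := by
  rw [twist_pow, smul_smul, mul_assoc, ← mul_pow, twistSign_mul_self, one_pow, mul_one, smul_pow]

theorem trace_twist_smul_pow (b : Bool) (Q : GL ι ℂ) (a : ℂ) (X : Matrix ι ι R) (j : ℕ) :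
    ((a • twist R b Q X) ^ j).trace = (a * twistSign b) ^ j • (X ^ j).trace := by
  rw [twist_smul_pow, Matrix.trace_smul, trace_twist, smul_smul, mul_assoc, pow_succ, mul_assoc,
    twistSign_mul_self, mul_one, mul_pow]

theorem traceless_twist (b : Bool) (Q : GL ι ℂ) (X : Matrix ι ι R) :
    traceless R ι (twist R b Q X) = twist R b Q (traceless R ι X) := by
  rw [traceless_apply, traceless_apply, map_sub, map_smul, twist_one, trace_twist, smul_comm,
    mul_smul_comm, smul_assoc]

/-- Every term of the current has total degree `n - 1` in the matrix. Together, the signs from its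
traces and from its matrix power give the same sign `twistSign b ^ n` for each term. -/
theorem current_twist (c : CurrentKind) (n : ℕ) (hn : 1 ≤ n) (b : Bool) (Q : GL ι ℂ) (a : ℂ)
    (X : Matrix ι ι R) : current c n (a • twist R b Q X) =
      (a ^ (n - 1) * twistSign b ^ n) • twist R b Q (current c n X) := by
  have h1 : n - 1 + 1 = n := by omega
  cases c with
  | traceless =>
    rw [current, current, twist_smul_pow, h1, LinearMap.map_smul_of_tower, traceless_twist,
      LinearMap.map_smul_of_tower, smul_comm]
  | generating =>
    have h : ∀ p j, genCoeff p (a • twist R b Q X) j = (a * twistSign b) ^ j • genCoeff p X j := by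
      intro p j
      rw [genCoeff, genCoeff, ← coeff_genSeries_pow_mul]
      simp only [trace_twist_smul_pow]
    rw [current, current, genGradient, genGradient, LinearMap.map_smul_of_tower, smul_comm]
    congr 1
    rw [map_sum, Finset.smul_sum]
    refine Finset.sum_congr rfl fun x hx => ?_
    rw [Finset.HasAntidiagonal.mem_antidiagonal] at hx
    rw [h, twist_smul_pow, map_smul, smul_assoc, smul_comm (genCoeff _ _ _), smul_smul]
    congr 1
    rw [← h1, ← hx, Nat.add_sub_cancel]
    ring
  | plain =>
    rw [current, current, twist_smul_pow, h1, LinearMap.map_smul_of_tower, smul_comm]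

end Currents

/-! ### Expansions of the currents -/

section CurrentExpansions

variable {𝒜 ι : Type*} [CommRing 𝒜] [Algebra ℂ 𝒜] [Fintype ι] [DecidableEq ι]
variable {F G : ℂ → Matrix ι ι 𝒜} {z : ℂ} {s : Matrix ι ι (PowerSeries 𝒜)}

theorem genCoeff_eq_aeval {R : Type*} [CommRing R] [Algebra ℂ R] (p : ℂ) (X : Matrix ι ι R) (j : ℕ) :
    genCoeff p X j = MvPolynomial.aeval (fun k => (X ^ k).trace)
      (PowerSeries.coeff j (genSeries p (MvPolynomial.X : ℕ → MvPolynomial ℕ ℂ))) := by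
  rw [map_coeff_genSeries, genCoeff]
  simp

theorem MatHasExpansionAt.matrix_linearMap {ℬ : Type*} [CommRing ℬ] [Algebra ℂ ℬ]
    (hF : MatHasExpansionAt F z s) (ℓ : Matrix ι ι 𝒜 →ₗ[ℂ] ℬ) :
    HasExpansionAt (fun w => ℓ (F w)) z
      (PowerSeries.mk fun r => ℓ (s.map (PowerSeries.coeff r))) := by
  have key : ∀ X : Matrix ι ι 𝒜, ℓ X =
      ∑ i, ∑ j, (ℓ ∘ₗ (Matrix.singleLinearMap ℂ i j)) (X i j) := fun X => by
    conv_lhs => rw [Matrix.matrix_eq_sum_single X]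
    simp only [map_sum]
    rfl
  have h := HasExpansionAt.sum Finset.univ fun i _ => HasExpansionAt.sum Finset.univ
    fun j _ => (hF i j).linearMap (ℓ ∘ₗ (Matrix.singleLinearMap ℂ i j))
  convert h using 1
  · funext w
    exact key (F w)
  · ext r
    rw [PowerSeries.coeff_mk, key]
    simp

omit [Fintype ι] [DecidableEq ι] in
theorem MatHasExpansionAt.const_smul (hF : MatHasExpansionAt F z s) (a : ℂ) :
    MatHasExpansionAt (fun w => a • F w) z (a • s) := fun i j => (hF i j).const_smul a

theorem MatHasExpansionAt.matrix_map (hF : MatHasExpansionAt F z s)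
    (ℓ : Matrix ι ι 𝒜 →ₗ[ℂ] Matrix ι ι 𝒜) {t : Matrix ι ι (PowerSeries 𝒜)}
    (ht : ∀ r, t.map (PowerSeries.coeff r) = ℓ (s.map (PowerSeries.coeff r))) :
    MatHasExpansionAt (fun w => ℓ (F w)) z t := by
  intro i j
  have h := hF.matrix_linearMap (Matrix.entryLinearMap ℂ 𝒜 i j ∘ₗ ℓ)
  have e : (PowerSeries.mk fun r => (Matrix.entryLinearMap ℂ 𝒜 i j ∘ₗ ℓ)
      (s.map (PowerSeries.coeff r))) = t i j := by
    ext r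
    rw [PowerSeries.coeff_mk, LinearMap.comp_apply, ← ht]
    rfl
  rw [e] at h
  exact h

theorem MatHasExpansionAt.twist_pow (hF : MatHasExpansionAt F z s) (b : Bool) (Q : GL ι ℂ) (k : ℕ) :
    MatHasExpansionAt (fun w => (twist 𝒜 b Q ^ k) (F w)) z
      ((twist (PowerSeries 𝒜) b Q ^ k) s) :=
  hF.matrix_map ((twist 𝒜 b Q ^ k).restrictScalars ℂ) fun r =>
    twist_pow_map b Q k s ((PowerSeries.coeff r).restrictScalars ℂ)

theorem MatHasExpansionAt.traceless (hF : MatHasExpansionAt F z s) :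
    MatHasExpansionAt (fun w => traceless 𝒜 ι (F w)) z (RSHierarchy.traceless (PowerSeries 𝒜) ι s) :=
  hF.matrix_map ((RSHierarchy.traceless 𝒜 ι).restrictScalars ℂ) fun r =>
    map_traceless ((PowerSeries.coeff r).restrictScalars ℂ) s

theorem MatHasExpansionAt.aeval_trace (hF : MatHasExpansionAt F z s) (p : MvPolynomial ℕ ℂ) :
    HasExpansionAt (fun w => MvPolynomial.aeval (fun k => (F w ^ k).trace) p) z
      (MvPolynomial.aeval (fun k => (s ^ k).trace) p) :=
  HasExpansionAt.aeval (fun k => (hF.pow k).trace) p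

theorem MatHasExpansionAt.gradient (hF : MatHasExpansionAt F z s) (N : ℕ) (p : MvPolynomial ℕ ℂ) :
    MatHasExpansionAt (fun w => gradient N p (F w)) z (gradient N p s) := by
  refine MatHasExpansionAt.sum _ fun k _ => MatHasExpansionAt.smul (hF.aeval_trace _)
    (MatHasExpansionAt.smul ?_ (hF.pow _))
  have h := HasExpansionAt.const (k : 𝒜) z
  rwa [map_natCast] at h

theorem MatHasExpansionAt.current (hF : MatHasExpansionAt F z s) (c : CurrentKind) (n : ℕ) :
    MatHasExpansionAt (fun w => current c n (F w)) z (current c n s) := by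
  cases c with
  | traceless => exact (hF.pow _).traceless.const_smul _
  | generating =>
    refine (MatHasExpansionAt.sum _ fun x _ =>
      MatHasExpansionAt.smul ?_ (hF.pow x.2)).const_smul _
    simp only [genCoeff_eq_aeval]
    exact hF.aeval_trace _
  | plain => exact (hF.pow _).const_smul _

theorem MatIsRegularAt.dPow (hF : MatIsRegularAt F z) (hG : MatIsRegularAt G z) (k : ℕ) :
    MatIsRegularAt (fun w => dPow k (F w) (G w)) z :=
  MatIsRegularAt.sum _ fun _ _ => ((hF.pow _).mul hG).mul (hF.pow _)

theorem MatIsRegularAt.dCurrent (hF : MatIsRegularAt F z) (hG : MatIsRegularAt G z)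
    (c : CurrentKind) (n : ℕ) : MatIsRegularAt (fun w => dCurrent c n (F w) (G w)) z := by
  cases c with
  | traceless =>
    obtain ⟨s, hs⟩ := (hF.dPow hG (n - 1)).exists_expansion
    exact (hs.traceless.const_smul _).isRegularAt
  | generating =>
    obtain ⟨s, hs⟩ := hF.exists_expansion
    have h : ∀ p j, IsRegularAt (fun w => genCoeff p (F w) j) z := fun p j => by
      simp only [genCoeff_eq_aeval]
      exact (hs.aeval_trace _).isRegularAt
    refine (MatIsRegularAt.sum _ fun x _ => MatIsRegularAt.add (MatIsRegularAt.smul ?_ (hF.pow _))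
      (MatIsRegularAt.smul (h _ _) (hF.dPow hG _))).const_smul _
    refine (IsRegularAt.sum _ fun y _ => (h _ _).mul ?_).const_smul _
    split_ifs
    · exact IsRegularAt.const 0 z
    · exact ((hF.pow _).mul hG).trace
  | plain => exact (hF.dPow hG _).const_smul _

end CurrentExpansions

/-! ### The currents of a model -/

section CurrentProjection

variable {𝒜 ι κ : Type*} [CommRing 𝒜] [Algebra ℂ 𝒜] [LocalPoissonAlgebra 𝒜]
    [Fintype ι] [DecidableEq ι] [Fintype κ] [DecidableEq κ]
variable (S : ModelData 𝒜 ι κ)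
variable {R : Type*} [CommRing R] [Algebra ℂ R]

open Classical in
/-- The kind of the currents at `z`. -/
def ModelData.kind (z : ℂ) : CurrentKind :=
  match S.type with
  | .A => if S.IsCyclotomic z ∧ S.IsConj then .traceless else .generating
  | .BD => .plain
  | .C => .plain

variable {S}

omit [LocalPoissonAlgebra 𝒜] [DecidableEq κ] in
theorem ModelData.type_of_kind {z : ℂ} (h : S.kind z ≠ .plain) : S.type = .A := by
  cases hA : S.type <;> simp_all [ModelData.kind]

omit [LocalPoissonAlgebra 𝒜] [DecidableEq κ] in
theorem ModelData.of_kind_traceless {z : ℂ} (h : S.kind z = .traceless) :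
    S.IsCyclotomic z ∧ S.IsConj := by
  have hA : S.type = .A := ModelData.type_of_kind (z := z) (by rw [h]; nofun)
  by_contra h'
  simp [ModelData.kind, hA, h'] at h

omit [LocalPoissonAlgebra 𝒜] [DecidableEq κ] in
theorem ModelData.currentPoly_mem_supported (z : ℂ) (n : ℕ) :
    S.currentPoly z n ∈ MvPolynomial.supported ℂ {k | k < n + 1} := by
  have h : (MvPolynomial.X n : MvPolynomial ℕ ℂ) ∈ MvPolynomial.supported ℂ {k | k < n + 1} := by
    rw [MvPolynomial.X_mem_supported]
    exact Nat.lt_succ_self n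
  unfold ModelData.currentPoly
  split
  · split_ifs
    · exact h
    · exact ModelData.genPoly_mem_supported _ n
  · exact h
  · exact h

theorem gradient_X (n : ℕ) (X : Matrix ι ι R) :
    gradient (n + 1) (MvPolynomial.X n) X = (n : ℂ) • X ^ (n - 1) := by
  rw [gradient, Finset.sum_eq_single n]
  · simp only [MvPolynomial.pderiv_X_self, map_one, one_smul]
    rw [Nat.cast_smul_eq_nsmul, Nat.cast_smul_eq_nsmul]
  · intro k _ hk
    simp [MvPolynomial.pderiv_X_of_ne hk.symm]
  · simp

/-- In type A the projection removes the trace of the gradient. In types B, C and D the degree `n`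
is even, so the gradient is an odd power of an element of `g` and is left unchanged. -/
theorem IsRSSystem.casimirMap_gradient (hS : IsRSSystem S) {z : ℂ} {n : ℕ} (hn : n ∈ S.degrees z)
    (v : κ → R) :
    S.casimirMap R 0 (gradient (n + 1) (S.currentPoly z n) (S.toMatrix 1 v)) =
      current (S.kind z) n (S.toMatrix 1 v) := by
  obtain ⟨h2, hdeg, -⟩ := hn
  have plain : S.type ≠ .A → Even n →
      S.casimirMap R 0 (gradient (n + 1) (MvPolynomial.X n) (S.toMatrix 1 v)) =
      current .plain n (S.toMatrix 1 v) := fun hA he => by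
    rw [gradient_X, LinearMap.map_smul_of_tower, hS.casimirMap_zero_odd_pow hA, current]
    exact Nat.Even.sub_odd (by omega) he odd_one
  cases hA : S.type with
  | A =>
    have h0 := hS.card_ne_zero hA
    rw [hS.casimirMap_zero_typeA hA]
    by_cases h : S.IsCyclotomic z ∧ S.IsConj
    · simp only [ModelData.kind, ModelData.currentPoly, hA, h, and_self, if_true]
      rw [gradient_X, LinearMap.map_smul_of_tower, current]
    · simp only [ModelData.kind, ModelData.currentPoly, hA, h, if_false]
      exact traceless_gradient_genPoly (hS.trace_toMatrix hA v) (by omega) h0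
  | BD =>
    simp only [hA] at hdeg
    simp only [ModelData.kind, ModelData.currentPoly, hA]
    exact plain (by rw [hA]; nofun) hdeg
  | C =>
    simp only [hA] at hdeg
    simp only [ModelData.kind, ModelData.currentPoly, hA]
    exact plain (by rw [hA]; nofun) hdeg

end CurrentProjection

/-! ### Series of simple poles -/

section PoleSeries

theorem coeff_C_add_X_inv (a : ℂ) (i : ℕ) :
    PowerSeries.coeff i (PowerSeries.C a + PowerSeries.X : PowerSeries ℂ)⁻¹ =
      (-1) ^ i * (a⁻¹) ^ (i + 1) := by
  -- For `a = 0` both sides vanish by convention: the series has no invertible constant term, and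
  -- `0⁻¹ = 0`.
  by_cases ha : a = 0
  · have h : (PowerSeries.C a + PowerSeries.X : PowerSeries ℂ)⁻¹ = 0 := by
      rw [PowerSeries.inv_eq_zero]
      simp [ha]
    rw [h, ha]
    simp
  have h0 : PowerSeries.constantCoeff (PowerSeries.C a + PowerSeries.X : PowerSeries ℂ) ≠ 0 := by
    simpa using ha
  have h : (PowerSeries.mk fun i => (-1) ^ i * (a⁻¹) ^ (i + 1)) =
      (PowerSeries.C a + PowerSeries.X : PowerSeries ℂ)⁻¹ := by
    rw [PowerSeries.eq_inv_iff_mul_eq_one h0]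
    ext n
    cases n with
    | zero => simp [mul_add, ha]
    | succ n =>
      rw [mul_add, map_add, PowerSeries.coeff_mul_C, PowerSeries.coeff_succ_mul_X,
        PowerSeries.coeff_mk, PowerSeries.coeff_mk, PowerSeries.coeff_one, if_neg (by omega)]
      linear_combination (-(-1) ^ n * a⁻¹ ^ (n + 1)) * mul_inv_cancel₀ ha
  rw [← h, PowerSeries.coeff_mk]

theorem map_coeff_smul {𝒜 ι : Type*} [CommRing 𝒜] [Algebra ℂ 𝒜] (f : PowerSeries ℂ)
    (A : Matrix ι ι (PowerSeries 𝒜)) (r : ℕ) :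
    (PowerSeries.map (algebraMap ℂ 𝒜) f • A).map (PowerSeries.coeff r) =
      ∑ x ∈ Finset.HasAntidiagonal.antidiagonal r,
        PowerSeries.coeff x.1 f • A.map (PowerSeries.coeff x.2) := by
  ext i j
  simp only [Matrix.map_apply, Matrix.smul_apply, Matrix.sum_apply, smul_eq_mul,
    PowerSeries.coeff_mul, PowerSeries.coeff_map]
  simp only [Algebra.smul_def]

theorem twist_pow_map_coeff {𝒜 ι : Type*} [CommRing 𝒜] [Algebra ℂ 𝒜] [Fintype ι] [DecidableEq ι]
    (b : Bool) (Q : GL ι ℂ) (k j : ℕ) (X : Matrix ι ι (PowerSeries 𝒜)) :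
    ((twist (PowerSeries 𝒜) b Q ^ k) X).map (PowerSeries.coeff j) =
      (twist 𝒜 b Q ^ k) (X.map (PowerSeries.coeff j)) :=
  twist_pow_map b Q k X ((PowerSeries.coeff j).restrictScalars ℂ)

theorem tendsto_inv_sub_mul (z : ℂ) {a : ℂ} (ha : a ≠ 0) :
    Filter.Tendsto (fun w => (z - a * w)⁻¹) (Filter.cocompact ℂ) (𝓝 0) := by
  have h := ((Homeomorph.mulLeft₀ a ha).trans (Homeomorph.subLeft z)).isClosedEmbedding.tendsto_cocompact
  rw [← Metric.cobounded_eq_cocompact] at h ⊢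
  exact Filter.tendsto_inv₀_cobounded.comp h

theorem IsProperOff.isRegularAt {𝒜 : Type*} [CommRing 𝒜] [Algebra ℂ 𝒜] {P : Set ℂ} {F : ℂ → 𝒜}
    (hF : IsProperOff P F) {z : ℂ} (hz : z ∉ P) : IsRegularAt F z := by
  obtain ⟨N, f, c, hf, -, h⟩ := hF
  exact (HasExpansionAt.of_fintype (s := PowerSeries.mk fun r =>
    ∑ i, PowerSeries.coeff r (taylor (f i) z) • c i) f c (fun i => hf i z hz)
    (Filter.Eventually.of_forall h) fun r => PowerSeries.coeff_mk _ _).isRegularAt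

end PoleSeries

/-! ### The matrices `𝓜ₙ` as functions of the spectral parameter -/

section Field

variable {𝒜 ι κ : Type*} [CommRing 𝒜] [Algebra ℂ 𝒜] [LocalPoissonAlgebra 𝒜]
    [Fintype ι] [DecidableEq ι] [Fintype κ] [DecidableEq κ]
variable {S : ModelData 𝒜 ι κ}

namespace ModelData

/-- `S(λ, x) = φ(λ) 𝓛(λ, x)`. -/
def field (S : ModelData 𝒜 ι κ) (w : ℂ) : Matrix ι ι 𝒜 :=
  S.toMatrix 1 fun a => S.phi w • S.L w a

omit [LocalPoissonAlgebra 𝒜] [DecidableEq κ] in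
theorem field_eq (w : ℂ) : S.field w = S.phi w • S.lax w := by
  rw [field, lax, toMatrix, toMatrix, Finset.smul_sum]
  exact Finset.sum_congr rfl fun a _ => smul_assoc _ _ _

omit [LocalPoissonAlgebra 𝒜] [DecidableEq κ] in
theorem field_hasExpansionAt {z : ℂ} (hz : S.IsRegularZero z) :
    MatHasExpansionAt S.field z (S.SExpansion z) := by
  intro i j
  have h := HasExpansionAt.sum Finset.univ fun a _ =>
    (hasExpansionAt_expansion (hz.2 a)).mul (HasExpansionAt.const
      (algebraMap ℂ 𝒜 ((S.basis a : Matrix ι ι ℂ) i j)) z)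
  convert h using 1
  · funext w
    rw [field, toMatrix, Matrix.sum_apply]
    rfl
  · rw [SExpansion, toMatrix, Matrix.sum_apply]
    refine Finset.sum_congr rfl fun a _ => ?_
    rw [Matrix.smul_apply, Matrix.map_apply, PowerSeries.algebraMap_apply, smul_eq_mul]
    rfl

omit [LocalPoissonAlgebra 𝒜] [DecidableEq κ] in
theorem WExpansion_hasExpansionAt {z : ℂ} (hz : S.IsRegularZero z) (n : ℕ) :
    HasExpansionAt (fun w => MvPolynomial.aeval (fun k => (S.field w ^ k).trace)
      (S.currentPoly z n)) z (S.WExpansion z n) :=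
  (field_hasExpansionAt hz).aeval_trace _

omit [LocalPoissonAlgebra 𝒜] [DecidableEq κ] in
theorem partialTrace₂_cyclicSum_gradient {R : Type*} [CommRing R] [Algebra ℂ R] {b : Bool}
    {Q : GL ι ℂ} (hb : S.IsTwist b Q) (c : ℕ → R) (G : Matrix ι ι R) :
    partialTrace₂ (S.cyclicSum c * ((1 : Matrix ι ι R) ⊗ₖ G)) =
      (S.T : ℂ)⁻¹ • ∑ k ∈ Finset.range S.T, c k • (twist R b Q ^ k) (S.casimirMap R 0 G) := by
  rw [partialTrace₂_cyclicSum]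
  congr 1
  exact Finset.sum_congr rfl fun k _ => by rw [hb.casimirMap_eq k G]

/-- Contraction with `σ₁ᵏ C₁₂` projects the gradient to `g` and then applies `σᵏ`, so only the
projected gradient enters. -/
theorem MExpansion_eq (hS : IsRSSystem S) {b : Bool} {Q : GL ι ℂ} (hb : S.IsTwist b Q) {z : ℂ}
    {n : ℕ} (hn : n ∈ S.degrees z) (ρ : ℂ) :
    S.MExpansion z n ρ = (S.T : ℂ)⁻¹ • ∑ k ∈ Finset.range S.T,
      PowerSeries.map (algebraMap ℂ 𝒜)
        (PowerSeries.C (z - (S.ω ^ k)⁻¹ * ρ) + PowerSeries.X)⁻¹ •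
      (twist (PowerSeries 𝒜) b Q ^ k) (current (S.kind z) n (S.SExpansion z)) := by
  have hR : (S.R0Expansion ρ z).map (PowerSeries.map (algebraMap ℂ 𝒜)) =
      S.cyclicSum fun k => PowerSeries.map (algebraMap ℂ 𝒜)
        (PowerSeries.C (z - (S.ω ^ k)⁻¹ * ρ) + PowerSeries.X)⁻¹ :=
    S.cyclicSum_map (PowerSeries.mapAlgHom (Algebra.ofId ℂ 𝒜)) _
  have hN : ∀ k, S.NExpansion z k ρ = (S.T : ℂ)⁻¹ • ∑ j ∈ Finset.range S.T,
      PowerSeries.map (algebraMap ℂ 𝒜)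
        (PowerSeries.C (z - (S.ω ^ j)⁻¹ * ρ) + PowerSeries.X)⁻¹ •
      S.casimirMap (PowerSeries 𝒜) j ((k : PowerSeries 𝒜) • S.SExpansion z ^ (k - 1)) := by
    intro k
    rw [NExpansion, hR, partialTrace₂_cyclicSum, smul_comm, Finset.smul_sum]
    congr 1
    refine Finset.sum_congr rfl fun j _ => ?_
    rw [map_smul, smul_comm]
  have hc : current (S.kind z) n (S.SExpansion z) = S.casimirMap (PowerSeries 𝒜) 0
      (gradient (n + 1) (S.currentPoly z n) (S.SExpansion z)) :=
    (hS.casimirMap_gradient hn _).symm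
  simp only [MExpansion, hN, hc, ← hb.casimirMap_eq]
  simp only [Finset.smul_sum]
  rw [Finset.sum_comm]
  refine Finset.sum_congr rfl fun j _ => ?_
  rw [gradient, map_sum, Finset.smul_sum, Finset.smul_sum]
  refine Finset.sum_congr rfl fun k _ => ?_
  rw [map_smul, map_smul, map_smul, smul_comm]
  congr 1
  rw [smul_comm]
  rfl

/-- The coefficient of `(λ - z)ʲ` in the projected gradient of `𝓦ₙ`. -/
def currentCoeff (S : ModelData 𝒜 ι κ) (z : ℂ) (n j : ℕ) : Matrix ι ι 𝒜 :=
  (current (S.kind z) n (S.SExpansion z)).map (PowerSeries.coeff j)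

/-- Partial fractions in `ρ`: the poles lie on the orbit of `z` and have order at most `rₙ + 1`. The
global properties of `𝓜ₙ` are read off from this form. -/
theorem M_eq (hS : IsRSSystem S) {b : Bool} {Q : GL ι ℂ} (hb : S.IsTwist b Q) {z : ℂ}
    {n : ℕ} (hn : n ∈ S.degrees z) (ρ : ℂ) :
    S.M z n ρ = (S.T : ℂ)⁻¹ • ∑ k ∈ Finset.range S.T,
      ∑ x ∈ Finset.HasAntidiagonal.antidiagonal (S.r z n),
        ((-1) ^ x.1 * ((z - (S.ω ^ k)⁻¹ * ρ)⁻¹) ^ (x.1 + 1)) •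
          (twist 𝒜 b Q ^ k) (S.currentCoeff z n x.2) := by
  have h : ∀ (k : ℕ) (j : ℕ), ((twist (PowerSeries 𝒜) b Q ^ k)
      (current (S.kind z) n (S.SExpansion z))).map (PowerSeries.coeff j) =
      (twist 𝒜 b Q ^ k) (S.currentCoeff z n j) := fun k j => twist_pow_map_coeff b Q k j _
  have hsum : ∀ (u : Finset ℕ) (A : ℕ → Matrix ι ι (PowerSeries 𝒜)) (r : ℕ),
      ((S.T : ℂ)⁻¹ • ∑ k ∈ u, A k).map (PowerSeries.coeff r) =
      (S.T : ℂ)⁻¹ • ∑ k ∈ u, (A k).map (PowerSeries.coeff r) := fun u A r => by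
    ext i j
    simp [Matrix.sum_apply]
  rw [M, MExpansion_eq hS hb hn, hsum]
  simp only [map_coeff_smul, h, coeff_C_add_X_inv]

/-- The twist is known to have order `T` only on `g`, not on all matrices; the projected gradient is
a combination of elements of `g`. -/
theorem twist_pow_T_currentCoeff (hS : IsRSSystem S) {b : Bool} {Q : GL ι ℂ}
    (hb : S.IsTwist b Q) {z : ℂ} {n : ℕ} (hn : n ∈ S.degrees z) (j : ℕ) :
    (twist 𝒜 b Q ^ S.T) (S.currentCoeff z n j) = S.currentCoeff z n j := by
  have hc : current (S.kind z) n (S.SExpansion z) = S.casimirMap (PowerSeries 𝒜) 0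
      (gradient (n + 1) (S.currentPoly z n) (S.SExpansion z)) :=
    (hS.casimirMap_gradient hn _).symm
  have h : (twist (PowerSeries 𝒜) b Q ^ S.T) (current (S.kind z) n (S.SExpansion z)) =
      current (S.kind z) n (S.SExpansion z) := by
    rw [hc, ← hb.casimirMap_eq]
    ext1
    rw [casimirMap_apply, casimirMap_apply, ← hS.order, pow_orderOf_eq_one, pow_zero]
  refine (twist_pow_map_coeff b Q S.T j _).symm.trans ?_
  rw [h]
  rfl

/-- The orbit of `z` under multiplication by `ω`. -/
def orbit (S : ModelData 𝒜 ι κ) (z : ℂ) : Set ℂ := Set.range fun k : ℕ => S.ω ^ k * z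

theorem orbit_finite (hS : IsRSSystem S) (z : ℂ) : (S.orbit z).Finite := by
  refine ((Finset.range S.T).finite_toSet.image fun k => S.ω ^ k * z).subset ?_
  rintro _ ⟨k, rfl⟩
  refine ⟨k % S.T, by simpa using Nat.mod_lt _ hS.T_pos, ?_⟩
  dsimp only
  rw [hS.primitive.eq_orderOf, pow_mod_orderOf]

theorem omega_ne_zero (hS : IsRSSystem S) : S.ω ≠ 0 := hS.primitive.ne_zero hS.T_pos.ne'

theorem M_isProperOff (hS : IsRSSystem S) {z : ℂ} {n : ℕ} (hn : n ∈ S.degrees z) (i j : ι) :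
    IsProperOff (S.orbit z) fun ρ => S.M z n ρ i j := by
  obtain ⟨b, Q, hb, -⟩ := hS.exists_twist
  have hω := omega_ne_zero hS
  have h : ∀ k : ℕ, ∀ p : ℕ, ∀ a : 𝒜, IsProperOff (S.orbit z) fun ρ =>
      ((S.T : ℂ)⁻¹ * ((-1) ^ p * ((z - (S.ω ^ k)⁻¹ * ρ)⁻¹) ^ (p + 1))) • a := by
    intro k p a
    refine IsProperOff.smul_const (fun w hw => ?_) ?_ a
    · have h0 : z - (S.ω ^ k)⁻¹ * w ≠ 0 := fun h0 => hw ⟨k, by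
        dsimp only
        rw [sub_eq_zero.1 h0, mul_inv_cancel_left₀ (pow_ne_zero k hω)]⟩
      fun_prop (disch := assumption)
    · have h1 := (((tendsto_inv_sub_mul z (inv_ne_zero (pow_ne_zero k hω))).pow
        (p + 1)).const_mul ((-1) ^ p)).const_mul ((S.T : ℂ)⁻¹)
      simpa using h1
  have h2 := IsProperOff.sum (Finset.range S.T) fun k _ => IsProperOff.sum
    (Finset.HasAntidiagonal.antidiagonal (S.r z n)) fun x _ =>
      h k x.1 ((twist 𝒜 b Q ^ k) (S.currentCoeff z n x.2) i j)
  convert h2 using 2 with ρ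
  rw [M_eq hS hb hn]
  simp only [Matrix.smul_apply, Matrix.sum_apply, Finset.smul_sum, mul_smul]

theorem M_omega_mul (hS : IsRSSystem S) {b : Bool} {Q : GL ι ℂ} (hb : S.IsTwist b Q) {z : ℂ}
    {n : ℕ} (hn : n ∈ S.degrees z) (ρ : ℂ) :
    S.M z n (S.ω * ρ) = twist 𝒜 b Q (S.M z n ρ) := by
  have hω := omega_ne_zero hS
  rw [M_eq hS hb hn, M_eq hS hb hn, LinearMap.map_smul_of_tower, map_sum]
  congr 1
  -- The sum over `0, …, T` is split at its first and at its last term. These two terms agree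
  -- because `ω` and `σ` have period `T`, so the cyclic sum may be shifted by one.
  have h := (Finset.sum_range_succ' (fun k => ∑ x ∈ Finset.HasAntidiagonal.antidiagonal (S.r z n),
    ((-1) ^ x.1 * ((z - (S.ω ^ k)⁻¹ * (S.ω * ρ))⁻¹) ^ (x.1 + 1)) •
      (twist 𝒜 b Q ^ k) (S.currentCoeff z n x.2)) S.T).symm.trans (Finset.sum_range_succ _ S.T)
  simp only [twist_pow_T_currentCoeff hS hb hn, hS.primitive.pow_eq_one] at h
  rw [pow_zero, pow_zero] at h
  refine (add_right_cancel h).symm.trans ?_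
  refine Finset.sum_congr rfl fun k _ => ?_
  rw [map_sum]
  refine Finset.sum_congr rfl fun x _ => ?_
  rw [LinearMap.map_smul_of_tower, pow_succ' (twist 𝒜 b Q), Module.End.mul_apply, pow_succ S.ω,
    mul_inv, mul_assoc, inv_mul_cancel_left₀ hω]

end ModelData

end Field

/-! ### Punctured neighbourhoods -/

section PunctureLemmas

theorem tendsto_mul_punctured {a : ℂ} (ha : a ≠ 0) (z : ℂ) :
    Filter.Tendsto (fun w => a * w) (𝓝[≠] z) (𝓝[≠] (a * z)) := by
  refine tendsto_nhdsWithin_of_tendsto_nhds_of_eventually_within _ ?_ ?_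
  · exact ((continuous_const_mul a).tendsto z).mono_left nhdsWithin_le_nhds
  · filter_upwards [self_mem_nhdsWithin] with w hw h
    exact hw (mul_left_cancel₀ ha h)

theorem coeff_eq_of_comp_mul {𝒜 : Type*} [CommRing 𝒜] [Algebra ℂ 𝒜] {F : ℂ → 𝒜} {s : PowerSeries 𝒜}
    (hF : HasExpansionAt F 0 s) {a : ℂ} (ha : a ≠ 0) {G : ℂ → 𝒜} {t : PowerSeries 𝒜} (hG : HasExpansionAt G 0 t)
    (h : ∀ᶠ w in 𝓝[≠] (0 : ℂ), F (a * w) = G w) (j : ℕ) :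
    a ^ j • PowerSeries.coeff j s = PowerSeries.coeff j t := by
  have h1 : HasExpansionAt (fun w => F (a * w)) 0 _ :=
    HasExpansionAt.comp_mul ha (by rwa [mul_zero])
  rw [← (h1.unique (hG.congr h)), PowerSeries.coeff_mk]

theorem eventually_notMem_of_finite {P : Set ℂ} (hP : P.Finite) (z : ℂ) :
    ∀ᶠ w in 𝓝[≠] z, w ∉ P := by
  have h := (hP.subset (Set.sdiff_subset (t := {z}))).isClosed.isOpen_compl.mem_nhds (x := z)
    (by simp)
  filter_upwards [nhdsWithin_le_nhds h, self_mem_nhdsWithin] with w h1 h2 h3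
  exact h1 ⟨h3, h2⟩

end PunctureLemmas

/-! ### The poles of `𝓜ₙ` -/

section PoleForm

variable {𝒜 ι κ : Type*} [CommRing 𝒜] [Algebra ℂ 𝒜] [LocalPoissonAlgebra 𝒜]
    [Fintype ι] [DecidableEq ι] [Fintype κ] [DecidableEq κ]
variable {S : ModelData 𝒜 ι κ}

namespace ModelData

theorem eventually_mem_dom (hS : IsRSSystem S) (z : ℂ) : ∀ᶠ w in 𝓝[≠] z, w ∈ S.dom := by
  have h := mem_codiscreteWithin_iff_forall_mem_nhdsNE.1 hS.dom_codiscrete z (Set.mem_univ z)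
  filter_upwards [h] with w hw
  simpa using hw

theorem field_omega_mul (hS : IsRSSystem S) {b : Bool} {Q : GL ι ℂ} (hb : S.IsTwist b Q) {w : ℂ}
    (hw : w ∈ S.dom) (hw' : S.ω * w ∈ S.dom) :
    S.field (S.ω * w) = S.ω⁻¹ • twist 𝒜 b Q (S.field w) := by
  rw [field_eq, field_eq, ← hS.lax_equivariant w hw hw', hb.toMatrix_sigmaEnd, hS.phi_equivariant,
    LinearMap.map_smul_of_tower, smul_smul]
  rfl

theorem eventually_field_omega_mul (hS : IsRSSystem S) {b : Bool} {Q : GL ι ℂ}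
    (hb : S.IsTwist b Q) :
    ∀ᶠ w in 𝓝[≠] (0 : ℂ), S.field (S.ω * w) = S.ω⁻¹ • twist 𝒜 b Q (S.field w) := by
  have h := tendsto_mul_punctured (omega_ne_zero hS) 0
  rw [mul_zero] at h
  filter_upwards [eventually_mem_dom hS 0, h.eventually (eventually_mem_dom hS 0)] with w h1 h2
  exact field_omega_mul hS hb h1 h2

omit [LocalPoissonAlgebra 𝒜] [DecidableEq κ] in
theorem current_hasExpansionAt {z : ℂ} (hz : S.IsRegularZero z) (n : ℕ) :
    MatHasExpansionAt (fun w => current (S.kind z) n (S.field w)) z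
      (current (S.kind z) n (S.SExpansion z)) :=
  (field_hasExpansionAt hz).current _ n

/-- At the origin, the coefficients of the currents are eigenvectors of `σ`. -/
theorem twist_currentCoeff (hS : IsRSSystem S) {b : Bool} {Q : GL ι ℂ} (hb : S.IsTwist b Q)
    (hε : twistSign b * S.ω = S.ω ^ S.kappa) (hz : S.IsRegularZero 0) {n : ℕ} (hn : 1 ≤ n) (j : ℕ) :
    twist 𝒜 b Q (S.currentCoeff 0 n j) =
      (S.ω⁻¹ * S.ω ^ (n * S.kappa + j)) • S.currentCoeff 0 n j := by
  have hω := omega_ne_zero hS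
  have hY := current_hasExpansionAt hz n
  have key : S.ω ^ j • S.currentCoeff 0 n j =
      (S.ω⁻¹ ^ (n - 1) * twistSign b ^ n) • twist 𝒜 b Q (S.currentCoeff 0 n j) := by
    have hG := (hY.twist_pow b Q 1).const_smul (S.ω⁻¹ ^ (n - 1) * twistSign b ^ n)
    have h2 := twist_pow_map_coeff b Q 1 j (current (S.kind 0) n (S.SExpansion 0))
    rw [pow_one, pow_one] at h2
    rw [pow_one, pow_one] at hG
    ext i i'
    -- The coefficients of order `j` are compared in the equivariance of the current under `w ↦ ω
    -- w`.
    have h := coeff_eq_of_comp_mul (hY i i') hω (hG i i') (by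
      filter_upwards [eventually_field_omega_mul hS hb] with w hw
      rw [hw, current_twist _ n hn]) j
    rw [Matrix.smul_apply, Matrix.smul_apply, currentCoeff, ← h2]
    refine h.trans ?_
    rw [Matrix.smul_apply, PowerSeries.coeff_smul]
    rfl
  have e1 : twistSign b ^ n * twistSign b ^ n = 1 := by
    rw [← mul_pow, twistSign_mul_self, one_pow]
  have e2 : S.ω * S.ω⁻¹ ^ n = S.ω⁻¹ ^ (n - 1) := by
    obtain ⟨n, rfl⟩ := Nat.exists_eq_add_of_le' hn
    rw [Nat.add_sub_cancel, pow_succ']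
    exact mul_inv_cancel_left₀ hω _
  have e3 : S.ω ^ (n * S.kappa) = twistSign b ^ n * S.ω ^ n := by
    rw [mul_comm, pow_mul, ← hε, mul_pow]
  rw [pow_add, e3, ← mul_assoc, mul_smul, key, smul_smul, ← e2]
  rw [show S.ω⁻¹ * (twistSign b ^ n * S.ω ^ n) * (S.ω * S.ω⁻¹ ^ n * twistSign b ^ n) =
    (S.ω⁻¹ * S.ω) * (S.ω ^ n * S.ω⁻¹ ^ n) * (twistSign b ^ n * twistSign b ^ n) by ring, e1,
    ← mul_pow, inv_mul_cancel₀ hω, mul_inv_cancel₀ hω]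
  simp

theorem dvd_add_r (hS : IsRSSystem S) {z : ℂ} (hz : S.IsCyclotomic z) (n : ℕ) :
    S.T ∣ n * S.kappa + S.r z n := by
  have hT : (S.T : ℤ) ≠ 0 := by exact_mod_cast hS.T_pos.ne'
  rw [← Int.natCast_dvd_natCast, r, if_pos hz]
  push_cast
  rw [Int.toNat_of_nonneg (Int.emod_nonneg _ hT)]
  have h := Int.emod_add_mul_ediv (-((n : ℤ) * S.kappa)) S.T
  refine ⟨-(-((n : ℤ) * S.kappa) / S.T), ?_⟩
  linear_combination h

theorem r_lt (hS : IsRSSystem S) (z : ℂ) (n : ℕ) : S.r z n < S.T := by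
  have hT : (0 : ℤ) < S.T := by exact_mod_cast hS.T_pos
  rw [r]
  split_ifs
  · have := Int.emod_lt_of_pos (-((n * S.kappa : ℕ) : ℤ)) hT
    have := Int.emod_nonneg (-((n * S.kappa : ℕ) : ℤ)) hT.ne'
    omega
  · exact hS.T_pos

/-- Each coefficient is an eigenvector of `σ`, and since `T` divides `n κ + rₙ` its eigenvalue
compensates the powers of `ω` from the poles. All `T` summands coincide, which cancels the prefactor
`1/T` and leaves minus the Taylor polynomial of the current over `ρ ^ (rₙ + 1)`. -/
theorem M_eq_of_isCyclotomic (hS : IsRSSystem S) {n : ℕ} (hz : S.IsRegularZero 0)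
    (hn : n ∈ S.degrees 0) (hc : S.IsCyclotomic 0) (ρ : ℂ) :
    S.M 0 n ρ = -∑ x ∈ Finset.HasAntidiagonal.antidiagonal (S.r 0 n),
      (ρ⁻¹) ^ (x.1 + 1) • S.currentCoeff 0 n x.2 := by
  obtain ⟨b, Q, hb, hε⟩ := hS.exists_twist
  have hω := omega_ne_zero hS
  have hT : (S.T : ℂ) ≠ 0 := by exact_mod_cast hS.T_pos.ne'
  have hpow : ∀ k j : ℕ, (twist 𝒜 b Q ^ k) (S.currentCoeff 0 n j) =
      (S.ω⁻¹ * S.ω ^ (n * S.kappa + j)) ^ k • S.currentCoeff 0 n j := by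
    intro k j
    induction k with
    | zero => simp
    | succ k ih =>
      rw [pow_succ', Module.End.mul_apply, ih, LinearMap.map_smul_of_tower,
        twist_currentCoeff hS hb hε hz (by have := hn.1; omega), smul_smul, ← pow_succ]
  rw [M_eq hS hb hn]
  have hterm : ∀ k : ℕ, ∑ x ∈ Finset.HasAntidiagonal.antidiagonal (S.r 0 n),
        ((-1) ^ x.1 * ((0 - (S.ω ^ k)⁻¹ * ρ)⁻¹) ^ (x.1 + 1)) •
          (twist 𝒜 b Q ^ k) (S.currentCoeff 0 n x.2) =
      -∑ x ∈ Finset.HasAntidiagonal.antidiagonal (S.r 0 n),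
        (ρ⁻¹) ^ (x.1 + 1) • S.currentCoeff 0 n x.2 := by
    intro k
    rw [← Finset.sum_neg_distrib]
    refine Finset.sum_congr rfl fun x hx => ?_
    rw [Finset.HasAntidiagonal.mem_antidiagonal] at hx
    rw [hpow, smul_smul, ← neg_smul]
    congr 1
    have h1 : (0 - (S.ω ^ k)⁻¹ * ρ)⁻¹ = -(S.ω ^ k * ρ⁻¹) := by
      rw [zero_sub, inv_neg, mul_inv, inv_inv]
    have h2 : (S.ω ^ k) ^ (x.1 + 1) * (S.ω⁻¹ * S.ω ^ (n * S.kappa + x.2)) ^ k = 1 := by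
      obtain ⟨q, hq⟩ := dvd_add_r hS hc n
      rw [← pow_mul, mul_comm k, pow_mul, ← mul_pow, pow_succ, mul_assoc, mul_inv_cancel_left₀ hω,
        ← pow_add, show x.1 + (n * S.kappa + x.2) = n * S.kappa + S.r 0 n by omega, hq, pow_mul,
        hS.primitive.pow_eq_one, one_pow, one_pow]
    have h3 : ((-1 : ℂ)) ^ x.1 * (-1) ^ (x.1 + 1) = -1 := by
      rw [← pow_add, ← add_assoc, pow_succ, ← two_mul, pow_mul]
      simp
    rw [h1, neg_eq_neg_one_mul, mul_pow, mul_pow]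
    linear_combination ((S.ω ^ k) ^ (x.1 + 1) * (ρ⁻¹) ^ (x.1 + 1) *
      (S.ω⁻¹ * S.ω ^ (n * S.kappa + x.2)) ^ k) * h3 - (ρ⁻¹) ^ (x.1 + 1) * h2
  simp only [hterm]
  rw [Finset.sum_const, Finset.card_range, ← Nat.cast_smul_eq_nsmul ℂ, smul_smul,
    inv_mul_cancel₀ hT, one_smul]

omit [LocalPoissonAlgebra 𝒜] [DecidableEq κ] in
theorem r_of_not_isCyclotomic {z : ℂ} (h : ¬ S.IsCyclotomic z) (n : ℕ) : S.r z n = 0 := by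
  rw [r, if_neg h]

/-- The singular part of `M` at `z`. -/
theorem exists_regular_part (hS : IsRSSystem S) {z : ℂ} (hz : S.IsRegularZero z) {n : ℕ}
    (hn : n ∈ S.degrees z) : ∃ c : ℂ, MatIsRegularAt (fun w => S.M z n w +
      (c * ((w - z) ^ (S.r z n + 1))⁻¹) • current (S.kind z) n (S.field w)) z := by
  have hY := current_hasExpansionAt hz n
  by_cases hc : S.IsCyclotomic z
  · obtain rfl := hc.2
    -- At the origin the singular part is minus a Taylor polynomial of the current, so adding the
    -- full quotient leaves a Taylor remainder.
    refine ⟨1, fun i j => ((hY i j).taylor_remainder (S.r 0 n + 1)).isRegularAt.congr ?_⟩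
    filter_upwards [self_mem_nhdsWithin] with w hw
    have hw : w ≠ 0 := hw
    have e : ∑ k ∈ Finset.range (S.r 0 n + 1), (w - 0) ^ k •
        PowerSeries.coeff k (current (S.kind 0) n (S.SExpansion 0) i j) =
        (w ^ (S.r 0 n + 1)) • ∑ x ∈ Finset.HasAntidiagonal.antidiagonal (S.r 0 n),
          (w⁻¹) ^ (x.1 + 1) • S.currentCoeff 0 n x.2 i j := by
      rw [← Finset.Nat.sum_antidiagonal_swap, Finset.Nat.sum_antidiagonal_eq_sum_range_succ_mk,
        Finset.smul_sum]
      refine Finset.sum_congr rfl fun k hk => ?_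
      rw [Finset.mem_range] at hk
      rw [smul_smul, sub_zero]
      congr 1
      dsimp only [Prod.fst_swap]
      rw [show S.r 0 n + 1 = k + (S.r 0 n - k + 1) by omega, pow_add, mul_assoc, ← mul_pow,
        mul_inv_cancel₀ hw, one_pow, mul_one]
    rw [e, smul_sub, smul_smul, sub_zero, inv_mul_cancel₀ (pow_ne_zero _ hw), one_smul,
      M_eq_of_isCyclotomic hS hz hn hc]
    simp only [Matrix.add_apply, Matrix.neg_apply, Matrix.sum_apply, Matrix.smul_apply, one_mul]
    abel
  · obtain ⟨b, Q, hb, -⟩ := hS.exists_twist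
    have hω := omega_ne_zero hS
    -- Away from a cyclotomic point only the summand `k = 0` is singular at `z`, with weight `1/T`;
    -- the others have their poles at different points of the orbit.
    refine ⟨(S.T : ℂ)⁻¹, fun i j => ?_⟩
    have h1 : ∀ k ∈ Finset.range (S.T - 1), IsRegularAt (fun w => (z - (S.ω ^ (k + 1))⁻¹ * w)⁻¹ •
        (twist 𝒜 b Q ^ (k + 1)) (S.currentCoeff z n 0) i j) z := by
      intro k hk
      rw [Finset.mem_range] at hk
      have hz0 : z ≠ 0 := fun h0 => hc ⟨by omega, h0⟩
      refine IsRegularAt.smul (AnalyticAt.isRegularAt ?_) (IsRegularAt.const _ _)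
      have h0 : z - (S.ω ^ (k + 1))⁻¹ * z ≠ 0 := fun h0 => by
        refine hS.primitive.pow_ne_one_of_pos_of_lt (by omega) (by omega : k + 1 < S.T) ?_
        have h2 : S.ω ^ (k + 1) * z = z := by
          conv_lhs => rw [sub_eq_zero.1 h0]
          exact mul_inv_cancel_left₀ (pow_ne_zero _ hω) z
        exact mul_right_cancel₀ hz0 (h2.trans (one_mul z).symm)
      fun_prop (disch := assumption)
    refine (((hY i j).divided_difference.isRegularAt.add
      (IsRegularAt.sum _ h1)).const_smul (S.T : ℂ)⁻¹).congr (Filter.Eventually.of_forall fun w => ?_)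
    have hr := r_of_not_isCyclotomic hc n
    have hT : S.T = S.T - 1 + 1 := by have := hS.T_pos; omega
    have hM : S.M z n w = (S.T : ℂ)⁻¹ • (∑ k ∈ Finset.range (S.T - 1),
        (z - (S.ω ^ (k + 1))⁻¹ * w)⁻¹ • (twist 𝒜 b Q ^ (k + 1)) (S.currentCoeff z n 0) +
        (z - w)⁻¹ • S.currentCoeff z n 0) := by
      rw [M_eq hS hb hn, hr]
      conv_lhs => rw [hT, Finset.sum_range_succ', ← hT]
      simp
    beta_reduce
    rw [hM, hr, zero_add, pow_one, ← neg_sub w z, inv_neg]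
    simp only [Matrix.add_apply, Matrix.smul_apply, Matrix.sum_apply, smul_add, smul_sub, mul_smul,
      neg_smul, smul_neg, Matrix.neg_apply]
    have e : PowerSeries.coeff 0 (current (S.kind z) n (S.SExpansion z) i j) =
      S.currentCoeff z n 0 i j := rfl
    rw [e]
    module

end ModelData

end PoleForm

/-! ### The twist function -/

section TwistFunction

variable {𝒜 ι κ : Type*} [CommRing 𝒜] [Algebra ℂ 𝒜] [LocalPoissonAlgebra 𝒜]
    [Fintype ι] [DecidableEq ι] [Fintype κ] [DecidableEq κ]
variable {S : ModelData 𝒜 ι κ}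

namespace ModelData

omit [LocalPoissonAlgebra 𝒜] [DecidableEq κ] in
theorem phi_eq (z : ℂ) : S.phi z = S.φ.num.eval z / S.φ.denom.eval z := by
  rw [phi, RatFunc.eval, Polynomial.eval₂_id, Polynomial.eval₂_id]

omit [LocalPoissonAlgebra 𝒜] [DecidableEq κ] in
-- Numerator and denominator are coprime, so a root of the numerator is a genuine zero of `φ` rather
-- than an artefact of division by zero.
theorem eval_denom_ne_zero {z : ℂ} (hz : S.IsRegularZero z) : S.φ.denom.eval z ≠ 0 := by
  obtain ⟨u, v, huv⟩ := RatFunc.isCoprime_num_denom S.φ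
  intro h
  have h1 := congrArg (Polynomial.eval z) huv
  rw [Polynomial.eval_add, Polynomial.eval_mul, Polynomial.eval_mul, hz.1, h] at h1
  simp at h1

omit [LocalPoissonAlgebra 𝒜] [DecidableEq κ] in
theorem analyticAt_phi {z : ℂ} (hz : S.IsRegularZero z) : AnalyticAt ℂ S.phi z := by
  have h : S.phi = fun w => S.φ.num.eval w / S.φ.denom.eval w := funext phi_eq
  rw [h]
  exact (AnalyticOnNhd.eval_polynomial S.φ.num z (Set.mem_univ z)).div
    (AnalyticOnNhd.eval_polynomial S.φ.denom z (Set.mem_univ z)) (eval_denom_ne_zero hz)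

omit [LocalPoissonAlgebra 𝒜] [DecidableEq κ] in
theorem phi_eq_zero {z : ℂ} (hz : S.IsRegularZero z) : S.phi z = 0 := by
  rw [phi_eq, hz.1, zero_div]

theorem eventually_eval_ne_zero {p : Polynomial ℂ} (hp : p ≠ 0) (z : ℂ) :
    ∀ᶠ w in 𝓝[≠] z, p.eval w ≠ 0 := by
  have hfin : {w | p.eval w = 0}.Finite :=
    p.roots.toFinset.finite_toSet.subset fun w hw => by simpa [hp] using hw
  exact eventually_notMem_of_finite hfin z

theorem eventually_phi_ne_zero (hS : IsRSSystem S) (z : ℂ) : ∀ᶠ w in 𝓝[≠] z, S.phi w ≠ 0 := by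
  filter_upwards [eventually_eval_ne_zero (RatFunc.num_ne_zero hS.phi_ne_zero) z,
    eventually_eval_ne_zero S.φ.denom_ne_zero z] with w h1 h2
  rw [phi_eq]
  exact div_ne_zero h1 h2

/-- At the origin, `φ(ωλ) = ω⁻¹ φ(λ)` allows only powers `λʲ` with `T ∣ j + 1`. The smallest is `T -
1`, which exceeds `rₙ` because degrees with `rₙ = T - 1` are excluded. At other points `rₙ = 0` and
a simple zero suffices. -/
theorem coeff_taylor_phi (hS : IsRSSystem S) {z : ℂ} (hz : S.IsRegularZero z) {n : ℕ}
    (hn : n ∈ S.degrees z) {j : ℕ} (hj : j ≤ S.r z n) :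
    PowerSeries.coeff j (taylor S.phi z) = 0 := by
  by_cases hc : S.IsCyclotomic z
  · obtain rfl := hc.2
    have hω := omega_ne_zero hS
    have hE := HasExpansionAt.of_analyticAt (analyticAt_phi hz)
    have h := coeff_eq_of_comp_mul hE hω (hE.const_smul S.ω⁻¹)
      (Filter.Eventually.of_forall hS.phi_equivariant) j
    rw [PowerSeries.coeff_smul, smul_eq_mul, smul_eq_mul] at h
    have h1 : S.ω ^ (j + 1) ≠ 1 := hS.primitive.pow_ne_one_of_pos_of_lt (by omega) (by
      have := r_lt hS 0 n
      have := hn.2.2 hc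
      omega)
    by_contra h0
    refine h1 ?_
    rw [pow_succ, mul_right_cancel₀ h0 h, inv_mul_cancel₀ hω]
  · rw [r_of_not_isCyclotomic hc, Nat.le_zero] at hj
    rw [hj, coeff_taylor_zero, phi_eq_zero hz]

theorem mem_orbit_of_pow_eq (hS : IsRSSystem S) {z w : ℂ} (h : z ^ S.T = w ^ S.T) :
    w ∈ S.orbit z := by
  by_cases hz : z = 0
  · rw [hz, zero_pow hS.T_pos.ne'] at h
    have hw := pow_eq_zero_iff hS.T_pos.ne' |>.1 h.symm
    exact ⟨0, by simp [hz, hw]⟩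
  · have : NeZero S.T := ⟨hS.T_pos.ne'⟩
    obtain ⟨i, -, hi⟩ := hS.primitive.eq_pow_of_pow_eq_one
      (show (w / z) ^ S.T = 1 by rw [div_pow, h, div_self (h ▸ pow_ne_zero _ hz)])
    exact ⟨i, by dsimp only; rw [hi, div_mul_cancel₀ _ hz]⟩

end ModelData

end TwistFunction

/-! ### The flows of the charges on the Lax matrix -/

section Flow

theorem partialTrace₂_smul {R ι : Type*} [CommRing R] [Algebra ℂ R] [Fintype ι] (a : ℂ)
    (U : Matrix (ι × ι) (ι × ι) R) : partialTrace₂ (a • U) = a • partialTrace₂ U := by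
  ext i j
  simp [partialTrace₂, Finset.smul_sum]

theorem partialTrace₂_add {R ι : Type*} [CommRing R] [Fintype ι]
    (U V : Matrix (ι × ι) (ι × ι) R) :
    partialTrace₂ (U + V) = partialTrace₂ U + partialTrace₂ V := by
  ext i j
  simp [partialTrace₂, Finset.sum_add_distrib]

theorem map_algebraMap_smul {R ι : Type*} [CommRing R] [Algebra ℂ R] (a : ℂ)
    (U : Matrix ι ι ℂ) : (a • U).map (algebraMap ℂ R) = a • U.map (algebraMap ℂ R) := by
  ext i j
  simp [Algebra.smul_def]

variable {𝒜 ι κ : Type*} [CommRing 𝒜] [Algebra ℂ 𝒜] [LocalPoissonAlgebra 𝒜]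
    [Fintype ι] [DecidableEq ι] [Fintype κ] [DecidableEq κ]
variable {S : ModelData 𝒜 ι κ}

open LocalPoissonAlgebra (prod der)

theorem prod_aeval_trace (N : ℕ) (c : 𝒜) (X : Matrix ι ι 𝒜) {n : ℕ} {p : MvPolynomial ℕ ℂ}
    (hp : p ∈ MvPolynomial.supported ℂ {k | k < n}) :
    prod N c (MvPolynomial.aeval (fun j => (X ^ j).trace) p) =
      ∑ j, ∑ l, prod N c (X j l) * gradient n p X l j := by
  rw [← prodDerivation_apply, derivation_aeval_trace _ _ hp, Matrix.trace, Finset.sum_comm]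
  refine Finset.sum_congr rfl fun l _ => ?_
  rw [Matrix.diag_apply, Matrix.mul_apply]
  exact Finset.sum_congr rfl fun j _ => mul_comm _ _

namespace ModelData

omit [DecidableEq κ] in
theorem prod_field_current (N : ℕ) (μ w : ℂ) (z : ℂ) (n : ℕ) (i k : ι) :
    prod N (S.field μ i k) (MvPolynomial.aeval (fun j => (S.field w ^ j).trace)
      (S.currentPoly z n)) =
    (S.phi μ * S.phi w) • partialTrace₂
      (Matrix.kroneckerMap (fun a b => prod N a b) (S.lax μ) (S.lax w) *
        ((1 : Matrix ι ι 𝒜) ⊗ₖ gradient (n + 1) (S.currentPoly z n) (S.field w))) i k := by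
  rw [prod_aeval_trace _ _ _ (currentPoly_mem_supported z n), partialTrace₂_mul_apply,
    Finset.smul_sum]
  refine Finset.sum_congr rfl fun j _ => ?_
  rw [Finset.smul_sum]
  refine Finset.sum_congr rfl fun l _ => ?_
  rw [← smul_mul_assoc, Matrix.kroneckerMap_apply]
  congr 1
  rw [field_eq, field_eq, Matrix.smul_apply, Matrix.smul_apply, map_smul, map_smul,
    LinearMap.smul_apply, smul_smul, mul_comm]

/-- `Tr₂ (𝓡⁰₁₂(μ, w) X(w)₂)` for the gradient `X` of `𝓦ₙ`. -/
def laxPair (S : ModelData 𝒜 ι κ) (z : ℂ) (n : ℕ) (μ w : ℂ) : Matrix ι ι 𝒜 :=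
  partialTrace₂ ((S.R0 μ w).map (algebraMap ℂ 𝒜) *
    ((1 : Matrix ι ι 𝒜) ⊗ₖ gradient (n + 1) (S.currentPoly z n) (S.field w)))

/-- `Tr₂ (𝓡⁰₂₁(w, μ) X(w)₂)` for the gradient `X` of `𝓦ₙ`. -/
def laxPairFlip (S : ModelData 𝒜 ι κ) (z : ℂ) (n : ℕ) (μ w : ℂ) : Matrix ι ι 𝒜 :=
  partialTrace₂ ((flip₁₂ (S.R0 w μ)).map (algebraMap ℂ 𝒜) *
    ((1 : Matrix ι ι 𝒜) ⊗ₖ gradient (n + 1) (S.currentPoly z n) (S.field w)))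

/-- The terms with `𝓡⁰₁₂` give the expected flow before extraction of a coefficient. The term with
`𝓡⁰₂₁` survives only with a factor `φ(w)`, which will suppress it at the zero. -/
theorem prod_zero_current_field (hS : IsRSSystem S) (z : ℂ) (n : ℕ) {μ w : ℂ} (hμ : μ ∈ S.dom)
    (hw : w ∈ S.dom) (hμ0 : S.phi μ ≠ 0) (hw0 : S.phi w ≠ 0) (h : μ ^ S.T ≠ w ^ S.T) (i k : ι) :
    prod 0 (MvPolynomial.aeval (fun j => (S.field w ^ j).trace) (S.currentPoly z n))
      (S.field μ i k) =
    (-⁅S.laxPair z n μ w, S.field μ⁆ + S.phi μ • (S.laxPair z n μ w).map der) i k +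
      S.phi w • der (S.laxPairFlip z n μ w i k) := by
  obtain ⟨h0, h1, h2⟩ := hS.bracket μ hμ w hw hμ0 hw0 h
  beta_reduce at h0 h1 h2
  have e12 : (S.R μ w).map (algebraMap ℂ 𝒜) =
      (S.phi w)⁻¹ • (S.R0 μ w).map (algebraMap ℂ 𝒜) := map_algebraMap_smul _ _
  have e21 : (flip₁₂ (S.R w μ)).map (algebraMap ℂ 𝒜) =
      (S.phi μ)⁻¹ • (flip₁₂ (S.R0 w μ)).map (algebraMap ℂ 𝒜) :=
    map_algebraMap_smul (S.phi μ)⁻¹ (flip₁₂ (S.R0 w μ))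
  have hcomm : Commute (gradient (n + 1) (S.currentPoly z n) (S.field w)) (S.lax w) := by
    have h3 := (gradient_commute (n + 1) (S.currentPoly z n) (S.field w)).smul_right (S.phi w)⁻¹
    rwa [field_eq, smul_smul, inv_mul_cancel₀ hw0, one_smul, ← field_eq] at h3
  have p0 : prod 0 (S.field μ i k) (MvPolynomial.aeval (fun j => (S.field w ^ j).trace)
      (S.currentPoly z n)) = ⁅S.laxPair z n μ w, S.field μ⁆ i k := by
    rw [prod_field_current, h0, sub_mul, partialTrace₂_sub, partialTrace₂_lie_left,
      partialTrace₂_lie_right _ hcomm, sub_zero, e12, smul_mul_assoc, partialTrace₂_smul,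
      ← laxPair, field_eq μ, lie_complex_smul, Matrix.smul_apply, Ring.lie_def, Ring.lie_def,
      smul_mul_assoc, mul_smul_comm, ← smul_sub, Matrix.smul_apply, smul_smul, mul_assoc,
      mul_inv_cancel₀ hw0, mul_one]
  have p1 : prod 1 (S.field μ i k) (MvPolynomial.aeval (fun j => (S.field w ^ j).trace)
      (S.currentPoly z n)) =
      S.phi μ • S.laxPair z n μ w i k + S.phi w • S.laxPairFlip z n μ w i k := by
    rw [prod_field_current, h1, add_mul, partialTrace₂_add, e12, e21, smul_mul_assoc,
      smul_mul_assoc, partialTrace₂_smul, partialTrace₂_smul, ← laxPair, ← laxPairFlip,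
      Matrix.add_apply, Matrix.smul_apply, Matrix.smul_apply, smul_add, smul_smul, smul_smul,
      mul_inv_cancel_right₀ hw0, mul_right_comm, mul_inv_cancel₀ hμ0, one_mul]
  have p2 : ∀ N, 2 ≤ N → prod N (S.field μ i k) (MvPolynomial.aeval
      (fun j => (S.field w ^ j).trace) (S.currentPoly z n)) = 0 := fun N hN => by
    rw [prod_field_current, h2 N hN, zero_mul]
    simp [partialTrace₂]
  -- The Leibniz rule acts on the second argument, so the products were computed with the current
  -- there. Skew-symmetry reverses them, and the first product turns into a total derivative.
  rw [prod_zero_eq p2, p0, p1, map_add, Derivation.map_smul, Derivation.map_smul, Matrix.add_apply,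
    Matrix.neg_apply, Matrix.smul_apply, Matrix.map_apply, add_assoc]

theorem sub_inv_mul_ne_zero (hS : IsRSSystem S) {z μ : ℂ} (hμ : μ ∉ S.orbit z) (k : ℕ) :
    z - (S.ω ^ k)⁻¹ * μ ≠ 0 := fun h => hμ ⟨k, by
  dsimp only
  rw [sub_eq_zero.1 h, mul_inv_cancel_left₀ (pow_ne_zero k (omega_ne_zero hS))]⟩

theorem laxPair_hasExpansionAt (hS : IsRSSystem S) {z : ℂ} (hz : S.IsRegularZero z) {n : ℕ}
    (hn : n ∈ S.degrees z) {μ : ℂ} (hμ : μ ∉ S.orbit z) :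
    MatHasExpansionAt (S.laxPair z n μ) z (S.MExpansion z n μ) := by
  obtain ⟨b, Q, hb, -⟩ := hS.exists_twist
  rw [MExpansion_eq hS hb hn]
  have hY := current_hasExpansionAt hz n
  have h := (MatHasExpansionAt.sum (Finset.range S.T) fun k _ => MatHasExpansionAt.smul
    (HasExpansionAt.scalar (𝒜 := 𝒜) (f := fun w => (w - (S.ω ^ k)⁻¹ * μ)⁻¹) (z := z) (by
      have := sub_inv_mul_ne_zero hS hμ k
      fun_prop (disch := assumption))) (hY.twist_pow b Q k)).const_smul (S.T : ℂ)⁻¹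
  have e : ∀ k, taylor (fun w => (w - (S.ω ^ k)⁻¹ * μ)⁻¹) z =
      (PowerSeries.C (z - (S.ω ^ k)⁻¹ * μ) + PowerSeries.X)⁻¹ := fun k =>
    taylor_inv (sub_inv_mul_ne_zero hS hμ k)
  simp only [e] at h
  convert h using 1
  funext w
  have hR : (S.R0 μ w).map (algebraMap ℂ 𝒜) =
      S.cyclicSum fun k => algebraMap ℂ 𝒜 (w - (S.ω ^ k)⁻¹ * μ)⁻¹ :=
    S.cyclicSum_map (Algebra.ofId ℂ 𝒜) _
  rw [laxPair, hR, partialTrace₂_cyclicSum_gradient hb]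
  congr 1
  refine Finset.sum_congr rfl fun k _ => ?_
  congr 2
  exact hS.casimirMap_gradient hn _

/-- Holomorphy is all that is needed of this matrix, since it enters multiplied by `φ`. -/
theorem laxPairFlip_isRegularAt (hS : IsRSSystem S) {z : ℂ} (hz : S.IsRegularZero z) (n : ℕ)
    {μ : ℂ} (hμ : μ ∉ S.orbit z) : MatIsRegularAt (S.laxPairFlip z n μ) z := by
  have hω := omega_ne_zero hS
  have h0 : ∀ k : ℕ, μ - (S.ω ^ k)⁻¹ * z ≠ 0 := fun k h0 => by
    have h1 : z ^ S.T = μ ^ S.T := by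
      rw [sub_eq_zero.1 h0, mul_pow, inv_pow, ← pow_mul, mul_comm k, pow_mul,
        hS.primitive.pow_eq_one, one_pow, inv_one, one_mul]
    exact hμ (mem_orbit_of_pow_eq hS h1)
  intro i k
  have hG := ((field_hasExpansionAt hz).gradient (n + 1) (S.currentPoly z n)).isRegularAt
  have h : ∀ x y : ι × ι, AnalyticAt ℂ (fun w => S.R0 w μ x y) z := by
    intro x y
    have e : (fun w => S.R0 w μ x y) = fun w => (S.T : ℂ)⁻¹ * ∑ k ∈ Finset.range S.T,
        (μ - (S.ω ^ k)⁻¹ * w)⁻¹ * S.twistedCasimir k x y := by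
      funext w
      simp [R0, cyclicSum, Matrix.sum_apply]
    rw [e]
    refine analyticAt_const.mul (Finset.analyticAt_fun_sum _ fun k _ => ?_)
    have := h0 k
    fun_prop (disch := assumption)
  have h2 := IsRegularAt.sum Finset.univ fun j _ => IsRegularAt.sum Finset.univ fun l _ =>
    (HasExpansionAt.scalar (𝒜 := 𝒜) (h (j, i) (l, k))).isRegularAt.mul (hG l j)
  convert h2 using 1
  funext w
  rw [laxPairFlip, partialTrace₂_mul_apply]
  rfl

/-- The flow of the density `𝓚ₙ` on the Lax matrix. -/
theorem map_prod_field (hS : IsRSSystem S) {z : ℂ} (hz : S.IsRegularZero z) {n : ℕ}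
    (hn : n ∈ S.degrees z) {μ : ℂ} (hμ : μ ∈ S.dom) (hμ0 : S.phi μ ≠ 0) (hμz : μ ∉ S.orbit z) :
    (S.field μ).map (prod 0 (S.K z n)) =
      -⁅S.M z n μ, S.field μ⁆ + S.phi μ • (S.M z n μ).map der := by
  ext i k
  -- An entry of the right-hand side depends linearly on the Lax pair, so its expansion follows from
  -- that of the pair.
  have hℓ : ∃ ℓ : Matrix ι ι 𝒜 →ₗ[ℂ] 𝒜,
      ∀ X, ℓ X = (-⁅X, S.field μ⁆ + S.phi μ • X.map der) i k := by
    refine ⟨Matrix.entryLinearMap ℂ 𝒜 i k ∘ₗ (LinearMap.mulLeft ℂ (S.field μ) -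
      LinearMap.mulRight ℂ (S.field μ) +
      S.phi μ • (der : Derivation ℂ 𝒜 𝒜).toLinearMap.mapMatrix), fun X => ?_⟩
    rw [Ring.lie_def, neg_sub]
    rfl
  obtain ⟨ℓ, hℓ⟩ := hℓ
  obtain ⟨t, ht⟩ := ((laxPairFlip_isRegularAt hS hz n hμz).map
    (der : Derivation ℂ 𝒜 𝒜).toLinearMap).exists_expansion
  have hW := (WExpansion_hasExpansionAt hz n).linearMap ((prod 0).flip (S.field μ i k))
  have hR := ((laxPair_hasExpansionAt hS hz hn hμz).matrix_linearMap ℓ).add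
    ((ht i k).smul (analyticAt_phi hz))
  have hT : ∀ᶠ w in 𝓝[≠] z, μ ^ S.T ≠ w ^ S.T := by
    have h1 : Filter.Tendsto (fun w => w ^ S.T) (𝓝[≠] z) (𝓝 (z ^ S.T)) :=
      ((continuous_pow S.T).tendsto z).mono_left nhdsWithin_le_nhds
    have h2 : z ^ S.T ≠ μ ^ S.T := fun h => hμz (mem_orbit_of_pow_eq hS h)
    filter_upwards [h1.eventually_ne h2] with w hw
    exact hw.symm
  -- Both sides are expanded in the parameter `w` of the current, with `μ` fixed; the coefficient of
  -- order `rₙ` is the claim.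
  have h := hW.unique (hR.congr (by
    filter_upwards [eventually_mem_dom hS z, eventually_phi_ne_zero hS z, hT] with w h1 h2 h3
    rw [hℓ]
    exact prod_zero_current_field hS z n hμ h1 hμ0 h2 h3 i k))
  have h1 := congrArg (PowerSeries.coeff (S.r z n)) h
  rw [map_add, PowerSeries.coeff_mk, PowerSeries.coeff_mk, PowerSeries.coeff_mul,
    Finset.sum_eq_zero, add_zero, hℓ] at h1
  · exact h1
  -- The remaining term contains only coefficients of `φ` of order at most `rₙ`, and these are zero.
  · intro x hx
    rw [Finset.HasAntidiagonal.mem_antidiagonal] at hx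
    rw [PowerSeries.coeff_map, coeff_taylor_phi hS hz hn (by omega), map_zero, zero_mul]

end ModelData

end Flow

/-! ### The zero-curvature equation -/

section ZeroCurvatureAlgebra

variable {R ι : Type*} [CommRing R] [Algebra ℂ R] [Fintype ι] [DecidableEq ι]

omit [Fintype ι] [DecidableEq ι] in
theorem map_derivation_add (D : Derivation ℂ R R) (X Y : Matrix ι ι R) :
    (X + Y).map D = X.map D + Y.map D := by
  ext i j
  exact map_add D _ _

/-- The zero-curvature expression in terms of the regular parts of the matrices. -/
theorem zeroCurvature_regular_part (c : CurrentKind) (m n : ℕ) {X : Matrix ι ι R}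
    (hX : c = .generating → X.trace = 0) (D E d : Derivation ℂ R R) (M N : Matrix ι ι R)
    (φ a b : ℂ) (hD : X.map D = -⁅M, X⁆ + φ • M.map d) (hE : X.map E = -⁅N, X⁆ + φ • N.map d) :
    N.map D - M.map E + ⁅M, N⁆ =
      (N + b • current c m X).map D - (M + a • current c n X).map E +
        ⁅M + a • current c n X, N + b • current c m X⁆ -
        (b * φ) • dCurrent c m X ((M + a • current c n X).map d) +
        (a * φ) • dCurrent c n X ((N + b • current c m X).map d) +
        (a * b * φ) • (dCurrent c m X (dCurrent c n X (X.map d)) -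
          dCurrent c n X (dCurrent c m X (X.map d))) := by
  have hc := current_commute_current c m n X
  -- The flow of a current: equivariance turns its commutator part into a commutator with the
  -- current, so the Hessian survives only with a factor `φ`.
  have h1 : ∀ (k : ℕ) (B : Matrix ι ι R), dCurrent c k X (-⁅B, X⁆ + φ • B.map d) =
      -⁅B, current c k X⁆ + φ • dCurrent c k X (B.map d) := fun k B => by
    rw [dCurrent_add, dCurrent_smul, ← neg_one_smul ℂ, dCurrent_smul, dCurrent_lie, neg_one_smul]
  -- The term of order `a * b`, which has the highest pole, drops out because the currents commute.
  have h2 : ⁅M + a • current c n X, N + b • current c m X⁆ =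
      ⁅M, N⁆ + b • ⁅M, current c m X⁆ - a • ⁅N, current c n X⁆ := by
    rw [← sub_eq_zero]
    have h3 : current c n X * current c m X = current c m X * current c n X := hc
    simp only [Ring.lie_def, add_mul, mul_add, smul_mul_assoc, mul_smul_comm, h3]
    module
  rw [h2]
  simp only [map_derivation_add, map_derivation_const_smul, map_derivation_current c _ _ hX, hD, hE,
    h1, dCurrent_add, dCurrent_smul]
  module

end ZeroCurvatureAlgebra

/-! ### The curvature as a function of the spectral parameter. -/

section ZeroCurvature

variable {𝒜 ι κ : Type*} [CommRing 𝒜] [Algebra ℂ 𝒜] [LocalPoissonAlgebra 𝒜]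
    [Fintype ι] [DecidableEq ι] [Fintype κ] [DecidableEq κ]
variable {S : ModelData 𝒜 ι κ}

open LocalPoissonAlgebra (prod der)

namespace ModelData

/-- The curvature of the connection of two commuting flows. -/
def curvature (S : ModelData 𝒜 ι κ) (z : ℂ) (n : ℕ) (w : ℂ) (m : ℕ) (ρ : ℂ) : Matrix ι ι 𝒜 :=
  (S.M w m ρ).map (prod 0 (S.K z n)) - (S.M z n ρ).map (prod 0 (S.K w m)) +
    ⁅S.M z n ρ, S.M w m ρ⁆

omit [DecidableEq κ] in
theorem curvature_symm (z : ℂ) (n : ℕ) (w : ℂ) (m : ℕ) (ρ : ℂ) :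
    S.curvature w m z n ρ = (-1 : ℂ) • S.curvature z n w m ρ := by
  rw [curvature, curvature, Ring.lie_def, Ring.lie_def]
  module

theorem curvature_omega_mul (hS : IsRSSystem S) {b : Bool} {Q : GL ι ℂ} (hb : S.IsTwist b Q)
    {z : ℂ} {n : ℕ} (hn : n ∈ S.degrees z) {w : ℂ} {m : ℕ} (hm : m ∈ S.degrees w) (ρ : ℂ) :
    S.curvature z n w m (S.ω * ρ) = twist 𝒜 b Q (S.curvature z n w m ρ) := by
  rw [curvature, curvature, M_omega_mul hS hb hn, M_omega_mul hS hb hm, twist_map, twist_map,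
    map_add, map_sub, twist_lie]

theorem curvature_isProperOff (hS : IsRSSystem S) {z : ℂ} {n : ℕ} (hn : n ∈ S.degrees z) {w : ℂ}
    {m : ℕ} (hm : m ∈ S.degrees w) (i j : ι) :
    IsProperOff (S.orbit z ∪ S.orbit w) fun ρ => S.curvature z n w m ρ i j := by
  have h1 := fun i j => (M_isProperOff hS hn i j).mono (Set.subset_union_left (t := S.orbit w))
  have h2 := fun i j => (M_isProperOff hS hm i j).mono (Set.subset_union_right (s := S.orbit z))
  have h := (((h2 i j).linearMap (prod 0 (S.K z n))).sub
    ((h1 i j).linearMap (prod 0 (S.K w m)))).add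
    ((IsProperOff.sum Finset.univ fun k _ => (h1 i k).mul (h2 k j)).sub
      (IsProperOff.sum Finset.univ fun k _ => (h2 i k).mul (h1 k j)))
  convert h using 1
  funext ρ
  rw [curvature, Ring.lie_def]
  simp only [Matrix.add_apply, Matrix.sub_apply, Matrix.map_apply, Matrix.mul_apply]

theorem isRegularAt_phi_div (hS : IsRSSystem S) {z : ℂ} (hz : S.IsRegularZero z) {n : ℕ}
    (hn : n ∈ S.degrees z) :
    IsRegularAt (fun w => ((w - z) ^ (S.r z n + 1))⁻¹ * S.phi w) z :=
  (HasExpansionAt.of_analyticAt (analyticAt_phi hz)).div_pow fun _ hj =>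
    coeff_taylor_phi hS hz hn (Nat.lt_succ_iff.1 hj)

theorem trace_field (hS : IsRSSystem S) {z : ℂ} (h : S.kind z = .generating) (w : ℂ) :
    (S.field w).trace = 0 :=
  hS.trace_toMatrix (type_of_kind (z := z) (by rw [h]; nofun)) _

/-- For inner `σ`, equivariance allows a nonzero coefficient of order `j` only if `T` divides `j + n
- 1`. Since `T` divides `n + rₙ`, this means `j ≡ rₙ + 1` modulo `T`, which no `j ≤ rₙ` satisfies
when `rₙ + 1 < T`. -/
theorem coeff_trace_pow_eq_zero (hS : IsRSSystem S) {z : ℂ} (hz : S.IsRegularZero z)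
    (hk : S.kind z = .traceless) {n : ℕ} (hn : n ∈ S.degrees z) {j : ℕ} (hj : j < S.r z n + 1) :
    PowerSeries.coeff j (S.SExpansion z ^ (n - 1)).trace = 0 := by
  obtain ⟨hc, hconj⟩ := of_kind_traceless hk
  obtain rfl := hc.2
  have hω := omega_ne_zero hS
  obtain ⟨b, Q, hb, hε⟩ := hS.exists_twist
  have hκ : S.kappa = 1 := by rw [kappa, if_pos hconj]
  have hε : twistSign b = 1 := by
    rw [hκ, pow_one] at hε
    exact mul_right_cancel₀ hω (hε.trans (one_mul _).symm)
  have hT := ((field_hasExpansionAt hz).pow (n - 1)).trace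
  have h := coeff_eq_of_comp_mul hT hω (hT.const_smul (S.ω⁻¹ ^ (n - 1))) (by
    filter_upwards [eventually_field_omega_mul hS hb] with w hw
    rw [hw, trace_twist_smul_pow, hε, mul_one]) j
  rw [PowerSeries.coeff_smul] at h
  have h1 : S.ω ^ j ≠ S.ω⁻¹ ^ (n - 1) := by
    intro h1
    have h2 : S.ω ^ (j + (n - 1)) = 1 := by
      rw [pow_add, h1, ← mul_pow, inv_mul_cancel₀ hω, one_pow]
    have h3 := (hS.primitive.pow_eq_one_iff_dvd _).1 h2
    have h4 := dvd_add_r hS hc n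
    rw [hκ, mul_one] at h4
    have h5 := hn.1
    -- The difference is `rₙ + 1 - j`, which lies strictly between `0` and `T`.
    have h6 := (Nat.dvd_sub h4 h3)
    have h7 := Nat.le_of_dvd (by omega) h6
    have h8 := hn.2.2 hc
    have h9 := r_lt hS 0 n
    omega
  have h2 : (S.ω ^ j - S.ω⁻¹ ^ (n - 1)) • PowerSeries.coeff j (S.SExpansion 0 ^ (n - 1)).trace = 0 := by
    rw [sub_smul, h, sub_self]
  exact (smul_eq_zero_iff_right (sub_ne_zero.2 h1)).1 h2

theorem isRegularAt_der_trace_div (hS : IsRSSystem S) {z : ℂ} (hz : S.IsRegularZero z)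
    (hk : S.kind z = .traceless) {n : ℕ} (hn : n ∈ S.degrees z) :
    IsRegularAt (fun w => ((w - z) ^ (S.r z n + 1))⁻¹ • der (S.field w ^ (n - 1)).trace) z := by
  refine HasExpansionAt.div_pow ((((field_hasExpansionAt hz).pow (n - 1)).trace).linearMap
    (der : Derivation ℂ 𝒜 𝒜).toLinearMap) fun j hj => ?_
  rw [PowerSeries.coeff_mk, coeff_trace_pow_eq_zero hS hz hk hn hj, map_zero]

/-- The commutator of the Hessians of two currents is regular after division by the poles. -/
theorem hessian_isRegularAt (hS : IsRSSystem S) {z : ℂ} (hz : S.IsRegularZero z) {n m : ℕ}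
    (hn : n ∈ S.degrees z) (hm : m ∈ S.degrees z) :
    MatIsRegularAt (fun w => ((((w - z) ^ (S.r z n + 1))⁻¹) * ((w - z) ^ (S.r z m + 1))⁻¹ * S.phi w) •
      (dCurrent (S.kind z) m (S.field w) (dCurrent (S.kind z) n (S.field w) ((S.field w).map der)) -
        dCurrent (S.kind z) n (S.field w)
          (dCurrent (S.kind z) m (S.field w) ((S.field w).map der)))) z := by
  by_cases hk : S.kind z = .traceless
  · have hF := field_hasExpansionAt hz
    -- Each part of the commutator distributes its two poles: one is absorbed by `φ`, the other by
    -- the differentiated trace.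
    have hterm : ∀ {n m : ℕ}, n ∈ S.degrees z → m ∈ S.degrees z → ∀ c : ℂ,
        MatIsRegularAt (fun w => (((w - z) ^ (S.r z n + 1))⁻¹ * S.phi w) •
          ((((w - z) ^ (S.r z m + 1))⁻¹ • der (S.field w ^ (m - 1)).trace) •
            c • traceless 𝒜 ι (S.field w ^ (n - 1 - 1)))) z := fun hn hm c =>
      (((hF.pow _).traceless.isRegularAt.const_smul c).smul
        (isRegularAt_der_trace_div hS hz hk hm)).scalar_smul (isRegularAt_phi_div hS hz hn)
    refine ((hterm hn hm (((m * n * (n - 1 : ℕ) : ℕ) : ℂ) * (Fintype.card ι : ℂ)⁻¹)).sub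
      (hterm hm hn (((m * n * (m - 1 : ℕ) : ℕ) : ℂ) * (Fintype.card ι : ℂ)⁻¹))).congr (Filter.Eventually.of_forall fun w => ?_)
    rw [hk, dCurrent_comm_traceless m n der (S.field w), smul_sub]
    congr 1
    · rw [smul_assoc _ (der _), smul_smul]
      congr 1
      ring
    · rw [smul_assoc _ (der _), smul_smul]
      congr 1
      ring
  -- For the other two kinds of currents the Hessians commute, so nothing remains.
  · refine (MatIsRegularAt.const 0 z).congr (Filter.Eventually.of_forall fun w => ?_)
    rw [dCurrent_comm hk hm.1 hn.1 (fun h => hS.card_ne_zero (type_of_kind (by rw [h]; nofun)))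
      (fun h => trace_field hS h w), sub_self, smul_zero]

theorem curvature_isRegularAt (hS : IsRSSystem S) {z : ℂ} (hz : S.IsRegularZero z) {n : ℕ}
    (hn : n ∈ S.degrees z) {w₀ : ℂ} (hw₀ : S.IsRegularZero w₀) {m : ℕ} (hm : m ∈ S.degrees w₀)
    (h : w₀ = z ∨ z ∉ S.orbit w₀) : MatIsRegularAt (S.curvature z n w₀ m) z := by
  obtain ⟨c, hBn⟩ := exists_regular_part hS hz hn
  -- If `z` is off the orbit of `w₀`, the second matrix is regular at `z` and `c' = 0` brings this
  -- case into the same form; the values of `s` and of the kind at `z` are then immaterial.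
  have hm' : ∃ c' : ℂ, ∃ s : ℕ, MatIsRegularAt (fun w => S.M w₀ m w +
      (c' * ((w - z) ^ (s + 1))⁻¹) • current (S.kind z) m (S.field w)) z ∧
      (c' = 0 ∨ m ∈ S.degrees z ∧ s = S.r z m) := by
    rcases h with rfl | h
    · obtain ⟨c', hc'⟩ := exists_regular_part hS hw₀ hm
      exact ⟨c', _, hc', Or.inr ⟨hm, rfl⟩⟩
    · refine ⟨0, 0, fun i j => ?_, Or.inl rfl⟩
      simpa using (M_isProperOff hS hm i j).isRegularAt h
  obtain ⟨c', s, hBm, hc'⟩ := hm'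
  have hF := (field_hasExpansionAt hz).isRegularAt
  have hbφ : IsRegularAt (fun w => c' * ((w - z) ^ (s + 1))⁻¹ * S.phi w) z := by
    rcases hc' with rfl | ⟨h1, rfl⟩
    · simpa using IsRegularAt.const (0 : ℂ) z
    · simpa only [mul_assoc, smul_eq_mul] using (isRegularAt_phi_div hS hz h1).const_smul c'
  have haφ : IsRegularAt (fun w => c * ((w - z) ^ (S.r z n + 1))⁻¹ * S.phi w) z := by
    simpa only [mul_assoc, smul_eq_mul] using (isRegularAt_phi_div hS hz hn).const_smul c
  have hH : MatIsRegularAt (fun w => (c * ((w - z) ^ (S.r z n + 1))⁻¹ *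
      (c' * ((w - z) ^ (s + 1))⁻¹) * S.phi w) •
      (dCurrent (S.kind z) m (S.field w) (dCurrent (S.kind z) n (S.field w) ((S.field w).map der)) -
        dCurrent (S.kind z) n (S.field w)
          (dCurrent (S.kind z) m (S.field w) ((S.field w).map der)))) z := by
    rcases hc' with rfl | ⟨h1, rfl⟩
    · simpa using MatIsRegularAt.const (0 : Matrix ι ι 𝒜) z
    · refine ((hessian_isRegularAt hS hz hn h1).const_smul (c * c')).congr
        (Filter.Eventually.of_forall fun w => ?_)
      rw [smul_smul]
      congr 1
      ring
  have hder := fun {G : ℂ → Matrix ι ι 𝒜} (hG : MatIsRegularAt G z) =>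
    hG.map (der : Derivation ℂ 𝒜 𝒜).toLinearMap
  refine ((((((hBm.map (prod 0 (S.K z n))).sub (hBn.map (prod 0 (S.K w₀ m)))).add
    (hBn.lie hBm)).sub ((hF.dCurrent (hder hBn) (S.kind z) m).scalar_smul hbφ)).add
    ((hF.dCurrent (hder hBm) (S.kind z) n).scalar_smul haφ)).add hH).congr ?_
  -- The flow formulas hold where the Lax matrix is defined, `φ` does not vanish and neither orbit
  -- is met, that is, in a punctured neighbourhood of `z`.
  filter_upwards [eventually_mem_dom hS z, eventually_phi_ne_zero hS z,
    eventually_notMem_of_finite (orbit_finite hS z) z,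
    eventually_notMem_of_finite (orbit_finite hS w₀) z] with w h1 h2 h3 h4
  exact zeroCurvature_regular_part (S.kind z) m n (fun hk => trace_field hS hk w)
    (prodDerivation 0 (S.K z n)) (prodDerivation 0 (S.K w₀ m)) der (S.M z n w) (S.M w₀ m w)
    (S.phi w) _ _ (map_prod_field hS hz hn h1 h2 h3) (map_prod_field hS hw₀ hm h1 h2 h4)

/-- Equivariance of the curvature carries regularity from a point to its whole orbit, so only the
chosen representatives need a local analysis. -/
theorem curvature_isRegularAt_orbit (hS : IsRSSystem S) {z : ℂ} {n : ℕ} (hn : n ∈ S.degrees z)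
    {w : ℂ} {m : ℕ} (hm : m ∈ S.degrees w) {u : ℂ} (h : MatIsRegularAt (S.curvature z n w m) u)
    {v : ℂ} (hv : v ∈ S.orbit u) : MatIsRegularAt (S.curvature z n w m) v := by
  obtain ⟨k, rfl⟩ := hv
  obtain ⟨b, Q, hb, -⟩ := hS.exists_twist
  have hω := omega_ne_zero hS
  induction k with
  | zero => simpa using h
  | succ k ih =>
    have h1 : MatIsRegularAt (fun ρ => S.curvature z n w m (S.ω⁻¹ * ρ)) (S.ω ^ (k + 1) * u) :=
      fun i j => IsRegularAt.comp_mul (F := fun ρ => S.curvature z n w m ρ i j) (inv_ne_zero hω) (by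
        have h2 := ih i j
        rwa [pow_succ', mul_assoc, inv_mul_cancel_left₀ hω])
    obtain ⟨t, ht⟩ := h1.exists_expansion
    refine (ht.twist_pow b Q 1).isRegularAt.congr (Filter.Eventually.of_forall fun ρ => ?_)
    rw [pow_one, ← curvature_omega_mul hS hb hn hm, mul_inv_cancel_left₀ hω]

theorem curvature_eq_zero (hS : IsRSSystem S) {z : ℂ} (hz : S.IsRegularZero z) {n : ℕ}
    (hn : n ∈ S.degrees z) {w : ℂ} (hw : S.IsRegularZero w) {m : ℕ} (hm : m ∈ S.degrees w)
    (h : z = w ∨ z ∉ S.orbit w ∧ w ∉ S.orbit z) {ρ : ℂ} (hρz : ρ ∉ S.orbit z)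
    (hρw : ρ ∉ S.orbit w) : S.curvature z n w m ρ = 0 := by
  have h1 := curvature_isRegularAt hS hz hn hw hm (h.imp Eq.symm And.left)
  -- Exchanging the two flows changes the sign of the curvature, which reduces regularity at `w` to
  -- the case already treated.
  have h2 : MatIsRegularAt (S.curvature z n w m) w :=
    ((curvature_isRegularAt hS hw hm hz hn (h.imp id And.right)).const_smul (-1)).congr
      (Filter.Eventually.of_forall fun ρ => curvature_symm w m z n ρ)
  ext i j
  refine (curvature_isProperOff hS hn hm i j).eq_zero
    ((orbit_finite hS z).union (orbit_finite hS w)) ?_ (by simp [hρz, hρw])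
  rintro v (hv | hv)
  · exact curvature_isRegularAt_orbit hS hn hm h1 hv i j
  · exact curvature_isRegularAt_orbit hS hn hm h2 hv i j

end ModelData

end ZeroCurvature

end RSHierarchy

end

theorem mainTheorem9 {𝒜 ι κ : Type*} [CommRing 𝒜] [Algebra ℂ 𝒜]
    [RSHierarchy.LocalPoissonAlgebra 𝒜] [Fintype ι] [DecidableEq ι] [Fintype κ] [DecidableEq κ]
    (S : RSHierarchy.ModelData 𝒜 ι κ) (hS : RSHierarchy.IsRSSystem S)
    (Z : Set ℂ) (hZ : ∀ z ∈ Z, S.IsRegularZero z)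
    (hdisj : ∀ z ∈ Z, ∀ w ∈ Z, z ≠ w → ∀ k : ℕ, w ≠ S.ω ^ k * z)
    (z₀ : ℂ) (hz₀ : z₀ ∈ Z) (w₀ : ℂ) (hw₀ : w₀ ∈ Z)
    (n : ℕ) (hn : n ∈ S.degrees z₀) (m : ℕ) (hm : m ∈ S.degrees w₀)
    (l : ℂ) (hlz : ∀ k : ℕ, l ≠ S.ω ^ k * z₀) (hlw : ∀ k : ℕ, l ≠ S.ω ^ k * w₀) :
    (S.M w₀ m l).map (RSHierarchy.flow (S.Q z₀ n))
      - (S.M z₀ n l).map (RSHierarchy.flow (S.Q w₀ m))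
      + ⁅S.M z₀ n l, S.M w₀ m l⁆ = 0 := by
  have hne : ∀ {u v : ℂ}, u ∈ Z → v ∈ Z → u ≠ v → v ∉ S.orbit u := by
    rintro u v hu hv huv ⟨k, hk⟩
    exact hdisj u hu v hv huv k hk.symm
  -- The flow of the class of a density is by definition the zeroth product with it, so the goal is
  -- `curvature` up to unfolding.
  refine RSHierarchy.ModelData.curvature_eq_zero hS (hZ z₀ hz₀) hn (hZ w₀ hw₀) hm ?_ ?_ ?_
  · by_cases h : z₀ = w₀
    · exact Or.inl h
    · exact Or.inr ⟨hne hw₀ hz₀ (Ne.symm h), hne hz₀ hw₀ h⟩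
  · rintro ⟨k, hk⟩
    exact hlz k hk.symm
  · rintro ⟨k, hk⟩
    exact hlw k hk.symm
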